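/- **Setting.** Let $d\ge 1$, and let $X_1,X_2,\ldots$ be i.i.d. random vectors in $\mathbb{R}^d$ with a density $f$. Assume that $f$ has convex compact support $C\subset\mathbb{R}^d$, that $f$ is bounded and bounded away from $0$ on $C$, and that $f$ is differentiable on $C$ with uniformly bounded first-order partial derivatives. Let $j_0\in\mathbb{N}$, $Q=\{1,\ldots,2^d-1\}$, and let $\varphi,\psi^{(q)}:\mathbb{R}^d\to\mathbb{R}$ ($q\in Q$) be bounded with compact support. For a function $h$ on $\mathbb{R}^d$, $j\in\mathbb{N}$ and $z\in\mathbb{Z}^d$ write $h_{j,z}(x)=2^{dj/2}h(2^jx-z)$. Assume that $\{\varphi_{j_0,z},\ \psi^{(q)}_{j,z}:\ j\ge j_0,\ z\in\mathbb{Z}^d,\ q\in Q\}$ is an orthonormal basis of $L_2(\mathbb{R}^d)$. Put $$\alpha_{j,z}=\int_{\mathbb{R}^d}\varphi_{j,z}(x)\sqrt{f(x)}\,dx,\qquad \beta^{(q)}_{j,z}=\int_{\mathbb{R}^d}\psi^{(q)}_{j,z}(x)\sqrt{f(x)}\,dx .$$ For integers $1\le k<n$ and $1\le i\le n$ let $R_{(k);i}$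 be the Euclidean distance from $X_i$ to its $k$-th nearest neighbour among the other points of $\{X_1,\ldots,X_n\}$, let $V_{(k);i}=c_0R_{(k);i}^d$ with $c_0=\pi^{d/2}/\Gamma(d/2+1)$, and define $$\hat\alpha_{j,z}=\frac{\Gamma(k)}{\Gamma(k+1/2)}\frac1{\sqrt n}\sum_{i=1}^n\varphi_{j,z}(X_i)\sqrt{V_{(k);i}},\qquad \hat\beta^{(q)}_{j,z}=\frac{\Gamma(k)}{\Gamma(k+1/2)}\frac1{\sqrt n}\sum_{i=1}^n\psi^{(q)}_{j,z}(X_i)\sqrt{V_{(k);i}} .$$ **Proposition.** For all $j\ge j_0$, $z\in\mathbb{Z}^d$ and $q\in Q$, the estimators $\hat\alpha_{j,z}$ and $\hat\beta^{(q)}_{j,z}$ have finite second moments, and: 1. (Bias) for every fixed integer $k\ge1$, as $n\to\infty$, $$\mathbb{E}(\hat\alpha_{j,z})=\alpha_{j,z}+O(n^{-1/d}),\qquad \mathbb{E}(\hat\beta^{(q)}_{j,z})=\beta^{(q)}_{j,z}+O(n^{-1/d});$$ 2. (Variance) $$\mathrm{Var}(\hat\alpha_{j,z})=k^3\Big(\tfrac{\Gamma(k)}{\Gamma(k+1/2)}\Big)^2O(n^{-1}),\qquad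 \mathrm{Var}(\hat\beta^{(q)}_{j,z})=k^3\Big(\tfrac{\Gamma(k)}{\Gamma(k+1/2)}\Big)^2O(n^{-1}),$$ where the constants implied by $O(n^{-1})$ do not depend on $k$ or $n$ ($1\le k<n$); 3. (Consistency) if $k=k_n\ge1$ is any sequence of integers, constant or varying with $n$, such that $k_n^{3/2}\,\Gamma(k_n)/\Gamma(k_n+1/2)=o(n^{1/2})$, then, as $n\to\infty$, $$\mathbb{E}\big((\hat\alpha_{j,z}-\alpha_{j,z})^2\big)\to0,\qquad \mathbb{E}\big((\hat\beta^{(q)}_{j,z}-\beta^{(q)}_{j,z})^2\big)\to0,$$ and $\hat\alpha_{j,z}\to\alpha_{j,z}$, $\hat\beta^{(q)}_{j,z}\to\beta^{(q)}_{j,z}$ in probability. -/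

import Mathlib

open MeasureTheory ProbabilityTheory Filter Topology Asymptotics

noncomputable section

/-- `R_{(k);i}`: the distance from `x i` to its `k`-th nearest neighbour among the other points of
the sample `x 0, …, x (n-1)`, i.e. the radius of the smallest closed Euclidean ball centred at `x i`
that contains at least `k` other sample points (meaningful for `1 ≤ k < n`, `i < n`). -/
def nnRadius {d : ℕ} (x : ℕ → EuclideanSpace ℝ (Fin d)) (n k i : ℕ) : ℝ :=
  sInf {r : ℝ | 0 ≤ r ∧ k ≤ ((Finset.range n).filter fun l => l ≠ i ∧ ‖x l - x i‖ ≤ r).card}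

/-- The volume `c₀ = π^{d/2} / Γ(d/2 + 1)` of the Euclidean unit ball of `ℝ^d`. -/
def unitBallVol (d : ℕ) : ℝ :=
  Real.pi ^ ((d : ℝ) / 2) / Real.Gamma ((d : ℝ) / 2 + 1)

/-- `V_{(k);i} = c₀ R_{(k);i}^d`. -/
def nnVolume {d : ℕ} (x : ℕ → EuclideanSpace ℝ (Fin d)) (n k i : ℕ) : ℝ :=
  unitBallVol d * nnRadius x n k i ^ d

/-- The rescaled and translated function `h_{j,z}(x) = 2^{dj/2} h(2^j x - z)`. -/
def dilate {d : ℕ} (h : EuclideanSpace ℝ (Fin d) → ℝ) (j : ℕ) (z : Fin d → ℤ) :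
    EuclideanSpace ℝ (Fin d) → ℝ :=
  fun x => (2 : ℝ) ^ ((d : ℝ) * (j : ℝ) / 2) *
    h ((2 : ℝ) ^ j • x - WithLp.toLp 2 (fun i => (z i : ℝ)))

/-- The coefficient `∫ h_{j,z}(x) √f(x) dx` of `√f`. -/
def sqrtCoef {d : ℕ} (f h : EuclideanSpace ℝ (Fin d) → ℝ) (j : ℕ) (z : Fin d → ℤ) : ℝ :=
  ∫ x, dilate h j z x * Real.sqrt (f x)

/-- The factor `Γ(k) / Γ(k + 1/2)`. -/
def gammaRatio (k : ℕ) : ℝ :=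
  Real.Gamma (k : ℝ) / Real.Gamma ((k : ℝ) + 1 / 2)

/-- The estimator
`Γ(k)/Γ(k+1/2) · n^{-1/2} · ∑_{i ≤ n} h_{j,z}(x_i) √V_{(k);i}` computed from the first `n` points
of the sequence `x`. -/
def coefEst {d : ℕ} (h : EuclideanSpace ℝ (Fin d) → ℝ) (j : ℕ) (z : Fin d → ℤ)
    (n k : ℕ) (x : ℕ → EuclideanSpace ℝ (Fin d)) : ℝ :=
  gammaRatio k * (1 / Real.sqrt (n : ℝ)) *
    ∑ i ∈ Finset.range n, dilate h j z (x i) * Real.sqrt (nnVolume x n k i)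

/-- `X 0, X 1, …` are i.i.d. with density `f` on `ℝ^d`. -/
structure IsIIDSample {d : ℕ} {Ω : Type*} [MeasurableSpace Ω] (P : Measure Ω)
    (X : ℕ → Ω → EuclideanSpace ℝ (Fin d)) (f : EuclideanSpace ℝ (Fin d) → ℝ) : Prop where
  measurable : ∀ i, Measurable (X i)
  indep : iIndepFun X P
  law : ∀ i, P.map (X i) = volume.withDensity fun x => ENNReal.ofReal (f x)

/-- The index set of the wavelet system: `z ∈ ℤ^d` for the father wavelets `φ_{j₀,z}`, and
`(j, z, q)` with `j ≥ j₀`, `z ∈ ℤ^d`, `q ∈ Q` (a set of `2^d - 1` elements) for `ψ^{(q)}_{j,z}`. -/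
abbrev WaveletIndex (d j₀ : ℕ) : Type :=
  (Fin d → ℤ) ⊕ ({j : ℕ // j₀ ≤ j} × (Fin d → ℤ) × Fin (2 ^ d - 1))

/-- The system `{φ_{j₀,z}, ψ^{(q)}_{j,z}}`. -/
def waveletSystem {d : ℕ} (φ : EuclideanSpace ℝ (Fin d) → ℝ)
    (ψ : Fin (2 ^ d - 1) → EuclideanSpace ℝ (Fin d) → ℝ) (j₀ : ℕ) :
    WaveletIndex d j₀ → EuclideanSpace ℝ (Fin d) → ℝ
  | Sum.inl z => dilate φ j₀ z
  | Sum.inr (j, z, q) => dilate (ψ q) j z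

/-- `φ` and `ψ^{(q)}` are bounded, have compact support, and the system
`{φ_{j₀,z}, ψ^{(q)}_{j,z} : j ≥ j₀, z ∈ ℤ^d, q ∈ Q}` is an orthonormal basis of `L₂(ℝ^d)`. -/
structure IsWaveletBasis {d : ℕ} (φ : EuclideanSpace ℝ (Fin d) → ℝ)
    (ψ : Fin (2 ^ d - 1) → EuclideanSpace ℝ (Fin d) → ℝ) (j₀ : ℕ) : Prop where
  father_compact : HasCompactSupport φ
  mother_compact : ∀ q, HasCompactSupport (ψ q)
  father_bounded : ∃ M : ℝ, ∀ x, |φ x| ≤ M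
  mother_bounded : ∀ q, ∃ M : ℝ, ∀ x, |ψ q x| ≤ M
  basis : ∃ b : HilbertBasis (WaveletIndex d j₀) ℝ
      (Lp ℝ 2 (volume : Measure (EuclideanSpace ℝ (Fin d)))),
    ∀ i, (b i : EuclideanSpace ℝ (Fin d) → ℝ) =ᵐ[volume] waveletSystem φ ψ j₀ i

/-- `f` has convex compact support `C`, is bounded and bounded away from `0` on `C`, and is
differentiable on `C` (relative to `C`) with uniformly bounded first-order partial derivatives. -/
structure IsRegularDensity {d : ℕ} (f : EuclideanSpace ℝ (Fin d) → ℝ)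
    (C : Set (EuclideanSpace ℝ (Fin d))) : Prop where
  compact : IsCompact C
  convex : Convex ℝ C
  support : tsupport f = C
  lower : ∃ a₁ : ℝ, 0 < a₁ ∧ ∀ x ∈ C, a₁ ≤ f x
  upper : ∃ a₂ : ℝ, ∀ x ∈ C, f x ≤ a₂
  differentiable : DifferentiableOn ℝ f C
  partials : ∃ M : ℝ, ∀ x ∈ C, ∀ i : Fin d,
    |fderivWithin ℝ f C x (EuclideanSpace.single i 1)| ≤ M

end

/-! Let `μ` be the law with density `f`, and let `U` be the `μ`-content of the `k`-th nearest
neighbour ball of a sample point. Spheres are `μ`-null, so given the centre, `U` is distributed as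
the `k`-th order statistic of `n - 1` uniform variables. This law does not depend on the centre,
hence `U` is independent of it (`map_prodMk_ballContent`). Moreover `E U ^ s = Γ(k+s)Γ(n) /
(Γ(k)Γ(n+s))`, so the factor `Γ(k)/Γ(k+1/2)` normalises `√U` up to `√n Γ(n)/Γ(n+1/2)`, which lies in
`[1, 1 + 1/(2n)]` by Wendel's inequalities.

Bias. Let `V` be the volume of the ball of radius `r` around `a`. If the ball lies in `C`, the
Lipschitz property of `f` gives `f a * V = U (1 + O(r))`. Otherwise `a` lies within `r` of the
complement of `C`, where only `f a * V = O(U)` is known. Convexity gives both `r = O(U ^ (1/d))` and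
a boundary layer of probability `O(r)`, so both cases contribute `O(E U ^ (1/2 + 1/d))`. The main
term is `E[(H/√f)(X) √U]`, which factorises by independence, and `∫ H/√f dμ = ∫ H √f`. The resulting
bias is `O((k/n) ^ (1/d))`, uniformly in `k` (`exists_abs_bias_le`).

Variance. The Efron-Stein inequality is applied with the sum computed without the point `x i` as
comparison function. Deleting a point alters at most a constant times `k` radii, by a cone argument,
and each radius is sensitive to at most `k` deletions. All altered terms are dominated by `(k+1)`-st
neighbour volumes, of mean `O(k/n)`. Thus the unnormalised sum has variance `O(k ^ 3)`
(`exists_integral_sq_knnSum_le`).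

Consistency. The mean square error is variance plus squared bias. The growth condition makes the
variance bound vanish, and it forces `k/n → 0` because `k * gammaRatio k ^ 2 ≥ 1`.

The wavelets are measurable only up to null sets, as representatives of elements of `L₂`. A bounded
measurable modification replaces them without changing the estimator almost surely. -/

/-! ### Nearest neighbour radii and the law of the content of their balls. -/

section OrderStatistics

variable {E : Type*} [NormedAddCommGroup E] {ι : Type*}

/-- The number of points `y m`, `m ∈ S`, in the closed ball of radius `r` around `c`. -/
noncomputable def ballCount (y : ι → E) (S : Finset ι) (c : E) (r : ℝ) : ℕ :=
  (S.filter fun m => ‖y m - c‖ ≤ r).card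

/-- The distance from `c` to its `k`-th nearest point among `y m`, `m ∈ S`. -/
noncomputable def kthRadius (y : ι → E) (S : Finset ι) (k : ℕ) (c : E) : ℝ :=
  sInf {r : ℝ | 0 ≤ r ∧ k ≤ ballCount y S c r}

theorem ballCount_mono (y : ι → E) (S : Finset ι) (c : E) {r s : ℝ} (h : r ≤ s) :
    ballCount y S c r ≤ ballCount y S c s :=
  Finset.card_le_card fun _ hm => by
    simp only [Finset.mem_filter] at hm ⊢
    exact ⟨hm.1, hm.2.trans h⟩

theorem ballCount_subset (y : ι → E) {S T : Finset ι} (h : S ⊆ T) (c : E) (r : ℝ) :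
    ballCount y S c r ≤ ballCount y T c r :=
  Finset.card_le_card (Finset.filter_subset_filter _ h)

theorem ballCount_le_card (y : ι → E) (S : Finset ι) (c : E) (r : ℝ) :
    ballCount y S c r ≤ S.card := Finset.card_filter_le _ _

theorem ballCount_eq_card (y : ι → E) (S : Finset ι) (c : E) {r : ℝ}
    (h : ∀ m ∈ S, ‖y m - c‖ ≤ r) : ballCount y S c r = S.card := by
  rw [ballCount, Finset.filter_true_of_mem h]

theorem kthRadius_nonneg (y : ι → E) (S : Finset ι) (k : ℕ) (c : E) : 0 ≤ kthRadius y S k c :=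
  Real.sInf_nonneg fun _ hr => hr.1

/-- The default value of `sInf ∅`. It lets the upper bounds and measurability below hold without
assuming that there are `k` points. -/
theorem kthRadius_eq_zero_of_card_lt (y : ι → E) {S : Finset ι} {k : ℕ} (c : E)
    (h : S.card < k) : kthRadius y S k c = 0 := by
  have : {r : ℝ | 0 ≤ r ∧ k ≤ ballCount y S c r} = ∅ := by
    ext r
    simp only [Set.mem_ofPred_eq, Set.mem_empty_iff_false, iff_false, not_and, not_le]
    exact fun _ => (ballCount_le_card y S c r).trans_lt h
  rw [kthRadius, this, Real.sInf_empty]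

/-- Having `k` points within `r` means that some `k`-subset is within `r`, so the set is a finite
union of closed half-lines. Closedness makes the infimum attained: the `k`-th ball really contains
`k` points. -/
theorem isClosed_ballCount_ge (y : ι → E) (S : Finset ι) (k : ℕ) (c : E) :
    IsClosed {r : ℝ | 0 ≤ r ∧ k ≤ ballCount y S c r} := by
  have h : {r : ℝ | 0 ≤ r ∧ k ≤ ballCount y S c r} =
      Set.Ici 0 ∩ ⋃ T ∈ S.powersetCard k, ⋂ m ∈ T, Set.Ici ‖y m - c‖ := by
    ext r
    simp only [Set.mem_ofPred_eq, Set.mem_inter_iff, Set.mem_Ici, Set.mem_iUnion, Set.mem_iInter,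
      Finset.mem_powersetCard, exists_prop, ballCount]
    refine and_congr_right fun _ => ⟨fun h => ?_, ?_⟩
    · obtain ⟨T, hT, hc⟩ := Finset.exists_subset_card_eq h
      exact ⟨T, ⟨hT.trans (Finset.filter_subset _ _), hc⟩,
        fun m hm => (Finset.mem_filter.1 (hT hm)).2⟩
    · rintro ⟨T, ⟨hT, rfl⟩, hr⟩
      exact Finset.card_le_card fun m hm => Finset.mem_filter.2 ⟨hT hm, hr m hm⟩
  rw [h]
  exact isClosed_Ici.inter (Set.Finite.isClosed_biUnion (Finset.finite_toSet _) fun T _ =>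
    isClosed_biInter fun m _ => isClosed_Ici)

theorem le_ballCount_kthRadius (y : ι → E) {S : Finset ι} {k : ℕ} (c : E) (hk : k ≤ S.card) :
    k ≤ ballCount y S c (kthRadius y S k c) := by
  refine ((isClosed_ballCount_ge y S k c).csInf_mem ⟨∑ m ∈ S, ‖y m - c‖, ?_, ?_⟩
    ⟨0, fun _ hr => hr.1⟩).2
  · exact Finset.sum_nonneg fun _ _ => norm_nonneg _
  · rwa [ballCount_eq_card]
    exact fun m hm => Finset.single_le_sum (f := fun m => ‖y m - c‖)
      (fun _ _ => norm_nonneg _) hm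

theorem kthRadius_le (y : ι → E) (S : Finset ι) {k : ℕ} (c : E) {r : ℝ} (hr : 0 ≤ r)
    (h : k ≤ ballCount y S c r) : kthRadius y S k c ≤ r :=
  csInf_le ⟨0, fun _ hr => hr.1⟩ ⟨hr, h⟩

theorem kthRadius_le_iff (y : ι → E) {S : Finset ι} {k : ℕ} (c : E) (hk : k ≤ S.card) {r : ℝ}
    (hr : 0 ≤ r) : kthRadius y S k c ≤ r ↔ k ≤ ballCount y S c r :=
  ⟨fun h => (le_ballCount_kthRadius y c hk).trans (ballCount_mono y S c h),
    kthRadius_le y S c hr⟩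

theorem kthRadius_le_of_forall (y : ι → E) (S : Finset ι) {k : ℕ} (c : E) {r : ℝ} (hr : 0 ≤ r)
    (h : ∀ m ∈ S, ‖y m - c‖ ≤ r) : kthRadius y S k c ≤ r := by
  rcases le_or_gt k S.card with hk | hk
  · exact kthRadius_le y S c hr (by rwa [ballCount_eq_card y S c h])
  · rwa [kthRadius_eq_zero_of_card_lt y c hk]

theorem kthRadius_map {κ : Type*} (y : ι → E) (e : κ ↪ ι) (S : Finset κ) (k : ℕ) (c : E) :
    kthRadius y (S.map e) k c = kthRadius (y ∘ e) S k c := by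
  have : ∀ r, ballCount y (S.map e) c r = ballCount (y ∘ e) S c r := fun r => by
    rw [ballCount, ballCount, Finset.filter_map, Finset.card_map]
    rfl
  simp only [kthRadius, this]

variable [MeasurableSpace E] [BorelSpace E]

theorem map_norm_sub_Iic (μ : Measure E) (c : E) (r : ℝ) :
    (μ.map fun y => ‖y - c‖).real (Set.Iic r) = μ.real (Metric.closedBall c r) := by
  rw [map_measureReal_apply (by fun_prop) measurableSet_Iic]
  congr 1
  ext y
  simp [dist_eq_norm]

/-- The function is the distribution function of `‖y - c‖`, whose jump at `r` is the mass of the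
sphere of radius `r`. -/
theorem continuous_measureReal_closedBall (μ : Measure E) [IsProbabilityMeasure μ] (c : E)
    (hs : ∀ r, μ (Metric.sphere c r) = 0) :
    Continuous fun r => μ.real (Metric.closedBall c r) := by
  set D := μ.map fun y => ‖y - c‖
  have hm : Measurable fun y => ‖y - c‖ := by fun_prop
  have : IsProbabilityMeasure D := Measure.isProbabilityMeasure_map hm.aemeasurable
  have hc : (fun r => μ.real (Metric.closedBall c r)) = cdf D := by
    ext r
    rw [cdf_eq_real, map_norm_sub_Iic]
  rw [hc]
  refine continuous_iff_continuousAt.2 fun r => ?_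
  rw [(monotone_cdf D).continuousAt_iff_leftLim_eq_rightLim, StieltjesFunction.rightLim_eq]
  have h1 : (cdf D).measure {r} = 0 := by
    rw [measure_cdf, Measure.map_apply hm (measurableSet_singleton r)]
    refine measure_mono_null (fun y hy => ?_) (hs r)
    simpa [dist_eq_norm] using hy
  rw [StieltjesFunction.measure_singleton, ENNReal.ofReal_eq_zero] at h1
  exact le_antisymm ((monotone_cdf D).leftLim_le le_rfl) (by linarith)

theorem tendsto_measureReal_closedBall (μ : Measure E) [IsProbabilityMeasure μ] (c : E) :
    Tendsto (fun r => μ.real (Metric.closedBall c r)) atTop (𝓝 1) := by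
  have hm : Measurable fun y => ‖y - c‖ := by fun_prop
  have : IsProbabilityMeasure (μ.map fun y => ‖y - c‖) :=
    Measure.isProbabilityMeasure_map hm.aemeasurable
  have := tendsto_cdf_atTop (μ.map fun y => ‖y - c‖)
  exact this.congr fun r => by rw [cdf_eq_real, map_norm_sub_Iic]

variable [SecondCountableTopology E]

theorem measurable_ballCount (S : Finset ι) (r : ℝ) :
    Measurable fun q : E × (ι → E) => ballCount q.2 S q.1 r := by
  simp only [ballCount, Finset.card_filter]
  refine Finset.measurable_sum _ fun m _ => Measurable.ite ?_ measurable_const measurable_const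
  exact measurableSet_le (by fun_prop) measurable_const

theorem measurable_kthRadius (S : Finset ι) (k : ℕ) :
    Measurable fun q : E × (ι → E) => kthRadius q.2 S k q.1 := by
  rcases le_or_gt k S.card with hk | hk
  · refine measurable_of_Iic fun r => ?_
    rcases le_or_gt 0 r with hr | hr
    · have : (fun q : E × (ι → E) => kthRadius q.2 S k q.1) ⁻¹' Set.Iic r =
          {q | k ≤ ballCount q.2 S q.1 r} := by
        ext q
        exact kthRadius_le_iff q.2 q.1 hk hr
      rw [this]
      exact measurableSet_le measurable_const (measurable_ballCount S r)
    · convert MeasurableSet.empty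
      ext q
      simpa using hr.trans_le (kthRadius_nonneg q.2 S k q.1)
  · simp only [kthRadius_eq_zero_of_card_lt _ _ hk, measurable_const]

/-- `P(Bin(N, u) < k)`. -/
noncomputable def binomialTail (N k : ℕ) (u : ℝ) : ℝ :=
  ∑ m ∈ Finset.range k, (N.choose m : ℝ) * u ^ m * (1 - u) ^ (N - m)

/-- The event splits according to the set `T` of indices whose points fall into the ball. For each
`T` it is a product set of measure `p ^ m * (1 - p) ^ (N - m)`. -/
theorem measureReal_ballCount_eq {N : ℕ} (μ : Measure E) [IsProbabilityMeasure μ] (c : E) (r : ℝ)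
    (m : ℕ) :
    (Measure.pi fun _ : Fin N => μ).real {y | ballCount y Finset.univ c r = m} =
      (N.choose m : ℝ) * μ.real (Metric.closedBall c r) ^ m *
        (1 - μ.real (Metric.closedBall c r)) ^ (N - m) := by
  set B := Metric.closedBall c r
  have hB : MeasurableSet B := Metric.isClosed_closedBall.measurableSet
  set A : Finset (Fin N) → Set (Fin N → E) := fun T =>
    Set.univ.pi fun l => if l ∈ T then B else Bᶜ
  have hA : ∀ T y, y ∈ A T ↔ (Finset.univ.filter fun l => ‖y l - c‖ ≤ r) = T := by
    intro T y
    simp only [A, Set.mem_pi, Set.mem_univ, true_implies, Finset.ext_iff, Finset.mem_filter,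
      Finset.mem_univ, true_and]
    refine forall_congr' fun l => ?_
    by_cases hl : l ∈ T <;> simp [hl, B, dist_eq_norm]
  have hU : {y : Fin N → E | ballCount y Finset.univ c r = m} =
      ⋃ T ∈ Finset.univ.powersetCard m, A T := by
    ext y
    simp only [Set.mem_ofPred_eq, Set.mem_iUnion, hA, Finset.mem_powersetCard, exists_prop,
      ballCount]
    exact ⟨fun h => ⟨_, ⟨Finset.subset_univ _, h⟩, rfl⟩, by rintro ⟨T, ⟨-, h⟩, rfl⟩; exact h⟩
  have hm : ∀ T : Finset (Fin N), ∀ l, MeasurableSet (if l ∈ T then B else Bᶜ) := by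
    intro T l
    split_ifs
    exacts [hB, hB.compl]
  rw [hU, measureReal_biUnion_finset]
  · have : ∀ T ∈ (Finset.univ : Finset (Fin N)).powersetCard m,
        (Measure.pi fun _ : Fin N => μ).real (A T) = μ.real B ^ m * (1 - μ.real B) ^ (N - m) := by
      intro T hT
      rw [measureReal_def, Measure.pi_pi, ENNReal.toReal_prod]
      have : ∀ l, (μ (if l ∈ T then B else Bᶜ)).toReal =
          if l ∈ T then μ.real B else 1 - μ.real B := by
        intro l
        split_ifs
        · rfl
        · exact probReal_compl_eq_one_sub hB
      simp only [this]
      rw [Finset.prod_ite, Finset.prod_const, Finset.prod_const, Finset.filter_not,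
        Finset.filter_mem_eq_inter, Finset.univ_inter, ← Finset.compl_eq_univ_sdiff,
        Finset.card_compl, (Finset.mem_powersetCard.1 hT).2, Fintype.card_fin]
    rw [Finset.sum_congr rfl this, Finset.sum_const, Finset.card_powersetCard, Finset.card_univ,
      Fintype.card_fin, nsmul_eq_mul, mul_assoc]
  · intro T _ T' _ hne
    refine Set.disjoint_left.2 fun y h h' => hne ?_
    rw [← (hA T y).1 h, ← (hA T' y).1 h']
  · exact fun T _ => MeasurableSet.univ_pi (hm T)

theorem measureReal_ballCount_lt {N : ℕ} (μ : Measure E) [IsProbabilityMeasure μ] (c : E) (r : ℝ)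
    (k : ℕ) :
    (Measure.pi fun _ : Fin N => μ).real {y | ballCount y Finset.univ c r < k} =
      binomialTail N k (μ.real (Metric.closedBall c r)) := by
  have hU : {y : Fin N → E | ballCount y Finset.univ c r < k} =
      ⋃ m ∈ Finset.range k, {y | ballCount y Finset.univ c r = m} := by
    ext y
    simp
  rw [hU, measureReal_biUnion_finset]
  · exact Finset.sum_congr rfl fun m _ => measureReal_ballCount_eq μ c r m
  · intro m _ m' _ hne
    refine Set.disjoint_left.2 fun y h h' => hne ?_
    exact h.symm.trans h'
  · exact fun m _ => measurableSet_eq_fun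
      ((measurable_ballCount _ r).comp (measurable_const.prodMk measurable_id)) measurable_const

theorem measurable_measureReal_closedBall (μ : Measure E) [IsProbabilityMeasure μ] :
    Measurable fun q : E × ℝ => μ.real (Metric.closedBall q.1 q.2) := by
  have : MeasurableSet {q : (E × ℝ) × E | ‖q.2 - q.1.1‖ ≤ q.1.2} :=
    measurableSet_le (by fun_prop) (by fun_prop)
  have h := (measurable_measure_prodMk_left (ν := μ) this).ennreal_toReal
  have he : ∀ q : E × ℝ, Prod.mk q ⁻¹' {q : (E × ℝ) × E | ‖q.2 - q.1.1‖ ≤ q.1.2} =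
      Metric.closedBall q.1 q.2 := fun q => by
    ext y
    simp [dist_eq_norm]
  simp only [he] at h
  exact h

/-- The probability content of the `k`-th nearest neighbour ball of `c`. -/
noncomputable def ballContent (μ : Measure E) (y : ι → E) (S : Finset ι) (k : ℕ) (c : E) : ℝ :=
  μ.real (Metric.closedBall c (kthRadius y S k c))

theorem measurable_ballContent (μ : Measure E) [IsProbabilityMeasure μ] (S : Finset ι) (k : ℕ) :
    Measurable fun q : E × (ι → E) => ballContent μ q.2 S k q.1 :=
  (measurable_measureReal_closedBall μ).comp (measurable_fst.prodMk (measurable_kthRadius S k))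

/-- Let `s` be the largest radius whose ball has content at most `u`; by continuity its content
equals `u`. The content of the `k`-th ball exceeds `u` exactly when its radius exceeds `s`, that is,
when fewer than `k` points lie within `s`: a binomial event. Taking the largest `s` copes with
intervals on which the content is constant. -/
theorem measureReal_lt_ballContent {N k : ℕ} (hk : k ≤ N) (μ : Measure E) [IsProbabilityMeasure μ]
    (c : E) (hs : ∀ r, μ (Metric.sphere c r) = 0) {u : ℝ} (hu0 : 0 ≤ u) (hu1 : u < 1) :
    (Measure.pi fun _ : Fin N => μ).real {y | u < ballContent μ y Finset.univ k c} =
      binomialTail N k u := by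
  set p : ℝ → ℝ := fun r => μ.real (Metric.closedBall c r)
  have hpc : Continuous p := continuous_measureReal_closedBall μ c hs
  have hpm : Monotone p := fun r s h => measureReal_mono (Metric.closedBall_subset_closedBall h)
  have hp0 : p 0 = 0 := by
    have : Metric.closedBall c 0 = Metric.sphere c 0 := by simp
    simp only [p, this, measureReal_def, hs, ENNReal.toReal_zero]
  obtain ⟨b, hb0, hb⟩ := (((tendsto_measureReal_closedBall μ c).eventually
    (lt_mem_nhds hu1)).and (eventually_ge_atTop 0)).exists.imp fun _ h => And.intro h.2 h.1
  set A : Set ℝ := {r | 0 ≤ r ∧ p r ≤ u}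
  have hAc : IsClosed A := (isClosed_Ici (a := (0:ℝ))).inter (isClosed_le hpc continuous_const)
  have hAb : BddAbove A := ⟨b, fun r hr => by
    by_contra h
    exact absurd (hb.trans_le (hpm (not_le.1 h).le)) (not_lt.2 hr.2)⟩
  have hAn : A.Nonempty := ⟨0, le_rfl, hp0.trans_le hu0⟩
  obtain ⟨hs0, hsu⟩ := hAc.csSup_mem hAn hAb
  set s := sSup A
  have hle : ∀ r, 0 ≤ r → (p r ≤ u ↔ r ≤ s) := fun r hr =>
    ⟨fun h => le_csSup hAb ⟨hr, h⟩, fun h => (hpm h).trans hsu⟩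
  have hps : p s = u := by
    refine le_antisymm hsu ?_
    obtain ⟨t, ht, htu⟩ := intermediate_value_Icc hb0 hpc.continuousOn
      (show u ∈ Set.Icc (p 0) (p b) from ⟨hp0.trans_le hu0, hb.le⟩)
    rw [← htu]
    exact hpm ((hle t ht.1).1 htu.le)
  have : {y : Fin N → E | u < ballContent μ y Finset.univ k c} =
      {y | ballCount y Finset.univ c s < k} := by
    ext y
    have h1 := hle _ (kthRadius_nonneg y Finset.univ k c)
    have h2 := kthRadius_le_iff y (S := Finset.univ) (k := k) c (by simpa using hk) hs0
    simp only [Set.mem_ofPred_eq]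
    rw [← not_le, ← not_le, ← h2, ← h1]
    rfl
  rw [this, measureReal_ballCount_lt]
  change binomialTail N k (p s) = _
  rw [hps]

/-- The law of the content of the `k`-th nearest neighbour ball does not depend on its centre. -/
theorem map_ballContent_eq {N k : ℕ} (hk : k ≤ N) (μ : Measure E) [IsProbabilityMeasure μ]
    (hs : ∀ c r, μ (Metric.sphere c r) = 0) (c c' : E) :
    (Measure.pi fun _ : Fin N => μ).map (fun y => ballContent μ y Finset.univ k c) =
      (Measure.pi fun _ : Fin N => μ).map (fun y => ballContent μ y Finset.univ k c') := by
  have hm : ∀ c, Measurable fun y : Fin N → E => ballContent μ y Finset.univ k c := fun c =>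
    (measurable_ballContent μ _ k).comp (measurable_const.prodMk measurable_id)
  have hp : ∀ c, IsProbabilityMeasure ((Measure.pi fun _ : Fin N => μ).map
      fun y => ballContent μ y Finset.univ k c) := fun c =>
    Measure.isProbabilityMeasure_map (hm c).aemeasurable
  have hp1 := hp c
  have hp2 := hp c'
  -- The distribution function has a formula free of `c`: the binomial tail on `[0, 1)`, and trivial
  -- values elsewhere because contents lie in `[0, 1]`.
  have key : ∀ c u, ((Measure.pi fun _ : Fin N => μ).map
      fun y => ballContent μ y Finset.univ k c).real (Set.Iic u) =
      if u < 0 then 0 else if 1 ≤ u then 1 else 1 - binomialTail N k u := by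
    intro c u
    rw [map_measureReal_apply (hm c) measurableSet_Iic]
    split_ifs with h0 h1
    · convert measureReal_empty
      ext y
      simpa using h0.trans_le (show 0 ≤ ballContent μ y Finset.univ k c from measureReal_nonneg)
    · convert probReal_univ
      · ext y
        simpa using (show ballContent μ y Finset.univ k c ≤ 1 from measureReal_le_one).trans h1
      · infer_instance
    · rw [← measureReal_lt_ballContent hk μ c (hs c) (not_lt.1 h0) (not_le.1 h1),
        ← probReal_compl_eq_one_sub (measurableSet_lt measurable_const (hm c))]
      congr 1
      ext y
      simp
  refine Measure.eq_of_cdf _ _ ?_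
  ext u
  rw [cdf_eq_real, cdf_eq_real, key, key]

end OrderStatistics

/-! ### Moments of uniform order statistics and Gamma function inequalities. -/

section Moments

theorem lintegral_rpow_mul_one_sub_rpow {a b : ℝ} (ha : 0 < a) (hb : 0 < b) :
    ∫⁻ x in Set.Ioo (0 : ℝ) 1, ENNReal.ofReal (x ^ (a - 1) * (1 - x) ^ (b - 1)) =
      ENNReal.ofReal (beta a b) := by
  have hβ := beta_pos ha hb
  have h := lintegral_betaPDF_eq_one ha hb
  rw [lintegral_betaPDF] at h
  have h2 : ∀ x : ℝ, ENNReal.ofReal (1 / beta a b * x ^ (a - 1) * (1 - x) ^ (b - 1)) =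
      ENNReal.ofReal (1 / beta a b) * ENNReal.ofReal (x ^ (a - 1) * (1 - x) ^ (b - 1)) := by
    intro x
    rw [mul_assoc, ENNReal.ofReal_mul (by positivity)]
  simp only [h2] at h
  rw [lintegral_const_mul _ (by fun_prop)] at h
  calc _ = ENNReal.ofReal (beta a b) * (ENNReal.ofReal (1 / beta a b) *
        ∫⁻ x in Set.Ioo (0 : ℝ) 1, ENNReal.ofReal (x ^ (a - 1) * (1 - x) ^ (b - 1))) := by
        rw [← mul_assoc, ← ENNReal.ofReal_mul hβ.le, mul_one_div_cancel hβ.ne']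
        simp
    _ = _ := by rw [h, mul_one]

/-- A hockey-stick identity, by telescoping with `Γ(x+1) = xΓ(x)`. It sums the Beta integrals coming
from the terms of the binomial tail. -/
theorem sum_gamma_div_factorial {s : ℝ} (hs : 0 < s) (k : ℕ) :
    ∑ m ∈ Finset.range (k + 1), s * Real.Gamma (m + s) / m.factorial =
      Real.Gamma ((k : ℝ) + 1 + s) / k.factorial := by
  induction k with
  | zero => simp [add_comm (1 : ℝ) s, Real.Gamma_add_one hs.ne']
  | succ k ih =>
    have h1 : Real.Gamma (((k + 1 : ℕ) : ℝ) + 1 + s) =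
        ((k : ℝ) + 1 + s) * Real.Gamma ((k : ℝ) + 1 + s) := by
      rw [← Real.Gamma_add_one (by positivity)]
      push_cast
      ring_nf
    rw [Finset.sum_range_succ, ih, h1, Nat.factorial_succ]
    push_cast
    field_simp

/-- The `m`-th binomial term integrates to a multiple of `B(m + s, N - m + 1)`. All these Beta
values share the denominator `Γ(N + 1 + s)`, so only the sum of `sum_gamma_div_factorial` remains.
-/
theorem lintegral_binomialTail {N k : ℕ} (hk1 : 1 ≤ k) (hk : k ≤ N) {s : ℝ} (hs : 0 < s) :
    ENNReal.ofReal s * ∫⁻ t in Set.Ioo (0 : ℝ) 1,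
        ENNReal.ofReal (binomialTail N k t) * ENNReal.ofReal (t ^ (s - 1)) =
      ENNReal.ofReal (Real.Gamma (k + s) / Real.Gamma k *
        (Real.Gamma (N + 1) / Real.Gamma (N + 1 + s))) := by
  have h1 : ∀ t ∈ Set.Ioo (0 : ℝ) 1,
      ENNReal.ofReal (binomialTail N k t) * ENNReal.ofReal (t ^ (s - 1)) =
        ∑ m ∈ Finset.range k, ENNReal.ofReal (N.choose m) *
          ENNReal.ofReal (t ^ ((m + s) - 1) * (1 - t) ^ (((N - m : ℕ) + 1 : ℝ) - 1)) := by
    intro t ht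
    have ht1 : 0 ≤ 1 - t := by linarith [ht.2]
    rw [← ENNReal.ofReal_mul' (by have := ht.1; positivity), binomialTail, Finset.sum_mul,
      ENNReal.ofReal_sum_of_nonneg]
    · refine Finset.sum_congr rfl fun m _ => ?_
      rw [← ENNReal.ofReal_mul (by positivity), add_sub_cancel_right, Real.rpow_natCast,
        add_sub_assoc, Real.rpow_add ht.1, Real.rpow_natCast]
      ring_nf
    · intro m _
      have := ht.1
      positivity
  rw [setLIntegral_congr_fun measurableSet_Ioo h1, lintegral_finsetSum _ (by fun_prop)]
  have h2 : ∀ m ∈ Finset.range k, ∫⁻ t in Set.Ioo (0 : ℝ) 1, ENNReal.ofReal (N.choose m) *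
      ENNReal.ofReal (t ^ ((m + s) - 1) * (1 - t) ^ (((N - m : ℕ) + 1 : ℝ) - 1)) =
      ENNReal.ofReal (N.choose m * beta (m + s) ((N - m : ℕ) + 1)) := by
    intro m _
    rw [lintegral_const_mul _ (by fun_prop), lintegral_rpow_mul_one_sub_rpow (by positivity)
      (by positivity), ← ENNReal.ofReal_mul (by positivity)]
  have h3 : ∀ m : ℕ, 0 ≤ (N.choose m : ℝ) * beta (m + s) ((N - m : ℕ) + 1) := fun m =>
    mul_nonneg (by positivity) (beta_pos (by positivity) (by positivity)).le
  rw [Finset.sum_congr rfl h2, ← ENNReal.ofReal_sum_of_nonneg fun m _ => h3 m,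
    ← ENNReal.ofReal_mul hs.le]
  congr 1
  obtain ⟨k, rfl⟩ : ∃ j, k = j + 1 := ⟨k - 1, by omega⟩
  have h4 := sum_gamma_div_factorial hs k
  push_cast
  rw [Real.Gamma_nat_eq_factorial, Real.Gamma_nat_eq_factorial, ← h4, Finset.mul_sum,
    Finset.sum_mul]
  refine Finset.sum_congr rfl fun m hm => ?_
  have hmN : m ≤ N := by have := Finset.mem_range.1 hm; omega
  have h5 : ((m : ℝ) + s) + ((N - m : ℕ) + 1) = N + 1 + s := by
    rw [Nat.cast_sub hmN]; ring
  rw [beta, h5, Real.Gamma_nat_eq_factorial, ← Nat.choose_mul_factorial_mul_factorial hmN]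
  have := (Real.Gamma_pos_of_pos (show (0:ℝ) < N + 1 + s by positivity)).ne'
  push_cast
  field_simp

/-- The moments of a random variable with the tail of the `k`-th order statistic of `N`
independent uniform variables. -/
theorem integral_rpow_of_binomialTail {Ω : Type*} [MeasurableSpace Ω] (Q : Measure Ω)
    [IsProbabilityMeasure Q] {U : Ω → ℝ} (hU : Measurable U) (h0 : ∀ ω, 0 ≤ U ω)
    (h1 : ∀ ω, U ω ≤ 1) {N k : ℕ} (hk1 : 1 ≤ k) (hk : k ≤ N)
    (ht : ∀ u, 0 ≤ u → u < 1 → Q.real {ω | u < U ω} = binomialTail N k u) {s : ℝ} (hs : 0 < s) :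
    ∫ ω, U ω ^ s ∂Q = Real.Gamma (k + s) / Real.Gamma k *
      (Real.Gamma (N + 1) / Real.Gamma (N + 1 + s)) := by
  rw [integral_eq_lintegral_of_nonneg_ae (ae_of_all _ fun ω => Real.rpow_nonneg (h0 ω) s)
    (hU.pow_const s).aestronglyMeasurable,
    lintegral_rpow_eq_lintegral_meas_lt_mul Q (ae_of_all _ h0) hU.aemeasurable hs]
  have : ∫⁻ t in Set.Ioi (0 : ℝ), Q {a | t < U a} * ENNReal.ofReal (t ^ (s - 1)) =
      ∫⁻ t in Set.Ioo (0 : ℝ) 1,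
        ENNReal.ofReal (binomialTail N k t) * ENNReal.ofReal (t ^ (s - 1)) := by
    rw [← lintegral_indicator measurableSet_Ioi, ← lintegral_indicator measurableSet_Ioo]
    congr 1
    ext t
    by_cases ht0 : 0 < t
    · rw [Set.indicator_of_mem (Set.mem_Ioi.2 ht0)]
      by_cases ht1 : t < 1
      · rw [Set.indicator_of_mem (Set.mem_Ioo.2 ⟨ht0, ht1⟩), ← ht t ht0.le ht1, ofReal_measureReal]
      · rw [Set.indicator_of_notMem fun h => ht1 h.2]
        have : {a | t < U a} = ∅ := by
          ext a
          simpa using (h1 a).trans (not_lt.1 ht1)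
        simp [this]
    · rw [Set.indicator_of_notMem (mt Set.mem_Ioi.1 ht0), Set.indicator_of_notMem fun h => ht0 h.1]
  have hp : ∀ x : ℝ, 0 < x → 0 < Real.Gamma x := fun x => Real.Gamma_pos_of_pos
  rw [this, lintegral_binomialTail hk1 hk hs, ENNReal.toReal_ofReal]
  have hk0 : (0 : ℝ) < k := by exact_mod_cast hk1
  have := hp (k + s) (by positivity)
  have := hp k hk0
  have := hp (N + 1) (by positivity)
  have := hp (N + 1 + s) (by positivity)
  positivity

/-- Log-convexity of `Γ` at the midpoint of `x` and `x + 1`. -/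
theorem sq_gamma_add_half_le {x : ℝ} (hx : 0 < x) :
    Real.Gamma (x + 1 / 2) ^ 2 ≤ Real.Gamma x * Real.Gamma (x + 1) := by
  have h := Real.Gamma_mul_add_mul_le_rpow_Gamma_mul_rpow_Gamma hx (show 0 < x + 1 by positivity)
    (show (0 : ℝ) < 1 / 2 by norm_num) (show (0 : ℝ) < 1 / 2 by norm_num) (by norm_num)
  have h0 := Real.Gamma_pos_of_pos hx
  have h1 := Real.Gamma_pos_of_pos (show 0 < x + 1 by positivity)
  have h2 := Real.Gamma_pos_of_pos (show 0 < x + 1 / 2 by positivity)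
  rw [← Real.sqrt_eq_rpow, ← Real.sqrt_eq_rpow, ← Real.sqrt_mul h0.le,
    show 1 / 2 * x + 1 / 2 * (x + 1) = x + 1 / 2 by ring] at h
  calc _ ≤ √(Real.Gamma x * Real.Gamma (x + 1)) ^ 2 := by gcongr
    _ = _ := Real.sq_sqrt (by positivity)

/-- Wendel's inequality, lower bound. -/
theorem one_le_sqrt_mul_gamma_ratio {x : ℝ} (hx : 0 < x) :
    1 ≤ √x * (Real.Gamma x / Real.Gamma (x + 1 / 2)) := by
  have h0 := Real.Gamma_pos_of_pos hx
  have h2 := Real.Gamma_pos_of_pos (show 0 < x + 1 / 2 by positivity)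
  have h := sq_gamma_add_half_le hx
  rw [Real.Gamma_add_one hx.ne'] at h
  rw [← mul_div_assoc, one_le_div h2]
  refine (abs_le_of_sq_le_sq' ?_ (by positivity)).2
  rw [mul_pow, Real.sq_sqrt hx.le]
  linarith

/-- Wendel's inequality, upper bound. -/
theorem sqrt_mul_gamma_ratio_le {x : ℝ} (hx : 0 < x) :
    √x * (Real.Gamma x / Real.Gamma (x + 1 / 2)) ≤ 1 + 1 / (2 * x) := by
  have h0 := Real.Gamma_pos_of_pos hx
  have h2 := Real.Gamma_pos_of_pos (show 0 < x + 1 / 2 by positivity)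
  -- Log-convexity is now used half a unit further, so that `Γ(x+1) = xΓ(x)` is bounded above by a
  -- multiple of `Γ(x+1/2)`.
  have h := sq_gamma_add_half_le (show 0 < x + 1 / 2 by positivity)
  rw [Real.Gamma_add_one (by positivity), show x + 1 / 2 + 1 / 2 = x + 1 by ring,
    Real.Gamma_add_one hx.ne'] at h
  rw [← mul_div_assoc, div_le_iff₀ h2]
  refine (abs_le_of_sq_le_sq' ?_ (by positivity)).2
  rw [mul_pow, mul_pow, Real.sq_sqrt hx.le]
  have h3 : x * Real.Gamma x ^ 2 ≤ (1 + 1 / (2 * x)) * Real.Gamma (x + 1 / 2) ^ 2 := by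
    refine le_of_mul_le_mul_left ?_ hx
    calc x * (x * Real.Gamma x ^ 2) = (x * Real.Gamma x) ^ 2 := by ring
      _ ≤ _ := h
      _ = _ := by field_simp
  -- The factor obtained is `1 + 1/(2x)`; it is weakened to its square so that square roots can be
  -- taken.
  refine h3.trans (mul_le_mul_of_nonneg_right ?_ (by positivity))
  have : 0 ≤ 1 / (2 * x) := by positivity
  nlinarith

end Moments

/-! ### Volumes of balls and boundary layers in convex bodies. -/

section ConvexGeometry

variable {d : ℕ} {C : Set (EuclideanSpace ℝ (Fin d))}

/-- A convex body has at least the volume proportion `(r / D) ^ d` in each ball of radius `r`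
around one of its points. -/
theorem Convex.le_volume_inter_closedBall (hC : Convex ℝ C) (hCc : IsCompact C) {D r : ℝ}
    (hD : 0 < D) (hCD : ∀ x ∈ C, ∀ y ∈ C, ‖x - y‖ ≤ D) {a : EuclideanSpace ℝ (Fin d)} (ha : a ∈ C)
    (hr : 0 ≤ r) (hrD : r ≤ D) :
    (r / D) ^ d * volume.real C ≤ volume.real (C ∩ Metric.closedBall a r) := by
  have hfin : volume (C ∩ Metric.closedBall a r) ≠ ⊤ :=
    measure_ne_top_of_subset Set.inter_subset_left hCc.measure_lt_top.ne
  have ht : 0 ≤ r / D := by positivity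
  have ht1 : r / D ≤ 1 := (div_le_one hD).2 hrD
  -- Shrinking `C` towards `a` by the ratio `r / D` keeps it inside `C`, by convexity, and brings it
  -- within `r` of `a`.
  have h := Measure.addHaar_image_homothety volume a (r / D) C
  rw [finrank_euclideanSpace_fin, abs_of_nonneg (by positivity)] at h
  have h2 : volume.real (AffineMap.homothety a (r / D) '' C) = (r / D) ^ d * volume.real C := by
    rw [measureReal_def, h, ENNReal.toReal_mul, ENNReal.toReal_ofReal (by positivity),
      measureReal_def]
  rw [← h2]
  refine measureReal_mono ?_ hfin
  rintro _ ⟨y, hy, rfl⟩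
  rw [AffineMap.homothety_apply, vsub_eq_sub, vadd_eq_add]
  refine ⟨?_, ?_⟩
  · have := hC.add_smul_sub_mem ha hy ⟨ht, ht1⟩
    rwa [add_comm] at this
  · rw [Metric.mem_closedBall, dist_eq_norm, add_sub_cancel_right, norm_smul,
      Real.norm_of_nonneg ht]
    calc r / D * ‖y - a‖ ≤ r / D * D := by gcongr; exact hCD y hy a ha
      _ = r := div_mul_cancel₀ _ hD.ne'

theorem Convex.interior_nonempty_of_volume_ne_zero (hC : Convex ℝ C) (h0 : volume C ≠ 0) :
    (interior C).Nonempty := by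
  by_contra h
  rw [Set.not_nonempty_iff_eq_empty] at h
  refine h0 (measure_mono_null ?_ (hC.addHaar_frontier volume))
  rw [frontier, h, Set.sdiff_empty]
  exact subset_closure

/-- The part of a convex body within distance `t` of its complement has volume `O(t)`. -/
theorem Convex.exists_volume_boundary_layer_le (hd : 1 ≤ d) (hC : Convex ℝ C) (hCc : IsCompact C)
    (h0 : volume C ≠ 0) :
    ∃ L : ℝ, 0 ≤ L ∧ ∀ t, 0 ≤ t →
      volume.real (C ∩ {a | Metric.infDist a Cᶜ ≤ t}) ≤ L * t := by
  have : Nonempty (Fin d) := ⟨⟨0, hd⟩⟩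
  obtain ⟨o, ho⟩ := hC.interior_nonempty_of_volume_ne_zero h0
  obtain ⟨ρ, hρ, hball⟩ := Metric.mem_nhds_iff.1 (mem_interior_iff_mem_nhds.1 ho)
  have hne : (Cᶜ).Nonempty := Set.nonempty_compl.2 hCc.ne_univ
  have hfin : volume C ≠ ⊤ := hCc.measure_lt_top.ne
  refine ⟨d * (4 / ρ) * volume.real C, by positivity, fun t ht => ?_⟩
  rcases ht.eq_or_lt with rfl | htpos
  · have hsub : C ∩ {a | Metric.infDist a Cᶜ ≤ 0} ⊆ frontier C := by
      rintro a ⟨haC, ha⟩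
      rw [frontier_eq_closure_inter_closure]
      refine ⟨subset_closure haC, ?_⟩
      rw [Metric.mem_closure_iff_infDist_zero hne]
      exact le_antisymm ha Metric.infDist_nonneg
    rw [mul_zero, measureReal_def, measure_mono_null hsub (hC.addHaar_frontier volume),
      ENNReal.toReal_zero]
  have hd1 : (1 : ℝ) ≤ d := by exact_mod_cast hd
  -- For large `t` the claimed bound already exceeds the volume of `C`. Otherwise the shrinking
  -- ratio `1 - 4t/ρ` is positive.
  rcases le_or_gt 1 (4 / ρ * t) with hl | hl
  · calc volume.real (C ∩ {a | Metric.infDist a Cᶜ ≤ t}) ≤ volume.real C :=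
        measureReal_mono Set.inter_subset_left hfin
      _ = 1 * 1 * volume.real C := by ring
      _ ≤ d * (4 / ρ * t) * volume.real C := by gcongr
      _ = _ := by ring
  set l := 4 / ρ * t
  have hl0 : 0 < l := by positivity
  set H := AffineMap.homothety o (1 - l) '' C
  have hH : MeasurableSet H :=
    (hCc.image (AffineMap.homothety_continuous o (1 - l))).isClosed.measurableSet
  -- A convex combination of `y` with the inscribed ball of radius `ρ` around `o`: each point of the
  -- shrunken copy `H` carries a ball of radius `l * ρ = 4 * t` inside `C`. Hence the layer of width
  -- `t` misses `H`.
  have hHsub : ∀ y ∈ C, ∀ w, ‖w‖ < l * ρ → AffineMap.homothety o (1 - l) y + w ∈ C := by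
    intro y hy w hw
    have hb : o + (1 / l) • w ∈ C := hball (by
      rw [Metric.mem_ball, dist_eq_norm, add_sub_cancel_left, norm_smul,
        Real.norm_of_nonneg (by positivity), one_div, inv_mul_lt_iff₀ hl0]
      exact hw)
    have := hC hy hb (show 0 ≤ 1 - l by linarith) hl0.le (by ring)
    convert this using 1
    rw [AffineMap.homothety_apply, vsub_eq_sub, vadd_eq_add, smul_add, smul_smul,
      mul_one_div_cancel hl0.ne', one_smul]
    module
  have hHC : H ⊆ C := by
    rintro _ ⟨y, hy, rfl⟩
    simpa using hHsub y hy 0 (by simpa using by positivity)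
  have hsub : C ∩ {a | Metric.infDist a Cᶜ ≤ t} ⊆ C \ H := by
    rintro _ ⟨haC, ha⟩
    refine ⟨haC, ?_⟩
    rintro ⟨y, hy, rfl⟩
    refine absurd ha (not_le.2 (lt_of_lt_of_le (show t < 2 * t by linarith) ?_))
    rw [Metric.le_infDist hne]
    intro b hb
    by_contra hlt
    rw [dist_comm, dist_eq_norm] at hlt
    refine hb ?_
    have := hHsub y hy (b - AffineMap.homothety o (1 - l) y) ?_
    · simpa using this
    · have : l * ρ = 4 * t := by simp only [l]; field_simp
      rw [this]
      linarith
  have hvol := Measure.addHaar_image_homothety volume o (1 - l) C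
  have hl1 : 0 ≤ 1 - l := by linarith
  rw [finrank_euclideanSpace_fin, abs_of_nonneg (by positivity)] at hvol
  have hvol' : volume.real H = (1 - l) ^ d * volume.real C := by
    rw [measureReal_def, hvol, ENNReal.toReal_mul, ENNReal.toReal_ofReal (by positivity),
      measureReal_def]
  calc volume.real (C ∩ {a | Metric.infDist a Cᶜ ≤ t}) ≤ volume.real (C \ H) :=
        measureReal_mono hsub (measure_ne_top_of_subset Set.sdiff_subset hfin)
    _ = volume.real C - volume.real H :=
        measureReal_sdiff hHC hH hfin
    _ = (1 - (1 - l) ^ d) * volume.real C := by rw [hvol']; ring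
    _ ≤ (d * l) * volume.real C := by
        gcongr
        -- Bernoulli's inequality gives `1 - (1 - l) ^ d ≤ d * l`.
        have := one_add_mul_le_pow (show (-2 : ℝ) ≤ -l by linarith) d
        rw [← sub_eq_add_neg] at this
        linarith
    _ = _ := by simp only [l]; ring

theorem closedBall_subset_of_lt_infDist_compl {a : EuclideanSpace ℝ (Fin d)} {r : ℝ}
    (h : r < Metric.infDist a Cᶜ) : Metric.closedBall a r ⊆ C := by
  intro b hb
  by_contra hbC
  have := Metric.infDist_le_dist_of_mem (x := a) (show b ∈ Cᶜ from hbC)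
  rw [dist_comm] at this
  exact absurd (h.trans_le this) (not_lt.2 hb)

theorem volume_real_closedBall (hd : 1 ≤ d) (a : EuclideanSpace ℝ (Fin d)) {r : ℝ} (hr : 0 ≤ r) :
    volume.real (Metric.closedBall a r) = unitBallVol d * r ^ d := by
  have : Nonempty (Fin d) := ⟨⟨0, hd⟩⟩
  have h1 : Real.Gamma ((d : ℝ) / 2 + 1) > 0 := Real.Gamma_pos_of_pos (by positivity)
  have h2 : √Real.pi ^ d = Real.pi ^ ((d : ℝ) / 2) := by
    rw [Real.sqrt_eq_rpow, ← Real.rpow_natCast, ← Real.rpow_mul Real.pi_pos.le]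
    ring_nf
  rw [measureReal_def, EuclideanSpace.volume_closedBall, ENNReal.toReal_mul, ENNReal.toReal_pow,
    ENNReal.toReal_ofReal hr, Fintype.card_fin, ENNReal.toReal_ofReal (by positivity), h2, mul_comm,
    unitBallVol]

theorem unitBallVol_pos (d : ℕ) : 0 < unitBallVol d :=
  div_pos (Real.rpow_pos_of_pos Real.pi_pos _) (Real.Gamma_pos_of_pos (by positivity))

end ConvexGeometry

/-! ### Regular densities: content of balls and of boundary layers. -/

section RegularDensity

/-- The measure with Lebesgue density `f`. -/
noncomputable abbrev densityMeasure {d : ℕ} (f : EuclideanSpace ℝ (Fin d) → ℝ) :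
    Measure (EuclideanSpace ℝ (Fin d)) :=
  volume.withDensity fun x => ENNReal.ofReal (f x)

namespace IsRegularDensity

variable {d : ℕ} {f : EuclideanSpace ℝ (Fin d) → ℝ} {C : Set (EuclideanSpace ℝ (Fin d))}

theorem eq_zero (hf : IsRegularDensity f C) {x : EuclideanSpace ℝ (Fin d)} (hx : x ∉ C) :
    f x = 0 := image_eq_zero_of_notMem_tsupport (by rwa [hf.support])

theorem nonneg (hf : IsRegularDensity f C) (x : EuclideanSpace ℝ (Fin d)) : 0 ≤ f x := by
  by_cases hx : x ∈ C
  · obtain ⟨a, ha, h⟩ := hf.lower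
    exact ha.le.trans (h x hx)
  · rw [hf.eq_zero hx]

theorem measurableSet (hf : IsRegularDensity f C) : MeasurableSet C :=
  hf.compact.isClosed.measurableSet

/-- Measurability comes from continuity on the closed set `C` and vanishing off it. -/
theorem measurable (hf : IsRegularDensity f C) : Measurable f := by
  classical
  have : f = C.piecewise f 0 := by
    ext x
    by_cases hx : x ∈ C
    · simp [hx]
    · simp [hx, hf.eq_zero hx]
  rw [this]
  exact ContinuousOn.measurable_piecewise hf.differentiable.continuousOn continuousOn_const
    hf.measurableSet

theorem exists_le (hf : IsRegularDensity f C) : ∃ b : ℝ, 0 < b ∧ ∀ x, f x ≤ b := by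
  obtain ⟨b, hb⟩ := hf.upper
  refine ⟨max b 1, by positivity, fun x => ?_⟩
  by_cases hx : x ∈ C
  · exact (hb x hx).trans (le_max_left _ _)
  · rw [hf.eq_zero hx]
    positivity

theorem exists_diam (hf : IsRegularDensity f C) :
    ∃ D : ℝ, 0 < D ∧ ∀ x ∈ C, ∀ y ∈ C, ‖x - y‖ ≤ D := by
  obtain ⟨D, hD⟩ := Metric.isBounded_iff.1 hf.compact.isBounded
  refine ⟨max D 1, by positivity, fun x hx y hy => ?_⟩
  rw [← dist_eq_norm]
  exact (hD hx hy).trans (le_max_left _ _)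

/-- The mean value inequality on the convex set `C`. Expanding a vector in the standard basis bounds
the norm of the derivative by the sum of the bounds on the partial derivatives. -/
theorem exists_lipschitz (hf : IsRegularDensity f C) :
    ∃ L : ℝ, 0 ≤ L ∧ ∀ x ∈ C, ∀ y ∈ C, |f y - f x| ≤ L * ‖y - x‖ := by
  obtain ⟨M, hM⟩ := hf.partials
  refine ⟨∑ _i : Fin d, |M|, by positivity, fun x hx y hy => ?_⟩
  refine hf.convex.norm_image_sub_le_of_norm_fderivWithin_le hf.differentiable (fun x hx => ?_)
    hx hy
  refine ContinuousLinearMap.opNorm_le_bound _ (by positivity) fun v => ?_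
  have hv : v = ∑ i, v i • EuclideanSpace.single i (1 : ℝ) := by
    ext j
    simp [Finset.sum_apply, Pi.single_apply]
  conv_lhs => rw [hv]
  rw [map_sum, Finset.sum_mul]
  refine (norm_sum_le _ _).trans (Finset.sum_le_sum fun i _ => ?_)
  rw [map_smul, norm_smul, mul_comm]
  exact mul_le_mul ((hM x hx i).trans (le_abs_self M)) (PiLp.norm_apply_le v i) (norm_nonneg _)
    (abs_nonneg _)

theorem integral_eq (hf : IsRegularDensity f C) (g : EuclideanSpace ℝ (Fin d) → ℝ) :
    ∫ x, g x ∂(densityMeasure f) = ∫ x, f x * g x := by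
  rw [integral_withDensity_eq_integral_toReal_smul hf.measurable.ennreal_ofReal
    (ae_of_all _ fun _ => ENNReal.ofReal_lt_top)]
  refine integral_congr_ae (ae_of_all _ fun x => ?_)
  simp [ENNReal.toReal_ofReal (hf.nonneg x)]

theorem measure_sphere (hd : 1 ≤ d) (c : EuclideanSpace ℝ (Fin d)) (r : ℝ) :
    densityMeasure f (Metric.sphere c r) = 0 := by
  have : Nonempty (Fin d) := ⟨⟨0, hd⟩⟩
  exact withDensity_absolutelyContinuous _ _ (Measure.addHaar_sphere volume c r)

variable [IsProbabilityMeasure (densityMeasure f)]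

theorem integrable (hf : IsRegularDensity f C) : Integrable f := by
  refine ⟨hf.measurable.aestronglyMeasurable, ?_⟩
  rw [hasFiniteIntegral_iff_ofReal (ae_of_all _ hf.nonneg)]
  have := withDensity_apply (μ := volume) (fun x => ENNReal.ofReal (f x)) MeasurableSet.univ
  rw [setLIntegral_univ] at this
  rw [← this]
  exact measure_lt_top (densityMeasure f) _

theorem measureReal_eq (hf : IsRegularDensity f C) {s : Set (EuclideanSpace ℝ (Fin d))}
    (hs : MeasurableSet s) : (densityMeasure f).real s = ∫ x in s, f x := by
  rw [measureReal_def, withDensity_apply _ hs, ← ofReal_integral_eq_lintegral_ofReal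
    hf.integrable.restrict (ae_of_all _ hf.nonneg), ENNReal.toReal_ofReal]
  exact integral_nonneg hf.nonneg

theorem ae_mem (hf : IsRegularDensity f C) : ∀ᵐ x ∂(densityMeasure f), x ∈ C := by
  have h : (densityMeasure f).real Cᶜ = 0 := by
    rw [hf.measureReal_eq hf.measurableSet.compl]
    refine (setIntegral_congr_fun hf.measurableSet.compl fun x hx => hf.eq_zero hx).trans (by simp)
  rw [measureReal_eq_zero_iff] at h
  exact h

theorem volume_ne_zero (hf : IsRegularDensity f C) : volume C ≠ 0 := by
  intro h
  have h1 : densityMeasure f C = 0 := withDensity_absolutelyContinuous _ _ h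
  have h2 : densityMeasure f Cᶜ = 0 := hf.ae_mem
  have h3 := measure_univ_le_add_compl (μ := densityMeasure f) C
  rw [h1, h2, measure_univ] at h3
  simp at h3

theorem exists_le_measureReal_closedBall (hf : IsRegularDensity f C) {D : ℝ} (hD : 0 < D)
    (hCD : ∀ x ∈ C, ∀ y ∈ C, ‖x - y‖ ≤ D) :
    ∃ c : ℝ, 0 < c ∧ ∀ a ∈ C, ∀ r, 0 ≤ r → r ≤ D →
      c * r ^ d ≤ (densityMeasure f).real (Metric.closedBall a r) := by
  obtain ⟨a₁, ha₁, hlow⟩ := hf.lower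
  have hv : 0 < volume.real C :=
    ENNReal.toReal_pos hf.volume_ne_zero hf.compact.measure_lt_top.ne
  refine ⟨a₁ * volume.real C / D ^ d, by positivity, fun a ha r hr hrD => ?_⟩
  have hm : MeasurableSet (C ∩ Metric.closedBall a r) :=
    hf.measurableSet.inter Metric.isClosed_closedBall.measurableSet
  have hfin : volume (C ∩ Metric.closedBall a r) ≠ ⊤ :=
    measure_ne_top_of_subset Set.inter_subset_left hf.compact.measure_lt_top.ne
  calc a₁ * volume.real C / D ^ d * r ^ d = a₁ * ((r / D) ^ d * volume.real C) := by
        rw [div_pow]; ring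
    _ ≤ a₁ * volume.real (C ∩ Metric.closedBall a r) := by
        gcongr
        exact hf.convex.le_volume_inter_closedBall hf.compact hD hCD ha hr hrD
    _ = ∫ x in C ∩ Metric.closedBall a r, a₁ := by
        rw [setIntegral_const, smul_eq_mul, mul_comm]
    _ ≤ ∫ x in C ∩ Metric.closedBall a r, f x :=
        setIntegral_mono_on (integrableOn_const hfin) hf.integrable.integrableOn hm
          fun x hx => hlow x hx.1
    _ = (densityMeasure f).real (C ∩ Metric.closedBall a r) := (hf.measureReal_eq hm).symm
    _ ≤ _ := measureReal_mono Set.inter_subset_right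

theorem measureReal_le (hf : IsRegularDensity f C) {b : ℝ} (hb : ∀ x, f x ≤ b)
    {s : Set (EuclideanSpace ℝ (Fin d))} (hs : MeasurableSet s) (hfin : volume s ≠ ⊤) :
    (densityMeasure f).real s ≤ b * volume.real s := by
  calc _ = ∫ x in s, f x := hf.measureReal_eq hs
    _ ≤ ∫ x in s, b := setIntegral_mono_on hf.integrable.integrableOn (integrableOn_const hfin) hs
        fun x _ => hb x
    _ = _ := by rw [setIntegral_const, smul_eq_mul, mul_comm]

/-- The set contains all of `Cᶜ`, where the distance is zero, but `Cᶜ` is null for this law. Inside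
`C` the volume bound applies since `f` is bounded. -/
theorem exists_measureReal_boundary_layer_le (hf : IsRegularDensity f C) (hd : 1 ≤ d) :
    ∃ L : ℝ, 0 ≤ L ∧ ∀ t, 0 ≤ t →
      (densityMeasure f).real {a | Metric.infDist a Cᶜ ≤ t} ≤ L * t := by
  obtain ⟨L, hL, h⟩ := hf.convex.exists_volume_boundary_layer_le hd hf.compact hf.volume_ne_zero
  obtain ⟨b, hb, hfb⟩ := hf.exists_le
  refine ⟨b * L, by positivity, fun t ht => ?_⟩
  have hm : MeasurableSet {a | Metric.infDist a Cᶜ ≤ t} :=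
    measurableSet_le (Metric.continuous_infDist_pt _).measurable measurable_const
  have h1 : (densityMeasure f).real {a | Metric.infDist a Cᶜ ≤ t} =
      (densityMeasure f).real (C ∩ {a | Metric.infDist a Cᶜ ≤ t}) := by
    rw [measureReal_def, measureReal_def]
    congr 1
    refine measure_congr ?_
    filter_upwards [hf.ae_mem] with x hx
    exact propext ⟨fun h => ⟨hx, h⟩, fun h => h.2⟩
  rw [h1, mul_assoc]
  exact (hf.measureReal_le hfb (hf.measurableSet.inter hm)
    (measure_ne_top_of_subset Set.inter_subset_left hf.compact.measure_lt_top.ne)).trans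
    (mul_le_mul_of_nonneg_left (h t ht) hb.le)

/-- The content of a ball inside the support is its volume times the density at its centre, up to a
relative error of the order of the radius. -/
theorem abs_sub_measureReal_closedBall_le (hf : IsRegularDensity f C) (hd : 1 ≤ d) {L : ℝ}
    (hL : ∀ x ∈ C, ∀ y ∈ C, |f y - f x| ≤ L * ‖y - x‖) (hL0 : 0 ≤ L)
    {a : EuclideanSpace ℝ (Fin d)} {r : ℝ} (hr : 0 ≤ r) (h : Metric.closedBall a r ⊆ C) :
    |f a * (unitBallVol d * r ^ d) - (densityMeasure f).real (Metric.closedBall a r)| ≤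
      L * r * (unitBallVol d * r ^ d) := by
  have hm : MeasurableSet (Metric.closedBall a r) := Metric.isClosed_closedBall.measurableSet
  have hfin : volume (Metric.closedBall a r) < ⊤ := measure_closedBall_lt_top
  have haC : a ∈ C := h (Metric.mem_closedBall_self hr)
  -- The difference is the integral of `f a - f x` over the ball, and on the ball the integrand is
  -- at most `L * r`.
  have h1 := norm_setIntegral_le_of_norm_le_const (f := fun x => f a - f x) (C := L * r) hfin
    fun x hx => by
      rw [Metric.mem_closedBall, dist_comm, dist_eq_norm] at hx
      exact (hL x (h (by rwa [Metric.mem_closedBall, dist_comm, dist_eq_norm])) a haC).trans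
        (by gcongr)
  rw [integral_sub (integrable_const_iff.2 (Or.inr ⟨by simpa using hfin⟩)) hf.integrable.restrict, setIntegral_const,
    ← hf.measureReal_eq hm, volume_real_closedBall hd a hr, smul_eq_mul, mul_comm _ (f a)] at h1
  exact h1

end IsRegularDensity

end RegularDensity

/-! ### Pointwise comparison of volume and content of a ball. -/

section Bias

theorem abs_sqrt_sub_sqrt_le {w u A : ℝ} (hw : 0 ≤ w) (hu : 0 < u) (h : |w - u| ≤ A * u) :
    |√w - √u| ≤ A * √u := by
  have hs : 0 < √u := Real.sqrt_pos.2 hu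
  refine le_of_mul_le_mul_right ?_ hs
  calc |√w - √u| * √u ≤ |√w - √u| * (√w + √u) := by
        gcongr
        linarith [Real.sqrt_nonneg w]
    _ = |(√w - √u) * (√w + √u)| := by
        rw [abs_mul, abs_of_nonneg (add_nonneg (Real.sqrt_nonneg w) hs.le)]
    _ = |w - u| := by
        congr 1
        nlinarith [Real.sq_sqrt hw, Real.sq_sqrt hu.le]
    _ ≤ A * u := h
    _ = A * √u * √u := by rw [mul_assoc, Real.mul_self_sqrt hu.le]

/-- Split at `u = τ`. With `τ` of the order of the mean this bounds every moment of order at most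
`2` by the second one, so no asymptotics of general Gamma ratios are needed. -/
theorem rpow_le_rpow_add_mul_sq {u τ s : ℝ} (hu : 0 ≤ u) (hτ : 0 < τ) (hs : 0 ≤ s) (hs2 : s ≤ 2) :
    u ^ s ≤ τ ^ s + τ ^ (s - 2) * u ^ (2 : ℝ) := by
  rcases le_or_gt u τ with h | h
  · have : 0 ≤ τ ^ (s - 2) * u ^ (2 : ℝ) := by positivity
    have := Real.rpow_le_rpow hu h hs
    linarith
  · have hu0 : 0 < u := hτ.trans h
    have h1 : u ^ (s - 2) ≤ τ ^ (s - 2) := Real.rpow_le_rpow_of_nonpos hτ h.le (by linarith)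
    have h2 : u ^ s = u ^ (s - 2) * u ^ (2 : ℝ) := by
      rw [← Real.rpow_add hu0]
      ring_nf
    have : 0 ≤ τ ^ s := by positivity
    have := mul_le_mul_of_nonneg_right h1 (show 0 ≤ u ^ (2 : ℝ) by positivity)
    linarith

variable {d : ℕ} {f : EuclideanSpace ℝ (Fin d) → ℝ} {C : Set (EuclideanSpace ℝ (Fin d))}

namespace IsRegularDensity

variable [IsProbabilityMeasure (densityMeasure f)]

theorem exists_radius_le_rpow (hf : IsRegularDensity f C) (hd : 1 ≤ d) {D : ℝ} (hD : 0 < D)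
    (hCD : ∀ x ∈ C, ∀ y ∈ C, ‖x - y‖ ≤ D) :
    ∃ κ : ℝ, 0 < κ ∧ ∀ a ∈ C, ∀ r, 0 ≤ r → r ≤ D →
      r ≤ κ * (densityMeasure f).real (Metric.closedBall a r) ^ (1 / (d : ℝ)) := by
  obtain ⟨c, hc, h⟩ := hf.exists_le_measureReal_closedBall hD hCD
  refine ⟨(1 / c) ^ (1 / (d : ℝ)), by positivity, fun a ha r hr hrD => ?_⟩
  have h1 := h a ha r hr hrD
  rw [← Real.mul_rpow (by positivity) measureReal_nonneg]
  calc r = (r ^ d) ^ (1 / (d : ℝ)) := by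
        rw [one_div, Real.pow_rpow_inv_natCast hr (by omega)]
    _ ≤ _ := by
        refine Real.rpow_le_rpow (by positivity) ?_ (by positivity)
        rw [one_div, inv_mul_eq_div, le_div_iff₀ hc]
        linarith

/-- The first error term is for balls inside `C`, where the relative error is of order `r`, hence `U
^ (1/d)`. The second is for balls leaving `C`: there the relative error is only bounded, but the
centre lies in a boundary layer of width `κ * U ^ (1/d)`. -/
theorem exists_abs_sqrt_sub_le (hf : IsRegularDensity f C) (hd : 1 ≤ d) {D : ℝ} (hD : 0 < D)
    (hCD : ∀ x ∈ C, ∀ y ∈ C, ‖x - y‖ ≤ D) :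
    ∃ A κ : ℝ, 0 ≤ A ∧ 0 ≤ κ ∧ ∀ a ∈ C, ∀ r, 0 ≤ r → r ≤ D →
      |√(f a * (unitBallVol d * r ^ d)) - √((densityMeasure f).real (Metric.closedBall a r))| ≤
        A * ((densityMeasure f).real (Metric.closedBall a r) ^ (1 / 2 + 1 / (d : ℝ)) +
          if Metric.infDist a Cᶜ ≤
              κ * (densityMeasure f).real (Metric.closedBall a r) ^ (1 / (d : ℝ))
          then √((densityMeasure f).real (Metric.closedBall a r)) else 0) := by
  obtain ⟨c, hc, hlow⟩ := hf.exists_le_measureReal_closedBall hD hCD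
  obtain ⟨κ, hκ, hrad⟩ := hf.exists_radius_le_rpow hd hD hCD
  obtain ⟨L, hL0, hL⟩ := hf.exists_lipschitz
  obtain ⟨b, hb, hfb⟩ := hf.exists_le
  have hv := unitBallVol_pos d
  set v := unitBallVol d
  refine ⟨L * κ * (v / c) + b * (v / c), κ, by positivity, hκ.le, fun a ha r hr hrD => ?_⟩
  have hlow := hlow a ha r hr hrD
  have hrad := hrad a ha r hr hrD
  have hup := hf.measureReal_le hfb (s := Metric.closedBall a r)
    Metric.isClosed_closedBall.measurableSet measure_closedBall_lt_top.ne
  rw [volume_real_closedBall hd a hr] at hup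
  have hin := hf.abs_sub_measureReal_closedBall_le hd hL hL0 (a := a) hr
  have hw0 : 0 ≤ f a * (v * r ^ d) := mul_nonneg (hf.nonneg a) (by positivity)
  have hw : f a * (v * r ^ d) ≤ b * (v * r ^ d) :=
    mul_le_mul_of_nonneg_right (hfb a) (by positivity)
  set U := (densityMeasure f).real (Metric.closedBall a r)
  change U ≤ b * (v * r ^ d) at hup
  have hU0 : 0 ≤ U := measureReal_nonneg
  have hVU : v * r ^ d ≤ v / c * U := by
    rw [div_mul_eq_mul_div, le_div_iff₀ hc]
    nlinarith
  have hS0 : 0 ≤ U ^ (1 / 2 + 1 / (d : ℝ)) := by positivity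
  have hI0 : 0 ≤ if Metric.infDist a Cᶜ ≤ κ * U ^ (1 / (d : ℝ)) then √U else 0 := by
    split_ifs <;> positivity
  -- Relative errors need `U > 0`; if `U = 0`, the lower bound on the content forces the volume to
  -- vanish as well.
  rcases hU0.eq_or_lt with hU | hU
  · have hr0 : r ^ d ≤ 0 := by
      rw [← hU] at hlow
      nlinarith
    have hr0' : r ^ d = 0 := le_antisymm hr0 (by positivity)
    rw [hr0', ← hU, mul_zero, mul_zero, sub_self, abs_zero]
    rw [← hU] at hS0 hI0
    positivity
  by_cases hball : Metric.closedBall a r ⊆ C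
  · have h1 : |f a * (v * r ^ d) - U| ≤ L * κ * (v / c) * U ^ (1 / (d : ℝ)) * U := by
      calc _ ≤ L * r * (v * r ^ d) := hin hball
        _ ≤ L * (κ * U ^ (1 / (d : ℝ))) * (v / c * U) := by gcongr
        _ = _ := by ring
    refine (abs_sqrt_sub_sqrt_le hw0 hU h1).trans ?_
    have h2 : L * κ * (v / c) * U ^ (1 / (d : ℝ)) * √U =
        L * κ * (v / c) * U ^ (1 / 2 + 1 / (d : ℝ)) := by
      rw [Real.rpow_add hU, Real.sqrt_eq_rpow]
      ring
    rw [h2]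
    refine mul_le_mul ?_ (le_add_of_nonneg_right hI0) hS0 (by positivity)
    exact le_add_of_nonneg_right (by positivity)
  · have h1 : |f a * (v * r ^ d) - U| ≤ b * (v / c) * U := by
      have : b * (v * r ^ d) ≤ b * (v / c) * U := by
        rw [mul_assoc]
        gcongr
      rw [abs_le]
      constructor <;> linarith
    have h2 : Metric.infDist a Cᶜ ≤ κ * U ^ (1 / (d : ℝ)) := by
      refine le_trans ?_ hrad
      by_contra h
      exact hball (closedBall_subset_of_lt_infDist_compl (not_le.1 h))
    refine (abs_sqrt_sub_sqrt_le hw0 hU h1).trans ?_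
    rw [if_pos h2]
    refine mul_le_mul ?_ (le_add_of_nonneg_left hS0) (by positivity) (by positivity)
    exact le_add_of_nonneg_left (by positivity)

end IsRegularDensity

end Bias

/-! ### Joint law of a sample point and the content of its ball. -/

section PairLaw

variable {E : Type*} [NormedAddCommGroup E]

theorem kthRadius_erase_eq {N : ℕ} (x : Fin (N + 1) → E) (i : Fin (N + 1)) (k : ℕ) (c : E) :
    kthRadius x (Finset.univ.erase i) k c =
      kthRadius (fun j => x (i.succAbove j)) Finset.univ k c := by
  have : (Finset.univ.erase i : Finset (Fin (N + 1))) = Finset.univ.map i.succAboveEmb := by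
    rw [Fin.univ_succAbove N i, Finset.erase_cons]
  rw [this, kthRadius_map]
  rfl

variable [MeasurableSpace E] [SecondCountableTopology E]

/-- Coordinate `i` is split off as the centre and the others are renumbered. The right side is free
of `i`, so all terms of the estimator have the same mean. -/
theorem integral_pi_kthRadius (μ : Measure E) [IsProbabilityMeasure μ] {N : ℕ} (i : Fin (N + 1))
    (k : ℕ) (Φ : E → ℝ → ℝ) :
    ∫ x, Φ (x i) (kthRadius x (Finset.univ.erase i) k (x i)) ∂(Measure.pi fun _ => μ) =
      ∫ q : E × (Fin N → E), Φ q.1 (kthRadius q.2 Finset.univ k q.1)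
        ∂(μ.prod (Measure.pi fun _ => μ)) := by
  rw [← (measurePreserving_piFinSuccAbove (fun _ => μ) i).integral_comp
    (MeasurableEquiv.measurableEmbedding _)]
  refine integral_congr_ae (ae_of_all _ fun x => ?_)
  simp only [kthRadius_erase_eq]
  rfl

variable [BorelSpace E]

/-- The content of the `k`-th nearest neighbour ball of an independent point is independent of that
point. -/
theorem map_prodMk_ballContent {N k : ℕ} (hk : k ≤ N) (μ : Measure E) [IsProbabilityMeasure μ]
    (hs : ∀ c r, μ (Metric.sphere c r) = 0) :
    (μ.prod (Measure.pi fun _ : Fin N => μ)).map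
        (fun q => (q.1, ballContent μ q.2 Finset.univ k q.1)) =
      μ.prod ((Measure.pi fun _ : Fin N => μ).map
        fun y => ballContent μ y Finset.univ k 0) := by
  have hm := measurable_ballContent (ι := Fin N) μ Finset.univ k
  have hm' : ∀ c, Measurable fun y : Fin N → E => ballContent μ y Finset.univ k c := fun c =>
    hm.comp (measurable_const.prodMk measurable_id)
  have : IsProbabilityMeasure ((Measure.pi fun _ : Fin N => μ).map
      fun y => ballContent μ y Finset.univ k 0) :=
    Measure.isProbabilityMeasure_map (hm' 0).aemeasurable
  refine (Measure.prod_eq fun s t hs' ht => ?_).symm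
  rw [Measure.map_apply (measurable_fst.prodMk hm) (hs'.prod ht), Measure.prod_apply
    ((measurable_fst.prodMk hm) (hs'.prod ht))]
  -- Sections of the preimage of a rectangle have a probability that depends on `a` only through
  -- membership in `s`, by `map_ballContent_eq`. Hence the joint law is a product.
  have h : ∀ a, (Measure.pi fun _ : Fin N => μ) (Prod.mk a ⁻¹'
      ((fun q : E × (Fin N → E) => (q.1, ballContent μ q.2 Finset.univ k q.1)) ⁻¹' s ×ˢ t)) =
      s.indicator (fun _ => (Measure.pi fun _ : Fin N => μ).map
        (fun y => ballContent μ y Finset.univ k 0) t) a := by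
    intro a
    by_cases ha : a ∈ s
    · rw [Set.indicator_of_mem ha, map_ballContent_eq hk μ hs 0 a, Measure.map_apply (hm' a) ht]
      congr 1
      ext y
      simp [ha]
    · rw [Set.indicator_of_notMem ha]
      convert measure_empty
      · ext y
        simp [ha]
      · infer_instance
  simp only [h]
  rw [lintegral_indicator hs', lintegral_const, Measure.restrict_apply_univ, mul_comm]

theorem integral_ballContent_rpow {N k : ℕ} (hk1 : 1 ≤ k) (hk : k ≤ N) (μ : Measure E)
    [IsProbabilityMeasure μ] (c : E) (hs : ∀ r, μ (Metric.sphere c r) = 0) {s : ℝ} (hs0 : 0 < s) :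
    ∫ y, ballContent μ y Finset.univ k c ^ s ∂(Measure.pi fun _ : Fin N => μ) =
      Real.Gamma (k + s) / Real.Gamma k * (Real.Gamma (N + 1) / Real.Gamma (N + 1 + s)) :=
  integral_rpow_of_binomialTail _
    ((measurable_ballContent μ _ k).comp (measurable_const.prodMk measurable_id))
    (fun _ => measureReal_nonneg) (fun _ => measureReal_le_one) hk1 hk
    (fun _ hu0 hu1 => measureReal_lt_ballContent hk μ c hs hu0 hu1) hs0

end PairLaw

/-! ### Expectation of a single term of the estimator. -/

section Bias

/-- The estimator with weight function `H`, as a function of a sample of `n` points. -/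
noncomputable def knnEst {d n : ℕ} (H : EuclideanSpace ℝ (Fin d) → ℝ) (k : ℕ)
    (x : Fin n → EuclideanSpace ℝ (Fin d)) : ℝ :=
  gammaRatio k * (1 / √(n : ℝ)) *
    ∑ i, H (x i) * √(unitBallVol d * kthRadius x (Finset.univ.erase i) k (x i) ^ d)

theorem gammaRatio_pos {k : ℕ} (hk : 1 ≤ k) : 0 < gammaRatio k := by
  have : (0 : ℝ) < k := by exact_mod_cast hk
  exact div_pos (Real.Gamma_pos_of_pos this) (Real.Gamma_pos_of_pos (by positivity))

theorem gammaRatio_nonneg (k : ℕ) : 0 ≤ gammaRatio k :=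
  div_nonneg (Real.Gamma_nonneg_of_nonneg (by positivity))
    (Real.Gamma_nonneg_of_nonneg (by positivity))

theorem one_le_sqrt_mul_gammaRatio {k : ℕ} (hk : 1 ≤ k) : 1 ≤ √(k : ℝ) * gammaRatio k :=
  one_le_sqrt_mul_gamma_ratio (by exact_mod_cast hk)

theorem sqrt_mul_gammaRatio_le {k : ℕ} (hk : 1 ≤ k) :
    √(k : ℝ) * gammaRatio k ≤ 1 + 1 / (2 * k) :=
  sqrt_mul_gamma_ratio_le (by exact_mod_cast hk)

variable {d : ℕ} {f : EuclideanSpace ℝ (Fin d) → ℝ} {C : Set (EuclideanSpace ℝ (Fin d))}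

theorem ae_prod_pi_forall_mem {E : Type*} [MeasurableSpace E] {μ : Measure E}
    [IsProbabilityMeasure μ] {C : Set E} (h : ∀ᵐ x ∂μ, x ∈ C) (N : ℕ) :
    ∀ᵐ q : E × (Fin N → E) ∂(μ.prod (Measure.pi fun _ => μ)), q.1 ∈ C ∧ ∀ l, q.2 l ∈ C := by
  have h1 : ∀ᵐ q : E × (Fin N → E) ∂(μ.prod (Measure.pi fun _ => μ)), q.1 ∈ C :=
    Measure.quasiMeasurePreserving_fst.ae h
  have h2 : ∀ᵐ q : E × (Fin N → E) ∂(μ.prod (Measure.pi fun _ => μ)), ∀ l, q.2 l ∈ C := by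
    refine Measure.quasiMeasurePreserving_snd.ae (p := fun y : Fin N → E => ∀ l, y l ∈ C) ?_
    exact ae_all_iff.2 fun l => (Measure.quasiMeasurePreserving_eval (fun _ => μ) l).ae h
  filter_upwards [h1, h2] with q hq1 hq2 using ⟨hq1, hq2⟩

/-- The second moment is explicit and at most `2 * (k/n) ^ 2`, where `n = N + 1`. Interpolation at
`τ = k/n` then gives the constant `1 + 2`. -/
theorem integral_ballContent_rpow_le {E : Type*} [NormedAddCommGroup E] [MeasurableSpace E]
    [BorelSpace E] [SecondCountableTopology E] {N k : ℕ} (hk1 : 1 ≤ k) (hk : k ≤ N) (μ : Measure E)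
    [IsProbabilityMeasure μ] (c : E) (hs : ∀ r, μ (Metric.sphere c r) = 0) {s : ℝ} (hs0 : 0 < s)
    (hs2 : s ≤ 2) :
    ∫ y, ballContent μ y Finset.univ k c ^ s ∂(Measure.pi fun _ : Fin N => μ) ≤
      3 * ((k : ℝ) / (N + 1 : ℕ)) ^ s := by
  have hk0 : (0 : ℝ) < k := by exact_mod_cast hk1
  set τ : ℝ := (k : ℝ) / (N + 1 : ℕ)
  have hτ : 0 < τ := by positivity
  have hm : Measurable fun y : Fin N → E => ballContent μ y Finset.univ k c :=
    (measurable_ballContent μ _ k).comp (measurable_const.prodMk measurable_id)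
  have h0 : ∀ y : Fin N → E, 0 ≤ ballContent μ y Finset.univ k c := fun _ => measureReal_nonneg
  have h1 : ∀ y : Fin N → E, ballContent μ y Finset.univ k c ≤ 1 := fun _ => measureReal_le_one
  have hi : ∀ t : ℝ, 0 ≤ t → Integrable (fun y => ballContent μ y Finset.univ k c ^ t)
      (Measure.pi fun _ : Fin N => μ) := fun t ht =>
    Integrable.of_bound (hm.pow_const t).aestronglyMeasurable 1 (ae_of_all _ fun y => by
      rw [Real.norm_of_nonneg (Real.rpow_nonneg (h0 y) t)]
      exact Real.rpow_le_one (h0 y) (h1 y) ht)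
  have hE2 : ∫ y, ballContent μ y Finset.univ k c ^ (2 : ℝ) ∂(Measure.pi fun _ : Fin N => μ) ≤
      2 * τ ^ (2 : ℝ) := by
    have hg : ∀ x : ℝ, 0 < x → Real.Gamma (x + 2) = (x + 1) * x * Real.Gamma x := by
      intro x hx
      rw [show x + 2 = x + 1 + 1 by ring, Real.Gamma_add_one (by positivity),
        Real.Gamma_add_one hx.ne', mul_assoc]
    have hGk := Real.Gamma_pos_of_pos hk0
    have hGN := Real.Gamma_pos_of_pos (show (0 : ℝ) < N + 1 by positivity)
    rw [integral_ballContent_rpow hk1 hk μ c hs (by norm_num), hg k hk0, hg (N + 1) (by positivity)]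
    simp only [τ]
    rw [show (2 : ℝ) = ((2 : ℕ) : ℝ) by norm_num, Real.rpow_natCast]
    push_cast
    have hk1' : (1 : ℝ) ≤ k := by exact_mod_cast hk1
    calc _ = ((k : ℝ) + 1) * k / (((N : ℝ) + 1 + 1) * (N + 1)) := by field_simp
      _ ≤ (2 * k) * k / ((N + 1) * (N + 1)) := by gcongr <;> linarith
      _ = _ := by
        rw [div_pow]
        ring
  calc _ ≤ ∫ y, (τ ^ s + τ ^ (s - 2) * ballContent μ y Finset.univ k c ^ (2 : ℝ))
        ∂(Measure.pi fun _ : Fin N => μ) := by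
        refine integral_mono (hi s hs0.le) ((integrable_const _).add ((hi 2 (by norm_num)).const_mul _))
          fun y => ?_
        exact rpow_le_rpow_add_mul_sq (h0 y) hτ hs0.le hs2
    _ = τ ^ s + τ ^ (s - 2) * ∫ y, ballContent μ y Finset.univ k c ^ (2 : ℝ)
        ∂(Measure.pi fun _ : Fin N => μ) := by
        rw [integral_add (integrable_const _) ((hi 2 (by norm_num)).const_mul _),
          integral_const_mul]
        simp
    _ ≤ τ ^ s + τ ^ (s - 2) * (2 * τ ^ (2 : ℝ)) := by gcongr
    _ = 3 * τ ^ s := by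
        rw [mul_left_comm, ← Real.rpow_add hτ]
        ring_nf

section IndependentPair

/-- By Fubini the layer is integrated first with `u` fixed. Its probability is at most `B * κ * u ^
s`, and multiplying by `√u` restores the power `1/2 + s`. The product structure of the law is what
permits this. -/
theorem integrable_and_integral_le_of_layer {E : Type*} [MeasurableSpace E] {μ : Measure E}
    [IsProbabilityMeasure μ] {ν : Measure ℝ} [IsProbabilityMeasure ν]
    (hν : ∀ᵐ u ∂ν, 0 ≤ u ∧ u ≤ 1) {ρ : E → ℝ} (hρ : Measurable ρ) {B κ s : ℝ} (hκ : 0 ≤ κ)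
    (hB : ∀ t, 0 ≤ t → μ.real {a | ρ a ≤ t} ≤ B * t) (hs : 0 ≤ s) :
    Integrable (fun p : E × ℝ => p.2 ^ (1 / 2 + s) + if ρ p.1 ≤ κ * p.2 ^ s then √p.2 else 0)
        (μ.prod ν) ∧
      ∫ p, (p.2 ^ (1 / 2 + s) + if ρ p.1 ≤ κ * p.2 ^ s then √p.2 else 0) ∂(μ.prod ν) ≤
        (1 + B * κ) * ∫ u, u ^ (1 / 2 + s) ∂ν := by
  have hs' : 0 ≤ 1 / 2 + s := by positivity
  have hsnd : ∀ᵐ p ∂(μ.prod ν), 0 ≤ p.2 ∧ p.2 ≤ 1 := Measure.quasiMeasurePreserving_snd.ae hν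
  have hInd : Measurable fun p : E × ℝ => if ρ p.1 ≤ κ * p.2 ^ s then √p.2 else 0 := by
    refine Measurable.ite (measurableSet_le ?_ ?_) measurable_snd.sqrt measurable_const
    · exact hρ.comp measurable_fst
    · exact (measurable_snd.pow_const _).const_mul _
  have hνi : Integrable (fun u : ℝ => u ^ (1 / 2 + s)) ν := by
    refine Integrable.of_bound (by fun_prop : Measurable fun u : ℝ => u ^ (1 / 2 + s)).aestronglyMeasurable 1 ?_
    filter_upwards [hν] with u hu
    rw [Real.norm_of_nonneg (Real.rpow_nonneg hu.1 _)]
    exact Real.rpow_le_one hu.1 hu.2 hs'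
  have hint3 : Integrable (fun p : E × ℝ => p.2 ^ (1 / 2 + s)) (μ.prod ν) := by
    refine Integrable.of_bound (measurable_snd.pow_const _).aestronglyMeasurable 1 ?_
    filter_upwards [hsnd] with p hp
    rw [Real.norm_of_nonneg (Real.rpow_nonneg hp.1 _)]
    exact Real.rpow_le_one hp.1 hp.2 hs'
  have hint4 : Integrable (fun p : E × ℝ => if ρ p.1 ≤ κ * p.2 ^ s then √p.2 else 0)
      (μ.prod ν) := by
    refine Integrable.of_bound hInd.aestronglyMeasurable 1 ?_
    filter_upwards [hsnd] with p hp
    split_ifs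
    · rw [Real.norm_of_nonneg (Real.sqrt_nonneg _)]
      exact Real.sqrt_le_one.2 hp.2
    · simp
  refine ⟨hint3.add hint4, ?_⟩
  have h1 : ∫ p : E × ℝ, p.2 ^ (1 / 2 + s) ∂(μ.prod ν) = ∫ u, u ^ (1 / 2 + s) ∂ν := by
    have := integral_prod_mul (μ := μ) (ν := ν) (fun _ => (1 : ℝ)) (fun u : ℝ => u ^ (1 / 2 + s))
    simpa using this
  have h2 : ∫ p : E × ℝ, (if ρ p.1 ≤ κ * p.2 ^ s then √p.2 else 0) ∂(μ.prod ν) ≤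
      B * κ * ∫ u, u ^ (1 / 2 + s) ∂ν := by
    rw [integral_prod_symm _ hint4, ← integral_const_mul]
    refine integral_mono_ae hint4.integral_prod_right (hνi.const_mul _) ?_
    filter_upwards [hν] with u hu
    have hset : MeasurableSet {a | ρ a ≤ κ * u ^ s} := measurableSet_le hρ measurable_const
    have h3 : ∫ a, (if ρ a ≤ κ * u ^ s then √u else 0) ∂μ =
        √u * μ.real {a | ρ a ≤ κ * u ^ s} := by
      have := integral_indicator_const (μ := μ) (√u) hset
      rw [smul_eq_mul, mul_comm (μ.real _)] at this
      rw [← this]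
      rfl
    have h4 := hB (κ * u ^ s) (mul_nonneg hκ (Real.rpow_nonneg hu.1 _))
    have h5 : u ^ (1 / 2 + s) = √u * u ^ s := by
      rw [Real.sqrt_eq_rpow, ← Real.rpow_add_of_nonneg hu.1 (by norm_num) hs]
    rw [h3, h5]
    calc _ ≤ √u * (B * (κ * u ^ s)) := mul_le_mul_of_nonneg_left h4 (Real.sqrt_nonneg _)
      _ = _ := by ring
  rw [integral_add hint3 hint4, h1]
  linarith

variable {E : Type*} [NormedAddCommGroup E] [MeasurableSpace E] [BorelSpace E]
  [SecondCountableTopology E] {N k : ℕ} {μ : Measure E} [IsProbabilityMeasure μ]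

theorem measurable_ballContent_zero (μ : Measure E) [IsProbabilityMeasure μ] (N k : ℕ) :
    Measurable fun y : Fin N → E => ballContent μ y Finset.univ k 0 :=
  (measurable_ballContent μ _ k).comp (measurable_const.prodMk measurable_id)

theorem integral_mul_sqrt_ballContent (hk1 : 1 ≤ k) (hk : k ≤ N)
    (hs : ∀ c r, μ (Metric.sphere c r) = 0) {g : E → ℝ} (hg : Measurable g) :
    ∫ q : E × (Fin N → E), g q.1 * √(ballContent μ q.2 Finset.univ k q.1)
      ∂(μ.prod (Measure.pi fun _ => μ)) =
    (∫ x, g x ∂μ) * (Real.Gamma (k + 1 / 2) / Real.Gamma k *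
      (Real.Gamma (N + 1) / Real.Gamma (N + 1 + 1 / 2))) := by
  have hm0 := measurable_ballContent_zero μ N k
  have hνp := Measure.isProbabilityMeasure_map (μ := Measure.pi fun _ : Fin N => μ) hm0.aemeasurable
  have hpm : Measurable fun q : E × (Fin N → E) => (q.1, ballContent μ q.2 Finset.univ k q.1) :=
    measurable_fst.prodMk (measurable_ballContent μ _ k)
  have hF : Measurable fun p : E × ℝ => g p.1 * √p.2 :=
    (hg.comp measurable_fst).mul measurable_snd.sqrt
  rw [← integral_ballContent_rpow hk1 hk μ 0 (hs 0) (by norm_num)]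
  calc _ = ∫ p, g p.1 * √p.2 ∂((μ.prod (Measure.pi fun _ : Fin N => μ)).map
        (fun q => (q.1, ballContent μ q.2 Finset.univ k q.1))) :=
        (integral_map hpm.aemeasurable hF.aestronglyMeasurable).symm
    _ = (∫ x, g x ∂μ) * ∫ u, √u ∂((Measure.pi fun _ : Fin N => μ).map
        fun y => ballContent μ y Finset.univ k 0) := by
        rw [map_prodMk_ballContent hk μ hs]
        exact integral_prod_mul g fun u => √u
    _ = _ := by
        rw [integral_map hm0.aemeasurable (by fun_prop)]
        simp only [Real.sqrt_eq_rpow]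

theorem integrable_and_integral_ballContent_le_of_layer (hk1 : 1 ≤ k) (hk : k ≤ N)
    (hsph : ∀ c r, μ (Metric.sphere c r) = 0) {ρ : E → ℝ} (hρ : Measurable ρ) {B κ s : ℝ}
    (hB0 : 0 ≤ B) (hκ : 0 ≤ κ) (hB : ∀ t, 0 ≤ t → μ.real {a | ρ a ≤ t} ≤ B * t) (hs : 0 ≤ s)
    (hs1 : s ≤ 1) :
    Integrable (fun q : E × (Fin N → E) => ballContent μ q.2 Finset.univ k q.1 ^ (1 / 2 + s) +
        if ρ q.1 ≤ κ * ballContent μ q.2 Finset.univ k q.1 ^ s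
        then √(ballContent μ q.2 Finset.univ k q.1) else 0) (μ.prod (Measure.pi fun _ => μ)) ∧
      ∫ q : E × (Fin N → E), (ballContent μ q.2 Finset.univ k q.1 ^ (1 / 2 + s) +
        if ρ q.1 ≤ κ * ballContent μ q.2 Finset.univ k q.1 ^ s
        then √(ballContent μ q.2 Finset.univ k q.1) else 0) ∂(μ.prod (Measure.pi fun _ => μ)) ≤
      (1 + B * κ) * (3 * ((k : ℝ) / (N + 1 : ℕ)) ^ (1 / 2 + s)) := by
  have hm0 := measurable_ballContent_zero μ N k
  have hνp := Measure.isProbabilityMeasure_map (μ := Measure.pi fun _ : Fin N => μ) hm0.aemeasurable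
  have hpm : Measurable fun q : E × (Fin N → E) => (q.1, ballContent μ q.2 Finset.univ k q.1) :=
    measurable_fst.prodMk (measurable_ballContent μ _ k)
  have hν01 : ∀ᵐ u ∂((Measure.pi fun _ : Fin N => μ).map
      fun y => ballContent μ y Finset.univ k 0), 0 ≤ u ∧ u ≤ 1 := by
    refine (ae_map_iff hm0.aemeasurable ?_).2 (ae_of_all _ fun y =>
      ⟨measureReal_nonneg, measureReal_le_one⟩)
    exact (measurableSet_Icc : MeasurableSet (Set.Icc (0 : ℝ) 1))
  obtain ⟨hi, hle⟩ := integrable_and_integral_le_of_layer hν01 hρ hκ hB hs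
  have hF : Measurable fun p : E × ℝ =>
      p.2 ^ (1 / 2 + s) + if ρ p.1 ≤ κ * p.2 ^ s then √p.2 else 0 := by
    refine (measurable_snd.pow_const _).add
      (Measurable.ite (measurableSet_le ?_ ?_) measurable_snd.sqrt measurable_const)
    · exact hρ.comp measurable_fst
    · exact (measurable_snd.pow_const _).const_mul _
  rw [← map_prodMk_ballContent hk μ hsph] at hi hle
  rw [integral_map hpm.aemeasurable hF.aestronglyMeasurable] at hle
  refine ⟨(integrable_map_measure hF.aestronglyMeasurable hpm.aemeasurable).1 hi, hle.trans ?_⟩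
  rw [integral_map hm0.aemeasurable (by fun_prop : Measurable fun u : ℝ => u ^ (1 / 2 + s)).aestronglyMeasurable]
  gcongr
  exact integral_ballContent_rpow_le hk1 hk μ 0 (hsph 0) (by positivity) (by linarith)

end IndependentPair

namespace IsRegularDensity

variable [IsProbabilityMeasure (densityMeasure f)]

/-- Writing `H √V = (H/√f) √(f V)` and replacing `f V` by the content `U`, the main term factorises
by independence. The error is controlled by `exists_abs_sqrt_sub_le` and `H/√f` is bounded on `C`.
-/
theorem exists_abs_integral_sub_le (hf : IsRegularDensity f C) (hd : 1 ≤ d)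
    {H : EuclideanSpace ℝ (Fin d) → ℝ} (hH : Measurable H) {M : ℝ} (hM : ∀ x, |H x| ≤ M) :
    ∃ K : ℝ, 0 ≤ K ∧ ∀ N k : ℕ, 1 ≤ k → k ≤ N →
      |∫ q : EuclideanSpace ℝ (Fin d) × (Fin N → EuclideanSpace ℝ (Fin d)),
          H q.1 * √(unitBallVol d * kthRadius q.2 Finset.univ k q.1 ^ d)
          ∂((densityMeasure f).prod (Measure.pi fun _ => densityMeasure f)) -
        (∫ x, H x * √(f x)) * (Real.Gamma (k + 1 / 2) / Real.Gamma k *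
          (Real.Gamma (N + 1) / Real.Gamma (N + 1 + 1 / 2)))| ≤
        K * ((k : ℝ) / (N + 1 : ℕ)) ^ (1 / 2 + 1 / (d : ℝ)) := by
  obtain ⟨D, hD, hCD⟩ := hf.exists_diam
  obtain ⟨A, κ, hA, hκ, hsq⟩ := hf.exists_abs_sqrt_sub_le hd hD hCD
  obtain ⟨B, hB, hlayer⟩ := hf.exists_measureReal_boundary_layer_le hd
  obtain ⟨a₁, ha₁, hlow⟩ := hf.lower
  have hM0 : 0 ≤ M := (abs_nonneg _).trans (hM 0)
  have hG : 0 ≤ M / √a₁ := by positivity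
  refine ⟨M / √a₁ * (A * ((1 + B * κ) * 3)), by positivity, fun N k hk1 hk => ?_⟩
  have hd1 : 1 / (d : ℝ) ≤ 1 := (div_le_one (by positivity)).2 (by exact_mod_cast hd)
  obtain ⟨herri, herr⟩ := integrable_and_integral_ballContent_le_of_layer hk1 hk
    (measure_sphere (f := f) hd) (Metric.continuous_infDist_pt Cᶜ).measurable hB hκ hlayer
    (s := 1 / (d : ℝ)) (by positivity) hd1
  have hgm : Measurable fun a => H a / √(f a) := hH.div hf.measurable.sqrt
  have hmain := integral_mul_sqrt_ballContent hk1 hk (measure_sphere (f := f) hd) hgm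
  have hgint : ∫ x, H x / √(f x) ∂(densityMeasure f) = ∫ x, H x * √(f x) := by
    rw [hf.integral_eq]
    refine integral_congr_ae (ae_of_all _ fun x => ?_)
    have := Real.mul_self_sqrt (hf.nonneg x)
    dsimp only
    -- Where the density vanishes both sides are `0`, the quotient by the convention on division by
    -- zero.
    by_cases hx : √(f x) = 0
    · rw [hx] at this ⊢
      simp
    · calc f x * (H x / √(f x)) = (√(f x) * √(f x)) * (H x / √(f x)) := by rw [this]
        _ = _ := by field_simp
  rw [hgint] at hmain
  have hgle : ∀ a ∈ C, |H a / √(f a)| ≤ M / √a₁ := fun a ha => by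
    rw [abs_div, abs_of_nonneg (Real.sqrt_nonneg _)]
    exact div_le_div₀ hM0 (hM a) (Real.sqrt_pos.2 ha₁) (Real.sqrt_le_sqrt (hlow a ha))
  have hRm := measurable_kthRadius (E := EuclideanSpace ℝ (Fin d)) (Finset.univ : Finset (Fin N)) k
  have hUm := measurable_ballContent (densityMeasure f) (Finset.univ : Finset (Fin N)) k
  have hRD : ∀ᵐ q : EuclideanSpace ℝ (Fin d) × (Fin N → EuclideanSpace ℝ (Fin d))
      ∂((densityMeasure f).prod (Measure.pi fun _ => densityMeasure f)),
      q.1 ∈ C ∧ kthRadius q.2 Finset.univ k q.1 ≤ D := by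
    filter_upwards [ae_prod_pi_forall_mem hf.ae_mem N] with q hq
    exact ⟨hq.1, kthRadius_le_of_forall _ _ _ hD.le fun l _ => hCD _ (hq.2 l) _ hq.1⟩
  have hint1 : Integrable (fun q : EuclideanSpace ℝ (Fin d) × (Fin N → EuclideanSpace ℝ (Fin d)) =>
      H q.1 * √(unitBallVol d * kthRadius q.2 Finset.univ k q.1 ^ d))
      ((densityMeasure f).prod (Measure.pi fun _ => densityMeasure f)) := by
    refine Integrable.of_bound ((hH.comp measurable_fst).mul
      ((hRm.pow_const d).const_mul _).sqrt).aestronglyMeasurable (M * √(unitBallVol d * D ^ d)) ?_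
    filter_upwards [hRD] with q hq
    rw [norm_mul, Real.norm_of_nonneg (Real.sqrt_nonneg _)]
    have := kthRadius_nonneg q.2 Finset.univ k q.1
    have := unitBallVol_pos d
    exact mul_le_mul (hM _) (Real.sqrt_le_sqrt (by gcongr; exact hq.2)) (Real.sqrt_nonneg _) hM0
  have hint2 : Integrable (fun q : EuclideanSpace ℝ (Fin d) × (Fin N → EuclideanSpace ℝ (Fin d)) =>
      H q.1 / √(f q.1) * √(ballContent (densityMeasure f) q.2 Finset.univ k q.1))
      ((densityMeasure f).prod (Measure.pi fun _ => densityMeasure f)) := by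
    refine Integrable.of_bound ((hgm.comp measurable_fst).mul
      hUm.sqrt).aestronglyMeasurable (M / √a₁ * 1) ?_
    filter_upwards [hRD] with q hq
    rw [norm_mul, Real.norm_of_nonneg (Real.sqrt_nonneg _)]
    exact mul_le_mul (hgle _ hq.1) (Real.sqrt_le_one.2 measureReal_le_one) (Real.sqrt_nonneg _) hG
  rw [← hmain, ← integral_sub hint1 hint2, ← Real.norm_eq_abs]
  refine (norm_integral_le_of_norm_le ((herri.const_mul A).const_mul (M / √a₁)) ?_).trans ?_
  · filter_upwards [hRD] with q hq
    have h1 := hsq q.1 hq.1 _ (kthRadius_nonneg q.2 Finset.univ k q.1) hq.2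
    have hfa : 0 < √(f q.1) := Real.sqrt_pos.2 (ha₁.trans_le (hlow _ hq.1))
    have h2 : H q.1 * √(unitBallVol d * kthRadius q.2 Finset.univ k q.1 ^ d) - H q.1 / √(f q.1) *
        √(ballContent (densityMeasure f) q.2 Finset.univ k q.1) =
        H q.1 / √(f q.1) * (√(f q.1 * (unitBallVol d * kthRadius q.2 Finset.univ k q.1 ^ d)) -
          √(ballContent (densityMeasure f) q.2 Finset.univ k q.1)) := by
      rw [Real.sqrt_mul (hf.nonneg _)]
      field_simp
    rw [h2, norm_mul]
    exact mul_le_mul (hgle _ hq.1) h1 (norm_nonneg _) hG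
  · rw [integral_const_mul, integral_const_mul]
    calc _ ≤ M / √a₁ * (A * ((1 + B * κ) *
          (3 * ((k : ℝ) / (N + 1 : ℕ)) ^ (1 / 2 + 1 / (d : ℝ))))) := by gcongr
      _ = _ := by ring

end IsRegularDensity

end Bias

/-! ### Integrability of the estimator and its bias on the product space. -/

section Bias

variable {d : ℕ} {f : EuclideanSpace ℝ (Fin d) → ℝ} {C : Set (EuclideanSpace ℝ (Fin d))}

theorem measurable_kthRadius_apply {E : Type*} [NormedAddCommGroup E] [MeasurableSpace E]
    [BorelSpace E] [SecondCountableTopology E] {n : ℕ} (S : Finset (Fin n)) (k : ℕ) (i : Fin n) :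
    Measurable fun x : Fin n → E => kthRadius x S k (x i) := by
  have h : Measurable fun x : Fin n → E => (x i, x) := by fun_prop
  have h2 : Measurable fun q : E × (Fin n → E) => kthRadius q.2 S k q.1 := measurable_kthRadius S k
  have h3 := h2.comp h
  simp only [Function.comp_def] at h3
  exact h3

theorem measurable_knnTerm {n : ℕ} {H : EuclideanSpace ℝ (Fin d) → ℝ} (hH : Measurable H)
    (S : Finset (Fin n)) (k : ℕ) (i : Fin n) :
    Measurable fun x : Fin n → EuclideanSpace ℝ (Fin d) =>
      H (x i) * √(unitBallVol d * kthRadius x S k (x i) ^ d) :=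
  (hH.comp (measurable_pi_apply i)).mul
    (((measurable_kthRadius_apply S k i).pow_const d).const_mul _).sqrt

theorem ae_pi_forall_mem {E : Type*} [MeasurableSpace E] {μ : Measure E}
    [IsProbabilityMeasure μ] {C : Set E} (h : ∀ᵐ x ∂μ, x ∈ C) (n : ℕ) :
    ∀ᵐ x ∂(Measure.pi fun _ : Fin n => μ), ∀ l, x l ∈ C :=
  ae_all_iff.2 fun l => (Measure.quasiMeasurePreserving_eval (fun _ => μ) l).ae h

theorem kthRadius_apply_le {E ι : Type*} [NormedAddCommGroup E] {C : Set E} {D : ℝ} (hD : 0 ≤ D)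
    (hCD : ∀ x ∈ C, ∀ y ∈ C, ‖x - y‖ ≤ D) {x : ι → E} (hx : ∀ l, x l ∈ C)
    (S : Finset ι) (k : ℕ) (i : ι) : kthRadius x S k (x i) ≤ D :=
  kthRadius_le_of_forall _ _ _ hD fun l _ => hCD _ (hx l) _ (hx i)

theorem abs_knnTerm_le {n : ℕ} {H : EuclideanSpace ℝ (Fin d) → ℝ} {M D : ℝ}
    (hM : ∀ x, |H x| ≤ M) (hD : 0 ≤ D) (hCD : ∀ x ∈ C, ∀ y ∈ C, ‖x - y‖ ≤ D)
    {x : Fin n → EuclideanSpace ℝ (Fin d)} (hx : ∀ l, x l ∈ C) (S : Finset (Fin n)) (k : ℕ)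
    (i : Fin n) :
    |H (x i) * √(unitBallVol d * kthRadius x S k (x i) ^ d)| ≤ M * √(unitBallVol d * D ^ d) := by
  rw [abs_mul, abs_of_nonneg (Real.sqrt_nonneg _)]
  have := kthRadius_nonneg x S k (x i)
  have := unitBallVol_pos d
  have := kthRadius_apply_le hD hCD hx S k i
  exact mul_le_mul (hM _) (Real.sqrt_le_sqrt (by gcongr)) (Real.sqrt_nonneg _)
    ((abs_nonneg _).trans (hM 0))

theorem measurable_knnEst {n : ℕ} {H : EuclideanSpace ℝ (Fin d) → ℝ} (hH : Measurable H) (k : ℕ) :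
    Measurable fun x : Fin n → EuclideanSpace ℝ (Fin d) => knnEst H k x :=
  (Finset.measurable_sum _ fun i _ => measurable_knnTerm hH _ k i).const_mul _

namespace IsRegularDensity

variable [IsProbabilityMeasure (densityMeasure f)]

theorem integrable_knnTerm (hf : IsRegularDensity f C) {n : ℕ}
    {H : EuclideanSpace ℝ (Fin d) → ℝ} (hH : Measurable H) {M : ℝ} (hM : ∀ x, |H x| ≤ M)
    (S : Finset (Fin n)) (k : ℕ) (i : Fin n) :
    Integrable (fun x : Fin n → EuclideanSpace ℝ (Fin d) =>
      H (x i) * √(unitBallVol d * kthRadius x S k (x i) ^ d))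
      (Measure.pi fun _ => densityMeasure f) := by
  obtain ⟨D, hD, hCD⟩ := hf.exists_diam
  refine Integrable.of_bound (measurable_knnTerm hH S k i).aestronglyMeasurable
    (M * √(unitBallVol d * D ^ d)) ?_
  filter_upwards [ae_pi_forall_mem hf.ae_mem n] with x hx
  exact abs_knnTerm_le hM hD.le hCD hx S k i

theorem memLp_knnEst (hf : IsRegularDensity f C) (n k : ℕ)
    {H : EuclideanSpace ℝ (Fin d) → ℝ} (hH : Measurable H) {M : ℝ} (hM : ∀ x, |H x| ≤ M) :
    MemLp (fun x : Fin n → EuclideanSpace ℝ (Fin d) => knnEst H k x) 2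
      (Measure.pi fun _ => densityMeasure f) := by
  obtain ⟨D, hD, hCD⟩ := hf.exists_diam
  refine MemLp.of_bound (measurable_knnEst hH k).aestronglyMeasurable
    (gammaRatio k * (1 / √(n : ℝ)) * ∑ _i : Fin n, M * √(unitBallVol d * D ^ d)) ?_
  filter_upwards [ae_pi_forall_mem hf.ae_mem n] with x hx
  have := gammaRatio_nonneg k
  rw [knnEst, norm_mul, Real.norm_of_nonneg (by positivity)]
  gcongr
  exact (norm_sum_le _ _).trans (Finset.sum_le_sum fun i _ => abs_knnTerm_le hM hD.le hCD hx _ k i)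

/-- Nonasymptotic bound for the bias of the estimator, uniform in `k`. -/
theorem exists_abs_bias_le (hf : IsRegularDensity f C) (hd : 1 ≤ d)
    {H : EuclideanSpace ℝ (Fin d) → ℝ} (hH : Measurable H) {M : ℝ} (hM : ∀ x, |H x| ≤ M) :
    ∃ K : ℝ, 0 ≤ K ∧ ∀ n k : ℕ, 1 ≤ k → k < n →
      |∫ x : Fin n → EuclideanSpace ℝ (Fin d), knnEst H k x ∂(Measure.pi fun _ => densityMeasure f) -
        ∫ x, H x * √(f x)| ≤ K * ((k : ℝ) / n) ^ (1 / (d : ℝ)) := by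
  obtain ⟨K, hK, h⟩ := hf.exists_abs_integral_sub_le hd hH hM
  set α := ∫ x, H x * √(f x)
  -- `2 * K` pays for the comparison of volume with content, since `√k * gammaRatio k ≤ 2`. `|α|`
  -- pays for the normalising factor `√n Γ(n)/Γ(n+1/2)`, which is not exactly `1`.
  refine ⟨2 * K + |α|, by positivity, fun n k hk1 hkn => ?_⟩
  obtain ⟨N, rfl⟩ : ∃ N, n = N + 1 := ⟨n - 1, by omega⟩
  have hk : k ≤ N := by omega
  have hk0 : (0 : ℝ) < k := by exact_mod_cast hk1
  have h := h N k hk1 hk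
  set J := ∫ q : EuclideanSpace ℝ (Fin d) × (Fin N → EuclideanSpace ℝ (Fin d)),
          H q.1 * √(unitBallVol d * kthRadius q.2 Finset.univ k q.1 ^ d)
          ∂((densityMeasure f).prod (Measure.pi fun _ => densityMeasure f))
  set n : ℝ := ((N + 1 : ℕ) : ℝ)
  have hn : 0 < n := by positivity
  have hnN : (N : ℝ) + 1 = n := by simp [n]
  rw [hnN] at h
  have hE : ∫ x : Fin (N + 1) → EuclideanSpace ℝ (Fin d), knnEst H k x
      ∂(Measure.pi fun _ => densityMeasure f) = gammaRatio k * √n * J := by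
    simp only [knnEst]
    rw [integral_const_mul, integral_finsetSum _ fun i _ => hf.integrable_knnTerm hH hM _ k i,
      Finset.sum_congr rfl fun i _ => integral_pi_kthRadius (densityMeasure f) i k
        fun a r => H a * √(unitBallVol d * r ^ d)]
    rw [Finset.sum_const, Finset.card_univ, Fintype.card_fin, nsmul_eq_mul]
    change gammaRatio k * (1 / √n) * (n * J) = _
    have : n * (1 / √n) = √n := by rw [mul_one_div, Real.div_sqrt]
    calc _ = gammaRatio k * (n * (1 / √n)) * J := by ring
      _ = _ := by rw [this]
  set G := Real.Gamma (k + 1 / 2) / Real.Gamma k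
  have hG : gammaRatio k * G = 1 := by
    have h1 := Real.Gamma_pos_of_pos hk0
    have h2 := Real.Gamma_pos_of_pos (show (0 : ℝ) < k + 1 / 2 by positivity)
    simp only [gammaRatio, G]
    field_simp
  set q := Real.Gamma n / Real.Gamma (n + 1 / 2)
  have hq1 : 1 ≤ √n * q := one_le_sqrt_mul_gamma_ratio hn
  have hq2 : √n * q ≤ 1 + 1 / (2 * n) := sqrt_mul_gamma_ratio_le hn
  have hγ := gammaRatio_pos hk1
  have hτ : 0 < (k : ℝ) / n := by positivity
  have hk1' : (1 : ℝ) ≤ k := by exact_mod_cast hk1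
  have hτ1 : (k : ℝ) / n ≤ 1 := (div_le_one hn).2 (by simp only [n]; exact_mod_cast hkn.le)
  have hd1 : 1 / (d : ℝ) ≤ 1 := (div_le_one (by positivity)).2 (by exact_mod_cast hd)
  -- The normalisation error is absorbed in the bias rate because `1 ≤ k ≤ n` and `1/d ≤ 1`.
  have hinv : 1 / (2 * n) ≤ ((k : ℝ) / n) ^ (1 / (d : ℝ)) := by
    calc 1 / (2 * n) ≤ 1 / n := by
          apply one_div_le_one_div_of_le hn
          linarith
      _ ≤ (k : ℝ) / n := by gcongr
      _ = ((k : ℝ) / n) ^ (1 : ℝ) := (Real.rpow_one _).symm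
      _ ≤ _ := Real.rpow_le_rpow_of_exponent_ge hτ hτ1 hd1
  have h1 : gammaRatio k * √n * (K * ((k : ℝ) / n) ^ (1 / 2 + 1 / (d : ℝ))) ≤
      2 * K * ((k : ℝ) / n) ^ (1 / (d : ℝ)) := by
    have h2 : √n * ((k : ℝ) / n) ^ (1 / 2 + 1 / (d : ℝ)) =
        √k * ((k : ℝ) / n) ^ (1 / (d : ℝ)) := by
      rw [Real.rpow_add hτ, ← Real.sqrt_eq_rpow, Real.sqrt_div hk0.le]
      have := Real.sqrt_pos.2 hn
      field_simp
    have h3 : √k * gammaRatio k ≤ 2 := by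
      refine (sqrt_mul_gammaRatio_le hk1).trans ?_
      have : 1 / (2 * (k : ℝ)) ≤ 1 := (div_le_one (by positivity)).2 (by linarith)
      linarith
    calc _ = gammaRatio k * K * (√n * ((k : ℝ) / n) ^ (1 / 2 + 1 / (d : ℝ))) := by ring
      _ = (√k * gammaRatio k) * (K * ((k : ℝ) / n) ^ (1 / (d : ℝ))) := by rw [h2]; ring
      _ ≤ 2 * (K * ((k : ℝ) / n) ^ (1 / (d : ℝ))) := by gcongr
      _ = _ := by ring
  rw [hE]
  have hsplit : gammaRatio k * √n * J - α =
      gammaRatio k * √n * (J - α * (G * q)) + α * (√n * q - 1) := by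
    calc _ = gammaRatio k * √n * (J - α * (G * q)) + α * ((gammaRatio k * G) * (√n * q) - 1) := by
          ring
      _ = _ := by rw [hG, one_mul]
  rw [hsplit]
  refine (abs_add_le _ _).trans ?_
  rw [abs_mul, abs_mul α, abs_of_nonneg (show 0 ≤ gammaRatio k * √n by positivity),
    abs_of_nonneg (sub_nonneg.2 hq1), add_mul]
  refine add_le_add ((mul_le_mul_of_nonneg_left h (by positivity)).trans h1)
    (mul_le_mul_of_nonneg_left ?_ (abs_nonneg α))
  linarith

end IsRegularDensity

end Bias

/-! ### The Efron-Stein inequality. -/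

section EfronStein

variable {E : Type*} [MeasurableSpace E]

/-- The mean minimises the mean square distance to a constant. -/
theorem integral_sq_sub_sq_integral_le {α : Type*} [MeasurableSpace α] (μ : Measure α)
    [IsProbabilityMeasure μ] {F : α → ℝ} (hF : MemLp F 2 μ) (c : ℝ) :
    ∫ x, F x ^ 2 ∂μ - (∫ x, F x ∂μ) ^ 2 ≤ ∫ x, (F x - c) ^ 2 ∂μ := by
  have h1 := hF.integrable one_le_two
  have h2 := hF.integrable_sq
  have h3 : ∫ x, (F x - c) ^ 2 ∂μ = ∫ x, F x ^ 2 ∂μ - 2 * c * ∫ x, F x ∂μ + c ^ 2 := by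
    have : ∀ x, (F x - c) ^ 2 = F x ^ 2 - 2 * c * F x + c ^ 2 := fun x => by ring
    simp only [this]
    have hs : Integrable (fun x => F x ^ 2 - 2 * c * F x) μ := h2.sub (h1.const_mul _)
    rw [integral_add hs (integrable_const _),
      integral_sub h2 (h1.const_mul _), integral_const_mul]
    simp
  rw [h3]
  nlinarith [sq_nonneg (∫ x, F x ∂μ - c)]

theorem memLp_two_of_measurable_of_abs_le {α : Type*} [MeasurableSpace α] (μ : Measure α)
    [IsFiniteMeasure μ] {F : α → ℝ} (hF : Measurable F) {M : ℝ} (hM : ∀ x, |F x| ≤ M) :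
    MemLp F 2 μ := MemLp.of_bound hF.aestronglyMeasurable M (ae_of_all _ hM)

/-- The **Efron-Stein inequality** for bounded functions of independent variables: `G i` does not
depend on the `i`-th coordinate. -/
theorem efron_stein (μ : Measure E) [IsProbabilityMeasure μ] {n : ℕ} :
    ∀ {F : (Fin n → E) → ℝ} {G : Fin n → (Fin n → E) → ℝ}, Measurable F →
      (∀ i, Measurable (G i)) → ∀ {M : ℝ}, (∀ x, |F x| ≤ M) → (∀ i x, |G i x| ≤ M) →
      (∀ i x a, G i (Function.update x i a) = G i x) →
      ∫ x, F x ^ 2 ∂(Measure.pi fun _ => μ) - (∫ x, F x ∂(Measure.pi fun _ => μ)) ^ 2 ≤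
        ∑ i, ∫ x, (F x - G i x) ^ 2 ∂(Measure.pi fun _ => μ) := by
  induction n with
  | zero =>
    intro F G hF _ M hM _ _
    obtain ⟨c, hc⟩ : ∃ c, ∀ x, F x = c :=
      ⟨F finZeroElim, fun x => congrArg F (Subsingleton.elim _ _)⟩
    simp [hc]
  | succ n ih =>
    intro F G hF hG M hFM hGM hGi
    obtain ⟨a₀⟩ : Nonempty E := nonempty_of_isProbabilityMeasure μ
    set π : Measure (Fin n → E) := Measure.pi fun _ => μ
    set e := MeasurableEquiv.piFinSuccAbove (fun _ : Fin (n + 1) => E) 0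
    have he : MeasurePreserving e (Measure.pi fun _ => μ) (μ.prod π) :=
      measurePreserving_piFinSuccAbove (fun _ => μ) 0
    have htr : ∀ Φ : (Fin (n + 1) → E) → ℝ, ∫ x, Φ x ∂(Measure.pi fun _ => μ) =
        ∫ q, Φ (e.symm q) ∂(μ.prod π) := fun Φ => by
      rw [← he.integral_comp e.measurableEmbedding]
      simp
    have hes : ∀ a y, e.symm (a, y) = Fin.cons a y := fun a y => by
      simp only [e, MeasurableEquiv.piFinSuccAbove, Fin.insertNthEquiv_zero]
      rfl
    set F' : E × (Fin n → E) → ℝ := fun q => F (e.symm q)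
    have hF' : Measurable F' := hF.comp e.symm.measurable
    set G' : Fin (n + 1) → E × (Fin n → E) → ℝ := fun i q => G i (e.symm q)
    have hG' : ∀ i, Measurable (G' i) := fun i => (hG i).comp e.symm.measurable
    have hF'M : ∀ q, |F' q| ≤ M := fun q => hFM _
    have hG'M : ∀ i q, |G' i q| ≤ M := fun i q => hGM i _
    have hsec : ∀ {Φ : E × (Fin n → E) → ℝ}, Measurable Φ → ∀ a, Measurable fun y => Φ (a, y) :=
      fun h a => h.comp (measurable_const.prodMk measurable_id)
    simp only [htr]
    change ∫ q, F' q ^ 2 ∂(μ.prod π) - (∫ q, F' q ∂(μ.prod π)) ^ 2 ≤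
      ∑ i, ∫ q, (F' q - G' i q) ^ 2 ∂(μ.prod π)
    have hFi := (memLp_two_of_measurable_of_abs_le (μ.prod π) hF' hF'M)
    have hGi' : ∀ i, MemLp (fun q => F' q - G' i q) 2 (μ.prod π) := fun i =>
      hFi.sub (memLp_two_of_measurable_of_abs_le (μ.prod π) (hG' i) (hG'M i))
    -- `m` is the conditional mean given the first coordinate. The variance of `F` is the variance
    -- of `m` plus the mean conditional variance; the first is bounded using `G 0`, the second by
    -- the induction hypothesis on slices.
    set m : E → ℝ := fun a => ∫ y, F' (a, y) ∂π
    have hm : Measurable m := hF'.stronglyMeasurable.integral_prod_right'.measurable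
    have hmM : ∀ a, |m a| ≤ M := fun a => by
      have := norm_integral_le_of_norm_le_const (μ := π) (f := fun y => F' (a, y)) (C := M)
        (ae_of_all _ fun y => hF'M (a, y))
      simpa using this
    have hmL := memLp_two_of_measurable_of_abs_le μ hm hmM
    -- the first coordinate
    have hfirst : ∫ a, m a ^ 2 ∂μ - (∫ a, m a ∂μ) ^ 2 ≤ ∫ q, (F' q - G' 0 q) ^ 2 ∂(μ.prod π) := by
      -- Since `G 0` ignores the first coordinate, its average over the others is a constant, which
      -- can replace the mean of `m`.
      have hc : ∀ a y, G' 0 (a, y) = G' 0 (a₀, y) := fun a y => by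
        simp only [G', hes]
        rw [← hGi 0 (Fin.cons a y) a₀, Fin.update_cons_zero]
      refine (integral_sq_sub_sq_integral_le μ hmL (∫ y, G' 0 (a₀, y) ∂π)).trans ?_
      rw [integral_prod _ (hGi' 0).integrable_sq]
      refine integral_mono (hmL.sub (memLp_const _)).integrable_sq
        (hGi' 0).integrable_sq.integral_prod_left fun a => ?_
      have h1 := (memLp_two_of_measurable_of_abs_le π (hsec hF' a) fun y => hF'M _)
      have h2 := (memLp_two_of_measurable_of_abs_le π (hsec (hG' 0) a) fun y => hG'M 0 _)
      have h3 : MemLp (fun y => F' (a, y) - G' 0 (a, y)) 2 π := h1.sub h2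
      have h4 : m a - ∫ y, G' 0 (a₀, y) ∂π = ∫ y, (F' (a, y) - G' 0 (a, y)) ∂π := by
        rw [integral_sub (h1.integrable one_le_two) (h2.integrable one_le_two)]
        simp only [hc a]
        rfl
      -- Jensen's inequality: the squared mean of `F' - G' 0` over `y` is at most the mean of its
      -- square.
      have h5 := variance_nonneg (fun y => F' (a, y) - G' 0 (a, y)) π
      rw [variance_eq_sub h3] at h5
      dsimp only
      rw [h4]
      have h6 : π[(fun y => F' (a, y) - G' 0 (a, y)) ^ 2] =
        ∫ y, (F' (a, y) - G' 0 (a, y)) ^ 2 ∂π := rfl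
      linarith
    -- the other coordinates
    have hrest : ∫ q, F' q ^ 2 ∂(μ.prod π) - ∫ a, m a ^ 2 ∂μ ≤
        ∑ i : Fin n, ∫ q, (F' q - G' i.succ q) ^ 2 ∂(μ.prod π) := by
      have h1 : ∀ a, ∫ y, F' (a, y) ^ 2 ∂π - m a ^ 2 ≤
          ∑ i : Fin n, ∫ y, (F' (a, y) - G' i.succ (a, y)) ^ 2 ∂π := fun a => by
        refine ih (F := fun y => F' (a, y)) (G := fun i y => G' i.succ (a, y)) (hsec hF' a)
          (fun i => hsec (hG' i.succ) a) (fun y => hF'M _) (fun i y => hG'M _ _) fun i y b => ?_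
        simp only [G', hes]
        rw [← hGi i.succ (Fin.cons a y) b, Fin.cons_update]
      rw [integral_prod _ hFi.integrable_sq, ← integral_sub hFi.integrable_sq.integral_prod_left
        hmL.integrable_sq]
      calc _ ≤ ∫ a, ∑ i : Fin n, ∫ y, (F' (a, y) - G' i.succ (a, y)) ^ 2 ∂π ∂μ :=
            integral_mono (hFi.integrable_sq.integral_prod_left.sub hmL.integrable_sq)
              (integrable_finsetSum _ fun i _ => (hGi' i.succ).integrable_sq.integral_prod_left) h1
        _ = ∑ i : Fin n, ∫ a, ∫ y, (F' (a, y) - G' i.succ (a, y)) ^ 2 ∂π ∂μ :=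
            integral_finsetSum _ fun i _ => (hGi' i.succ).integrable_sq.integral_prod_left
        _ = _ := Finset.sum_congr rfl fun i _ => (integral_prod _ (hGi' i.succ).integrable_sq).symm
    have hmean : ∫ q, F' q ∂(μ.prod π) = ∫ a, m a ∂μ :=
      integral_prod _ (hFi.integrable one_le_two)
    rw [hmean, Fin.sum_univ_succ]
    linarith

end EfronStein

/-! ### Effect of deleting one sample point on the radii. -/

section Removal

variable {E : Type*} [NormedAddCommGroup E]

/-- Two vectors that are both within half their norm of the same direction `c`: the difference is at
most as long as the longer one. -/
theorem norm_sub_le_of_direction [NormedSpace ℝ E] {c u v : E} (hu : ‖u - ‖u‖ • c‖ ≤ ‖u‖ / 2)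
    (hv : ‖v - ‖v‖ • c‖ ≤ ‖v‖ / 2) (h : ‖u‖ ≤ ‖v‖) : ‖u - v‖ ≤ ‖v‖ := by
  rcases (norm_nonneg v).eq_or_lt with h0 | h0
  · have hv0 : v = 0 := norm_eq_zero.1 h0.symm
    simpa [hv0] using h
  set t := ‖u‖ / ‖v‖
  have ht : 0 ≤ t := by positivity
  have ht1 : t ≤ 1 := (div_le_one h0).2 h
  have htv : t * ‖v‖ = ‖u‖ := div_mul_cancel₀ _ h0.ne'
  have h1 : ‖‖u‖ • c - t • v‖ ≤ ‖u‖ / 2 := by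
    -- `v` is rescaled to `t • v`, of length `‖u‖`, which is within `‖u‖ / 2` of `‖u‖ • c`. The path
    -- from `u` to `v` through `‖u‖ • c` and `t • v` has length at most `‖u‖ / 2 + ‖u‖ / 2 + (‖v‖ -
    -- ‖u‖)`.
    rw [← htv, mul_smul, ← smul_sub, norm_smul, Real.norm_of_nonneg ht, norm_sub_rev, mul_div_assoc]
    gcongr
  have h2 : ‖t • v - v‖ = ‖v‖ - ‖u‖ := by
    rw [show t • v - v = -((1 - t) • v) by rw [sub_smul, one_smul, neg_sub], norm_neg, norm_smul,
      Real.norm_of_nonneg (by linarith), sub_mul, one_mul, htv]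
  calc ‖u - v‖ = ‖(u - ‖u‖ • c) + (‖u‖ • c - t • v) + (t • v - v)‖ := by congr 1; abel
    _ ≤ ‖u - ‖u‖ • c‖ + ‖‖u‖ • c - t • v‖ + ‖t • v - v‖ := norm_add₃_le
    _ ≤ ‖v‖ := by linarith

/-- Compactness of the unit sphere gives finitely many centres of covering balls of radius `1/2`.
The vector `0` is added so that the set is nonempty, as `v = 0` requires. -/
theorem exists_finset_direction (E : Type*) [NormedAddCommGroup E] [NormedSpace ℝ E]
    [FiniteDimensional ℝ E] :
    ∃ s : Finset E, ∀ v : E, ∃ c ∈ s, ‖v - ‖v‖ • c‖ ≤ ‖v‖ / 2 := by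
  classical
  have : ProperSpace E := FiniteDimensional.proper ℝ E
  obtain ⟨t, -, htf, ht⟩ := (isCompact_sphere (0 : E) 1).finite_cover_balls
    (show (0 : ℝ) < 1 / 2 by norm_num)
  refine ⟨insert 0 htf.toFinset, fun v => ?_⟩
  rcases eq_or_ne v 0 with rfl | hv
  · exact ⟨0, Finset.mem_insert_self _ _, by simp⟩
  have hv0 : 0 < ‖v‖ := norm_pos_iff.2 hv
  have hmem : ‖v‖⁻¹ • v ∈ Metric.sphere (0 : E) 1 := by
    rw [mem_sphere_zero_iff_norm, norm_smul, norm_inv, norm_norm, inv_mul_cancel₀ hv0.ne']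
  obtain ⟨c, hc, hcv⟩ := Set.mem_iUnion₂.1 (ht hmem)
  refine ⟨c, Finset.mem_insert_of_mem (htf.mem_toFinset.2 hc), ?_⟩
  rw [Metric.mem_ball, dist_eq_norm] at hcv
  calc ‖v - ‖v‖ • c‖ = ‖‖v‖ • (‖v‖⁻¹ • v - c)‖ := by
        rw [smul_sub, smul_smul, mul_inv_cancel₀ hv0.ne', one_smul]
    _ = ‖v‖ * ‖‖v‖⁻¹ • v - c‖ := by rw [norm_smul, norm_norm]
    _ ≤ ‖v‖ * (1 / 2) := by gcongr
    _ = _ := by ring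

theorem kthRadius_mono {ι : Type*} (y : ι → E) {S : Finset ι} {k k' : ℕ} (c : E) (h : k ≤ k')
    (hk : k' ≤ S.card) : kthRadius y S k c ≤ kthRadius y S k' c :=
  kthRadius_le y S c (kthRadius_nonneg _ _ _ _) (h.trans (le_ballCount_kthRadius y c hk))

variable {n : ℕ}

/-- Removing the sample point `x i` changes the `k`-th nearest neighbour radius of `x l`. -/
def IsAffected (x : Fin n → E) (k : ℕ) (i l : Fin n) : Prop :=
  i ≠ l ∧ ballCount x ((Finset.univ.erase l).erase i) (x l)
    (kthRadius x (Finset.univ.erase l) k (x l)) < k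

theorem ballCount_erase_of_lt (x : Fin n → E) (S : Finset (Fin n)) (i : Fin n) (c : E) {r : ℝ}
    (h : r < ‖x i - c‖) : ballCount x (S.erase i) c r = ballCount x S c r := by
  rw [ballCount, Finset.filter_erase, Finset.erase_eq_of_notMem, ballCount]
  simp [h]

theorem ballCount_le_erase_add_one (x : Fin n → E) (S : Finset (Fin n)) (i : Fin n) (c : E)
    (r : ℝ) : ballCount x S c r ≤ ballCount x (S.erase i) c r + 1 := by
  rw [ballCount, ballCount, Finset.filter_erase]
  have := Finset.pred_card_le_card_erase (s := S.filter fun m => ‖x m - c‖ ≤ r) (a := i)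
  omega

theorem card_erase_univ (l : Fin n) : (Finset.univ.erase l : Finset (Fin n)).card = n - 1 := by
  simp

theorem IsAffected.norm_sub_le {x : Fin n → E} {k : ℕ} (hk : k < n) {i l : Fin n}
    (h : IsAffected x k i l) :
    ‖x i - x l‖ ≤ kthRadius x (Finset.univ.erase l) k (x l) := by
  by_contra hlt
  have h2 := h.2
  rw [ballCount_erase_of_lt _ _ _ _ (not_le.1 hlt)] at h2
  exact absurd (le_ballCount_kthRadius x (x l) (by rw [card_erase_univ]; omega)) (not_le.2 h2)

theorem kthRadius_erase_eq_of_not_isAffected {x : Fin n → E} {k : ℕ} {i l : Fin n}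
    (hil : i ≠ l) (hk : k + 1 < n) (h : ¬ IsAffected x k i l) :
    kthRadius x ((Finset.univ.erase l).erase i) k (x l) =
      kthRadius x (Finset.univ.erase l) k (x l) := by
  have hcard : k ≤ ((Finset.univ.erase l).erase i : Finset (Fin n)).card := by
    rw [Finset.card_erase_of_mem (by simpa using hil), card_erase_univ]
    omega
  refine le_antisymm (kthRadius_le _ _ _ (kthRadius_nonneg _ _ _ _) ?_)
    (kthRadius_le _ _ _ (kthRadius_nonneg _ _ _ _) ?_)
  · by_contra hlt
    exact h ⟨hil, not_le.1 hlt⟩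
  · exact (le_ballCount_kthRadius x (x l) hcard).trans
      (ballCount_subset x (Finset.erase_subset _ _) _ _)

/-- At least `k` of the points in the `(k+1)`-st ball survive the deletion. This is why volumes of
order `k + 1` enter the variance bound. -/
theorem kthRadius_erase_le_succ (x : Fin n → E) {k : ℕ} (i l : Fin n) (hk : k + 1 < n) :
    kthRadius x ((Finset.univ.erase l).erase i) k (x l) ≤
      kthRadius x (Finset.univ.erase l) (k + 1) (x l) := by
  refine kthRadius_le _ _ _ (kthRadius_nonneg _ _ _ _) ?_
  have h1 := le_ballCount_kthRadius x (S := Finset.univ.erase l) (k := k + 1) (x l)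
    (by rw [card_erase_univ]; omega)
  have h2 := ballCount_le_erase_add_one x (Finset.univ.erase l) i (x l)
    (kthRadius x (Finset.univ.erase l) (k + 1) (x l))
  omega

open Classical in
/-- Each nearest neighbour radius is affected by the removal of at most `k` points. -/
theorem card_isAffected_left_le (x : Fin n → E) {k : ℕ} (hk : k < n) (l : Fin n) :
    (Finset.univ.filter fun i => IsAffected x k i l).card ≤ k := by
  rcases (Finset.univ.filter fun i => IsAffected x k i l).eq_empty_or_nonempty with h | ⟨i, hi⟩
  · simp [h]
  have hi := (Finset.mem_filter.1 hi).2
  -- A single affecting point shows that the closed ball holds at most `k` points, so ties at the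
  -- boundary do no harm. All affecting points lie in that ball.
  have h1 := ballCount_le_erase_add_one x (Finset.univ.erase l) i (x l)
    (kthRadius x (Finset.univ.erase l) k (x l))
  have h2 := hi.2
  refine (Finset.card_le_card fun j hj => ?_).trans
    (show ballCount x (Finset.univ.erase l) (x l) (kthRadius x (Finset.univ.erase l) k (x l)) ≤ k
      by omega)
  have hj := (Finset.mem_filter.1 hj).2
  exact Finset.mem_filter.2 ⟨by simpa using hj.1, hj.norm_sub_le hk⟩

open Classical in
/-- The removal of a point affects at most `s.card * k` nearest neighbour radii, where `s` is a
finite set of directions that are dense at scale `1 / 2`. -/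
theorem card_isAffected_right_le [NormedSpace ℝ E] {s : Finset E}
    (hs : ∀ v : E, ∃ c ∈ s, ‖v - ‖v‖ • c‖ ≤ ‖v‖ / 2) (x : Fin n → E) {k : ℕ} (hk : k < n)
    (i : Fin n) :
    (Finset.univ.filter fun l => IsAffected x k i l).card ≤ s.card * k := by
  choose c hcs hc using fun l => hs (x l - x i)
  rw [mul_comm]
  refine Finset.card_le_mul_card_image_of_maps_to (f := c) (fun l _ => hcs l) k fun b _ => ?_
  by_contra hlt
  set L := (Finset.univ.filter fun l => IsAffected x k i l).filter fun l => c l = b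
  have hL : L.Nonempty := Finset.card_pos.1 (by omega)
  -- Suppose more than `k` affected indices share a direction, and let `m` be the one farthest from
  -- `x i`. The others are no farther from `x m` than `x i` is, so at least `k` points besides `x i`
  -- lie in the ball of `x m`, and deleting `x i` cannot affect it.
  obtain ⟨m, hm, hmax⟩ := L.exists_max_image (fun l => ‖x l - x i‖) hL
  have hmem : ∀ l ∈ L, IsAffected x k i l ∧ c l = b := fun l hl => by
    simpa [L] using hl
  have hma := (hmem m hm).1
  have hcount : k ≤ ballCount x ((Finset.univ.erase m).erase i) (x m)
      (kthRadius x (Finset.univ.erase m) k (x m)) := by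
    have hsub : L.erase m ⊆ ((Finset.univ.erase m).erase i).filter fun l => ‖x l - x m‖ ≤
        kthRadius x (Finset.univ.erase m) k (x m) := by
      intro l hl
      obtain ⟨hlm, hlL⟩ := Finset.mem_erase.1 hl
      refine Finset.mem_filter.2 ⟨?_, ?_⟩
      · simp [hlm, (hmem l hlL).1.1.symm]
      · have h1 := hc l
        have h2 := hc m
        rw [(hmem l hlL).2] at h1
        rw [(hmem m hm).2] at h2
        have h3 := norm_sub_le_of_direction h1 h2 (hmax l hlL)
        rw [sub_sub_sub_cancel_right] at h3
        rw [norm_sub_rev (x m)] at h3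
        exact h3.trans (hma.norm_sub_le hk)
    have := Finset.card_le_card hsub
    rw [Finset.card_erase_of_mem hm] at this
    exact le_trans (by omega) this
  exact absurd hma.2 (not_lt.2 hcount)

end Removal

/-! ### Deterministic bounds for the increments of the weighted sum. -/

section Variance

variable {d : ℕ}

/-- The square root of the volume of a ball whose radius is truncated at `D`. -/
noncomputable def truncSqrtVol (d : ℕ) (D r : ℝ) : ℝ := √(unitBallVol d * min r D ^ d)

theorem truncSqrtVol_nonneg (D r : ℝ) : 0 ≤ truncSqrtVol d D r := Real.sqrt_nonneg _

theorem truncSqrtVol_mono {D r s : ℝ} (hD : 0 ≤ D) (hr : 0 ≤ r) (h : r ≤ s) :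
    truncSqrtVol d D r ≤ truncSqrtVol d D s := by
  have := unitBallVol_pos d
  have : 0 ≤ min r D := le_min hr hD
  exact Real.sqrt_le_sqrt (by gcongr)

theorem truncSqrtVol_le {D r : ℝ} (hD : 0 ≤ D) (hr : 0 ≤ r) :
    truncSqrtVol d D r ≤ √(unitBallVol d * D ^ d) := by
  have := unitBallVol_pos d
  have : 0 ≤ min r D := le_min hr hD
  exact Real.sqrt_le_sqrt (by gcongr; exact min_le_right r D)

theorem truncSqrtVol_sq_le {D r : ℝ} (hD : 0 ≤ D) (hr : 0 ≤ r) :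
    truncSqrtVol d D r ^ 2 ≤ unitBallVol d * r ^ d := by
  have := unitBallVol_pos d
  have : 0 ≤ min r D := le_min hr hD
  rw [truncSqrtVol, Real.sq_sqrt (by positivity)]
  gcongr
  exact min_le_left r D

theorem measurable_truncSqrtVol (d : ℕ) (D : ℝ) : Measurable (truncSqrtVol d D) :=
  (((measurable_id.min measurable_const).pow_const d).const_mul _).sqrt

variable {E : Type*} [NormedAddCommGroup E] {n : ℕ}

/-- The weighted sum of the truncated nearest neighbour volumes. -/
noncomputable def knnSum (d : ℕ) (H : E → ℝ) (D : ℝ) (k : ℕ) (x : Fin n → E) : ℝ :=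
  ∑ l, H (x l) * truncSqrtVol d D (kthRadius x (Finset.univ.erase l) k (x l))

/-- The weighted sum of the truncated nearest neighbour volumes without the point `x i`. -/
noncomputable def knnSumErase (d : ℕ) (H : E → ℝ) (D : ℝ) (k : ℕ) (i : Fin n) (x : Fin n → E) : ℝ :=
  ∑ l ∈ Finset.univ.erase i,
    H (x l) * truncSqrtVol d D (kthRadius x ((Finset.univ.erase l).erase i) k (x l))

theorem kthRadius_congr {ι : Type*} {y y' : ι → E} {S : Finset ι} (h : ∀ m ∈ S, y m = y' m)
    (k : ℕ) (c : E) : kthRadius y S k c = kthRadius y' S k c := by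
  have : ∀ r, ballCount y S c r = ballCount y' S c r := fun r => by
    rw [ballCount, ballCount, Finset.filter_congr fun m hm => by rw [h m hm]]
  simp only [kthRadius, this]

theorem knnSumErase_update (H : E → ℝ) (D : ℝ) (k : ℕ) (i : Fin n) (x : Fin n → E) (a : E) :
    knnSumErase d H D k i (Function.update x i a) = knnSumErase d H D k i x := by
  refine Finset.sum_congr rfl fun l hl => ?_
  rw [Function.update_of_ne (Finset.ne_of_mem_erase hl),
    kthRadius_congr fun m hm => Function.update_of_ne (Finset.ne_of_mem_erase hm) _ _]

theorem abs_knnSum_le {H : E → ℝ} {M D : ℝ} (hM : ∀ x, |H x| ≤ M) (hD : 0 ≤ D) (S : Finset (Fin n))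
    (T : Fin n → Finset (Fin n)) (k : ℕ) (x : Fin n → E) :
    |∑ l ∈ S, H (x l) * truncSqrtVol d D (kthRadius x (T l) k (x l))| ≤
      n * (M * √(unitBallVol d * D ^ d)) := by
  have hM0 : 0 ≤ M := (abs_nonneg _).trans (hM 0)
  calc _ ≤ ∑ l ∈ S, |H (x l) * truncSqrtVol d D (kthRadius x (T l) k (x l))| :=
        Finset.abs_sum_le_sum_abs _ _
    _ ≤ ∑ _l ∈ S, M * √(unitBallVol d * D ^ d) := by
        refine Finset.sum_le_sum fun l _ => ?_
        rw [abs_mul, abs_of_nonneg (truncSqrtVol_nonneg _ _)]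
        exact mul_le_mul (hM _) (truncSqrtVol_le hD (kthRadius_nonneg _ _ _ _))
          (truncSqrtVol_nonneg _ _) hM0
    _ = S.card * (M * √(unitBallVol d * D ^ d)) := by rw [Finset.sum_const, nsmul_eq_mul]
    _ ≤ _ := by
        gcongr
        simpa using Finset.card_le_univ S

/-- Cauchy-Schwarz. This crude bound serves the extreme case `n = k + 1`, where a deletion leaves
too few points. -/
theorem knnSum_sq_le {H : E → ℝ} {M D : ℝ} (hM : ∀ x, |H x| ≤ M) (hD : 0 ≤ D) (k : ℕ)
    (x : Fin n → E) :
    knnSum d H D k x ^ 2 ≤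
      M ^ 2 * n * ∑ l, unitBallVol d * kthRadius x (Finset.univ.erase l) k (x l) ^ d := by
  calc knnSum d H D k x ^ 2 ≤ n * ∑ l, (H (x l) *
        truncSqrtVol d D (kthRadius x (Finset.univ.erase l) k (x l))) ^ 2 := by
        simpa [knnSum] using sq_sum_le_card_mul_sum_sq (s := Finset.univ) (f := fun l => H (x l) *
          truncSqrtVol d D (kthRadius x (Finset.univ.erase l) k (x l)))
    _ ≤ n * ∑ l, M ^ 2 * (unitBallVol d * kthRadius x (Finset.univ.erase l) k (x l) ^ d) := by
        gcongr with l
        rw [mul_pow]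
        refine mul_le_mul (sq_le_sq' (abs_le.1 (hM _)).1 (abs_le.1 (hM _)).2)
          (truncSqrtVol_sq_le hD (kthRadius_nonneg _ _ _ _)) (sq_nonneg _) (sq_nonneg _)
    _ = _ := by
        rw [← Finset.mul_sum]
        ring

-- Only the term of the deleted point and the affected terms change. In each of these the old and
-- the new radius are both at most the `(k+1)`-st one, so the change is at most a single larger
-- term.
open Classical in
theorem abs_knnSum_sub_knnSumErase_le {H : E → ℝ} {M D : ℝ} (hM : ∀ x, |H x| ≤ M) (hD : 0 ≤ D)
    {k : ℕ} (hk : k + 1 < n) (x : Fin n → E) (i : Fin n) :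
    |knnSum d H D k x - knnSumErase d H D k i x| ≤
      ∑ l ∈ Finset.univ.filter (fun l => l = i ∨ IsAffected x k i l),
        M * truncSqrtVol d D (kthRadius x (Finset.univ.erase l) (k + 1) (x l)) := by
  have hM0 : 0 ≤ M := (abs_nonneg _).trans (hM 0)
  set R := fun l => kthRadius x (Finset.univ.erase l) k (x l)
  set R' := fun l => kthRadius x (Finset.univ.erase l) (k + 1) (x l)
  set Re := fun l => kthRadius x ((Finset.univ.erase l).erase i) k (x l)
  have hRR' : ∀ l, truncSqrtVol d D (R l) ≤ truncSqrtVol d D (R' l) := fun l =>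
    truncSqrtVol_mono hD (kthRadius_nonneg _ _ _ _)
      (kthRadius_mono x (x l) (Nat.le_succ k) (by rw [card_erase_univ]; omega))
  have hReR' : ∀ l, truncSqrtVol d D (Re l) ≤ truncSqrtVol d D (R' l) := fun l =>
    truncSqrtVol_mono hD (kthRadius_nonneg _ _ _ _) (kthRadius_erase_le_succ x i l hk)
  have hsplit : knnSum d H D k x - knnSumErase d H D k i x =
      ∑ l, H (x l) * (truncSqrtVol d D (R l) - if l = i then 0 else truncSqrtVol d D (Re l)) := by
    have : knnSumErase d H D k i x =
        ∑ l, H (x l) * (if l = i then 0 else truncSqrtVol d D (Re l)) := by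
      rw [← Finset.add_sum_erase _ _ (Finset.mem_univ i), if_pos rfl, mul_zero, zero_add]
      exact Finset.sum_congr rfl fun l hl => by rw [if_neg (Finset.ne_of_mem_erase hl)]
    rw [this, knnSum, ← Finset.sum_sub_distrib]
    exact Finset.sum_congr rfl fun l _ => by ring
  rw [hsplit, Finset.sum_filter]
  refine (Finset.abs_sum_le_sum_abs _ _).trans (Finset.sum_le_sum fun l _ => ?_)
  have hR0 := truncSqrtVol_nonneg (d := d) D (R l)
  have hRe0 := truncSqrtVol_nonneg (d := d) D (Re l)
  have h1 := hRR' l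
  have h2 := hReR' l
  rw [abs_mul]
  by_cases hl : l = i
  · rw [if_pos hl, if_pos (Or.inl hl), sub_zero, abs_of_nonneg hR0]
    exact mul_le_mul (hM _) h1 hR0 hM0
  rw [if_neg hl]
  by_cases ha : IsAffected x k i l
  · rw [if_pos (Or.inr ha)]
    refine mul_le_mul (hM _) ?_ (abs_nonneg _) hM0
    rw [abs_le]
    constructor <;> linarith
  · rw [if_neg (by tauto)]
    have : Re l = R l := kthRadius_erase_eq_of_not_isAffected (Ne.symm hl) hk ha
    rw [this, sub_self, abs_zero, mul_zero]

/-- Cauchy-Schwarz over the at most `s.card * k + 1` changed terms gives one factor. Exchanging the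
sums over `i` and `l` gives the other, as each `l` is counted for at most `k + 1` indices `i`. -/
theorem sum_sq_knnSum_sub_knnSumErase_le [NormedSpace ℝ E] {s : Finset E}
    (hs : ∀ v : E, ∃ c ∈ s, ‖v - ‖v‖ • c‖ ≤ ‖v‖ / 2) {H : E → ℝ} {M D : ℝ} (hM : ∀ x, |H x| ≤ M)
    (hD : 0 ≤ D) {k : ℕ} (hk : k + 1 < n) (x : Fin n → E) :
    ∑ i, (knnSum d H D k x - knnSumErase d H D k i x) ^ 2 ≤
      M ^ 2 * (s.card * k + 1) * (k + 1) *
        ∑ l, unitBallVol d * kthRadius x (Finset.univ.erase l) (k + 1) (x l) ^ d := by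
  classical
  set V := fun l => unitBallVol d * kthRadius x (Finset.univ.erase l) (k + 1) (x l) ^ d
  have hV : ∀ l, 0 ≤ V l := fun l =>
    mul_nonneg (unitBallVol_pos d).le (pow_nonneg (kthRadius_nonneg _ _ _ _) d)
  have hi : ∀ i, (knnSum d H D k x - knnSumErase d H D k i x) ^ 2 ≤
      M ^ 2 * (s.card * k + 1) *
        ∑ l, if l = i ∨ IsAffected x k i l then V l else 0 := by
    intro i
    have hcard : ((Finset.univ.filter fun l => l = i ∨ IsAffected x k i l).card : ℝ) ≤
        s.card * k + 1 := by
      rw [Finset.filter_or, Finset.filter_eq' _ i, if_pos (Finset.mem_univ i)]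
      have h1 := Finset.card_union_le {i} (Finset.univ.filter fun l => IsAffected x k i l)
      have h2 := card_isAffected_right_le hs x (show k < n by omega) i
      rw [Finset.card_singleton] at h1
      exact_mod_cast h1.trans (by omega)
    calc _ = |knnSum d H D k x - knnSumErase d H D k i x| ^ 2 := (sq_abs _).symm
      _ ≤ (∑ l ∈ Finset.univ.filter (fun l => l = i ∨ IsAffected x k i l),
          M * truncSqrtVol d D (kthRadius x (Finset.univ.erase l) (k + 1) (x l))) ^ 2 :=
          pow_le_pow_left₀ (abs_nonneg _) (abs_knnSum_sub_knnSumErase_le hM hD hk x i) 2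
      _ ≤ (Finset.univ.filter fun l => l = i ∨ IsAffected x k i l).card *
          ∑ l ∈ Finset.univ.filter (fun l => l = i ∨ IsAffected x k i l),
            (M * truncSqrtVol d D (kthRadius x (Finset.univ.erase l) (k + 1) (x l))) ^ 2 :=
          sq_sum_le_card_mul_sum_sq
      _ ≤ (s.card * k + 1) * ∑ l ∈ Finset.univ.filter (fun l => l = i ∨ IsAffected x k i l),
            M ^ 2 * V l := by
          refine mul_le_mul hcard (Finset.sum_le_sum fun l _ => ?_)
            (Finset.sum_nonneg fun _ _ => sq_nonneg _) (by positivity)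
          rw [mul_pow]
          exact mul_le_mul_of_nonneg_left (truncSqrtVol_sq_le hD (kthRadius_nonneg _ _ _ _))
            (sq_nonneg M)
      _ = _ := by
          rw [← Finset.mul_sum, Finset.sum_filter]
          ring
  have hl : ∀ l, ∑ i, (if l = i ∨ IsAffected x k i l then V l else 0) ≤ (k + 1) * V l := by
    intro l
    rw [← Finset.sum_filter, Finset.sum_const, nsmul_eq_mul]
    refine mul_le_mul_of_nonneg_right ?_ (hV l)
    rw [Finset.filter_or, Finset.filter_eq _ l, if_pos (Finset.mem_univ l)]
    have h1 := Finset.card_union_le {l} (Finset.univ.filter fun i => IsAffected x k i l)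
    have h2 := card_isAffected_left_le x (show k < n by omega) l
    rw [Finset.card_singleton] at h1
    exact_mod_cast h1.trans (by omega)
  calc _ ≤ ∑ i, M ^ 2 * (s.card * k + 1) *
        ∑ l, (if l = i ∨ IsAffected x k i l then V l else 0) := Finset.sum_le_sum fun i _ => hi i
    _ = M ^ 2 * (s.card * k + 1) *
        ∑ l, ∑ i, (if l = i ∨ IsAffected x k i l then V l else 0) := by
        rw [← Finset.mul_sum, Finset.sum_comm]
    _ ≤ M ^ 2 * (s.card * k + 1) * ∑ l, (k + 1) * V l := by
        gcongr with l
        exact hl l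
    _ = _ := by
        rw [← Finset.mul_sum]
        ring

variable {f : EuclideanSpace ℝ (Fin d) → ℝ} {C : Set (EuclideanSpace ℝ (Fin d))}

namespace IsRegularDensity

variable [IsProbabilityMeasure (densityMeasure f)]

/-- The expected volume of the `k`-th nearest neighbour ball is `O(k / n)`. -/
theorem exists_integral_volume_le (hf : IsRegularDensity f C) {D : ℝ} (hd : 1 ≤ d)
    (hD : 0 < D) (hCD : ∀ x ∈ C, ∀ y ∈ C, ‖x - y‖ ≤ D) :
    ∃ B : ℝ, 0 ≤ B ∧ ∀ n k : ℕ, 1 ≤ k → k < n → ∀ l : Fin n,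
      Integrable (fun x : Fin n → EuclideanSpace ℝ (Fin d) =>
        unitBallVol d * kthRadius x (Finset.univ.erase l) k (x l) ^ d)
        (Measure.pi fun _ => densityMeasure f) ∧
      ∫ x : Fin n → EuclideanSpace ℝ (Fin d),
        unitBallVol d * kthRadius x (Finset.univ.erase l) k (x l) ^ d
        ∂(Measure.pi fun _ => densityMeasure f) ≤ B * (k / n) := by
  obtain ⟨c, hc, hlow⟩ := hf.exists_le_measureReal_closedBall hD hCD
  have hv := unitBallVol_pos d
  refine ⟨unitBallVol d / c, by positivity, fun n k hk1 hkn l => ⟨?_, ?_⟩⟩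
  · refine Integrable.of_bound
      (((measurable_kthRadius_apply _ k l).pow_const d).const_mul _).aestronglyMeasurable
      (unitBallVol d * D ^ d) ?_
    filter_upwards [ae_pi_forall_mem hf.ae_mem n] with x hx
    have h0 := kthRadius_nonneg x (Finset.univ.erase l) k (x l)
    rw [Real.norm_of_nonneg (by positivity)]
    have := kthRadius_apply_le hD.le hCD hx (Finset.univ.erase l) k l
    gcongr
  obtain ⟨N, rfl⟩ : ∃ N, n = N + 1 := ⟨n - 1, by omega⟩
  have hk : k ≤ N := by omega
  rw [integral_pi_kthRadius (densityMeasure f) l k fun _ r => unitBallVol d * r ^ d]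
  have hU := measurable_ballContent (densityMeasure f) (Finset.univ : Finset (Fin N)) k
  have hUi : Integrable (fun q : EuclideanSpace ℝ (Fin d) × (Fin N → EuclideanSpace ℝ (Fin d)) =>
      ballContent (densityMeasure f) q.2 Finset.univ k q.1)
      ((densityMeasure f).prod (Measure.pi fun _ => densityMeasure f)) :=
    Integrable.of_bound hU.aestronglyMeasurable 1 (ae_of_all _ fun q => by
      rw [Real.norm_of_nonneg (by exact measureReal_nonneg)]
      exact measureReal_le_one)
  have hle : ∫ q : EuclideanSpace ℝ (Fin d) × (Fin N → EuclideanSpace ℝ (Fin d)),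
      unitBallVol d * kthRadius q.2 Finset.univ k q.1 ^ d
      ∂((densityMeasure f).prod (Measure.pi fun _ => densityMeasure f)) ≤
      ∫ q : EuclideanSpace ℝ (Fin d) × (Fin N → EuclideanSpace ℝ (Fin d)),
        unitBallVol d / c * ballContent (densityMeasure f) q.2 Finset.univ k q.1
      ∂((densityMeasure f).prod (Measure.pi fun _ => densityMeasure f)) := by
    refine integral_mono_of_nonneg (ae_of_all _ fun q => ?_) (hUi.const_mul _) ?_
    · exact mul_nonneg hv.le (pow_nonneg (kthRadius_nonneg _ _ _ _) d)
    · filter_upwards [ae_prod_pi_forall_mem hf.ae_mem N] with q hq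
      have := hlow q.1 hq.1 (kthRadius q.2 Finset.univ k q.1) (kthRadius_nonneg _ _ _ _)
        (kthRadius_le_of_forall _ _ _ hD.le fun l _ => hCD _ (hq.2 l) _ hq.1)
      rw [div_mul_eq_mul_div, le_div_iff₀ hc, mul_assoc, mul_comm _ c]
      exact mul_le_mul_of_nonneg_left this hv.le
  refine hle.trans (le_of_eq ?_)
  rw [integral_const_mul, integral_prod _ hUi]
  have hk0 : (0 : ℝ) < k := by exact_mod_cast hk1
  -- The first moment is exactly `k/n`, whatever the centre.
  have hmom : ∀ a, ∫ y, ballContent (densityMeasure f) y Finset.univ k a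
      ∂(Measure.pi fun _ : Fin N => densityMeasure f) = (k : ℝ) / (N + 1 : ℕ) := by
    intro a
    have h := integral_ballContent_rpow hk1 hk (densityMeasure f) a
      (measure_sphere (f := f) hd a) one_pos
    simp only [Real.rpow_one] at h
    have h1 := Real.Gamma_pos_of_pos hk0
    have h2 := Real.Gamma_pos_of_pos (show (0 : ℝ) < N + 1 by positivity)
    rw [h, Real.Gamma_add_one hk0.ne', Real.Gamma_add_one (show (N : ℝ) + 1 ≠ 0 by positivity)]
    push_cast
    field_simp
  simp only [hmom]
  simp

end IsRegularDensity

end Variance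

/-! ### Variance of the estimator on the product space. -/

section Variance

variable {d : ℕ} {f : EuclideanSpace ℝ (Fin d) → ℝ} {C : Set (EuclideanSpace ℝ (Fin d))}

theorem measurable_sum_truncSqrtVol {n : ℕ} {H : EuclideanSpace ℝ (Fin d) → ℝ} (hH : Measurable H)
    (D : ℝ) (S : Finset (Fin n)) (T : Fin n → Finset (Fin n)) (k : ℕ) :
    Measurable fun x : Fin n → EuclideanSpace ℝ (Fin d) =>
      ∑ l ∈ S, H (x l) * truncSqrtVol d D (kthRadius x (T l) k (x l)) :=
  Finset.measurable_sum _ fun l _ => (hH.comp (measurable_pi_apply l)).mul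
    ((measurable_truncSqrtVol d D).comp (measurable_kthRadius_apply (T l) k l))

namespace IsRegularDensity

variable [IsProbabilityMeasure (densityMeasure f)]

theorem exists_integral_sq_knnSum_le (hf : IsRegularDensity f C) (hd : 1 ≤ d) {D : ℝ}
    (hD : 0 < D) (hCD : ∀ x ∈ C, ∀ y ∈ C, ‖x - y‖ ≤ D)
    {H : EuclideanSpace ℝ (Fin d) → ℝ} (hH : Measurable H) {M : ℝ} (hM : ∀ x, |H x| ≤ M) :
    ∃ K : ℝ, 0 ≤ K ∧ ∀ n k : ℕ, 1 ≤ k → k < n →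
      ∫ x : Fin n → EuclideanSpace ℝ (Fin d), knnSum d H D k x ^ 2
          ∂(Measure.pi fun _ => densityMeasure f) -
        (∫ x : Fin n → EuclideanSpace ℝ (Fin d), knnSum d H D k x
          ∂(Measure.pi fun _ => densityMeasure f)) ^ 2 ≤ K * k ^ 3 := by
  obtain ⟨s, hs⟩ := exists_finset_direction (EuclideanSpace ℝ (Fin d))
  obtain ⟨B, hB, hvol⟩ := hf.exists_integral_volume_le hd hD hCD
  -- The constant absorbs `(k + 1) ^ 2 ≤ 4 * k ^ 2` and `s.card * k + 1 ≤ (s.card + 1) * k`.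
  refine ⟨4 * M ^ 2 * B * (s.card + 1), by positivity, fun n k hk1 hkn => ?_⟩
  set π : Measure (Fin n → EuclideanSpace ℝ (Fin d)) := Measure.pi fun _ => densityMeasure f
  have hk1' : (1 : ℝ) ≤ k := by exact_mod_cast hk1
  have hn : (0 : ℝ) < n := by exact_mod_cast (by omega : 0 < n)
  have hFm : Measurable fun x : Fin n → EuclideanSpace ℝ (Fin d) => knnSum d H D k x :=
    measurable_sum_truncSqrtVol hH D _ _ k
  have hFM : ∀ x : Fin n → EuclideanSpace ℝ (Fin d),
      |knnSum d H D k x| ≤ n * (M * √(unitBallVol d * D ^ d)) := fun x =>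
    abs_knnSum_le hM hD.le _ _ k x
  have hF2 := memLp_two_of_measurable_of_abs_le π hFm hFM
  -- If `n = k + 1`, there is no `(k+1)`-st neighbour; the second moment is then at most a multiple
  -- of `n * k`, hence `O(k ^ 2)`.
  rcases (show k + 1 < n ∨ n = k + 1 by omega) with hk | hk
  · have hGm : ∀ i, Measurable fun x : Fin n → EuclideanSpace ℝ (Fin d) =>
        knnSumErase d H D k i x := fun i => measurable_sum_truncSqrtVol hH D _ _ k
    have hGM : ∀ i, ∀ x : Fin n → EuclideanSpace ℝ (Fin d),
        |knnSumErase d H D k i x| ≤ n * (M * √(unitBallVol d * D ^ d)) := fun i x =>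
      abs_knnSum_le hM hD.le _ _ k x
    have hint : ∀ i, Integrable (fun x => (knnSum d H D k x - knnSumErase d H D k i x) ^ 2) π :=
      fun i => (hF2.sub (memLp_two_of_measurable_of_abs_le π (hGm i) (hGM i))).integrable_sq
    have hvi := fun l => (hvol n (k + 1) (by omega) hk l).1
    calc _ ≤ ∑ i, ∫ x, (knnSum d H D k x - knnSumErase d H D k i x) ^ 2 ∂π :=
          efron_stein (densityMeasure f) hFm hGm hFM hGM fun i x a =>
            knnSumErase_update H D k i x a
      _ = ∫ x, ∑ i, (knnSum d H D k x - knnSumErase d H D k i x) ^ 2 ∂π :=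
          (integral_finsetSum _ fun i _ => hint i).symm
      _ ≤ ∫ x, M ^ 2 * (s.card * k + 1) * (k + 1) * ∑ l, unitBallVol d *
            kthRadius x (Finset.univ.erase l) (k + 1) (x l) ^ d ∂π :=
          integral_mono (integrable_finsetSum _ fun i _ => hint i)
            ((integrable_finsetSum _ fun l _ => hvi l).const_mul _)
            fun x => sum_sq_knnSum_sub_knnSumErase_le hs hM hD.le hk x
      _ = M ^ 2 * (s.card * k + 1) * (k + 1) * ∑ l, ∫ x, unitBallVol d *
            kthRadius x (Finset.univ.erase l) (k + 1) (x l) ^ d ∂π := by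
          rw [integral_const_mul, integral_finsetSum _ fun l _ => hvi l]
      _ ≤ M ^ 2 * (s.card * k + 1) * (k + 1) * ∑ _l : Fin n, B * ((k + 1 : ℕ) / n) := by
          gcongr with l
          exact (hvol n (k + 1) (by omega) hk l).2
      _ = M ^ 2 * B * (s.card * k + 1) * ((k + 1) * (k + 1)) := by
          rw [Finset.sum_const, Finset.card_univ, Fintype.card_fin, nsmul_eq_mul]
          push_cast
          field_simp
      _ ≤ M ^ 2 * B * (s.card * k + k) * ((k + k) * (k + k)) := by gcongr
      _ = _ := by ring
  · have hvi := fun l => (hvol n k hk1 hkn l).1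
    calc _ ≤ ∫ x, knnSum d H D k x ^ 2 ∂π := by
          have := sq_nonneg (∫ x, knnSum d H D k x ∂π)
          linarith
      _ ≤ ∫ x, M ^ 2 * n * ∑ l, unitBallVol d *
            kthRadius x (Finset.univ.erase l) k (x l) ^ d ∂π :=
          integral_mono hF2.integrable_sq ((integrable_finsetSum _ fun l _ => hvi l).const_mul _)
            fun x => knnSum_sq_le hM hD.le k x
      _ = M ^ 2 * n * ∑ l, ∫ x, unitBallVol d *
            kthRadius x (Finset.univ.erase l) k (x l) ^ d ∂π := by
          rw [integral_const_mul, integral_finsetSum _ fun l _ => hvi l]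
      _ ≤ M ^ 2 * n * ∑ _l : Fin n, B * (k / n) := by
          gcongr with l
          exact (hvol n k hk1 hkn l).2
      _ = M ^ 2 * B * (k + 1) * k * 1 * 1 := by
          rw [Finset.sum_const, Finset.card_univ, Fintype.card_fin, nsmul_eq_mul, hk]
          push_cast
          field_simp
      _ ≤ M ^ 2 * B * (k + k) * k * k * (2 * (s.card + 1)) := by
          gcongr
          have : (0 : ℝ) ≤ s.card := by positivity
          linarith
      _ = _ := by ring

/-- Variance bound for the estimator, uniform in `k` and `n`. -/
theorem exists_variance_knnEst_le (hf : IsRegularDensity f C) (hd : 1 ≤ d)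
    {H : EuclideanSpace ℝ (Fin d) → ℝ} (hH : Measurable H) {M : ℝ} (hM : ∀ x, |H x| ≤ M) :
    ∃ K : ℝ, 0 ≤ K ∧ ∀ n k : ℕ, 1 ≤ k → k < n →
      variance (fun x : Fin n → EuclideanSpace ℝ (Fin d) => knnEst H k x)
        (Measure.pi fun _ => densityMeasure f) ≤
        (k : ℝ) ^ 3 * gammaRatio k ^ 2 * (K * (n : ℝ)⁻¹) := by
  obtain ⟨D, hD, hCD⟩ := hf.exists_diam
  obtain ⟨K, hK, h⟩ := hf.exists_integral_sq_knnSum_le hd hD hCD hH hM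
  refine ⟨K, hK, fun n k hk1 hkn => ?_⟩
  have h := h n k hk1 hkn
  have hFm : Measurable fun x : Fin n → EuclideanSpace ℝ (Fin d) => knnSum d H D k x :=
    measurable_sum_truncSqrtVol hH D _ _ k
  have hF2 := memLp_two_of_measurable_of_abs_le (Measure.pi fun _ : Fin n => densityMeasure f) hFm
    fun x => abs_knnSum_le hM hD.le _ _ k x
  -- Efron-Stein is stated for everywhere bounded functions, hence the truncation at the diameter
  -- bound `D`. Almost surely all points lie in `C` and the truncation is inactive.
  have hae : (fun x : Fin n → EuclideanSpace ℝ (Fin d) => knnEst H k x)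
      =ᵐ[Measure.pi fun _ => densityMeasure f]
      fun x => gammaRatio k * (1 / √(n : ℝ)) * knnSum d H D k x := by
    filter_upwards [ae_pi_forall_mem hf.ae_mem n] with x hx
    rw [knnEst, knnSum]
    congr 1
    refine Finset.sum_congr rfl fun l _ => ?_
    rw [truncSqrtVol, min_eq_left (kthRadius_apply_le hD.le hCD hx _ k l)]
  rw [variance_congr hae, variance_const_mul, variance_eq_sub hF2]
  have hn : (0 : ℝ) < n := by exact_mod_cast (by omega : 0 < n)
  calc _ ≤ (gammaRatio k * (1 / √(n : ℝ))) ^ 2 * (K * k ^ 3) :=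
        mul_le_mul_of_nonneg_left h (sq_nonneg _)
    _ = _ := by
        rw [mul_pow, div_pow, Real.sq_sqrt hn.le]
        ring

end IsRegularDensity

end Variance

/-! ### Measurability of the wavelets up to null sets. -/

section Measurability

variable {d : ℕ}

theorem abs_dilate_le {h : EuclideanSpace ℝ (Fin d) → ℝ} {M : ℝ} (hM : ∀ x, |h x| ≤ M) (j : ℕ)
    (z : Fin d → ℤ) (x : EuclideanSpace ℝ (Fin d)) :
    |dilate h j z x| ≤ (2 : ℝ) ^ ((d : ℝ) * (j : ℝ) / 2) * M := by
  rw [dilate, abs_mul, abs_of_nonneg (by positivity)]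
  gcongr
  exact hM _

theorem aemeasurable_dilate {h : EuclideanSpace ℝ (Fin d) → ℝ} (hh : AEMeasurable h volume)
    (j : ℕ) (z : Fin d → ℤ) : AEMeasurable (dilate h j z) volume := by
  have h1 := Measure.quasiMeasurePreserving_smul
    (volume : Measure (EuclideanSpace ℝ (Fin d))) (r := (2 : ℝ) ^ j) (by positivity)
  have h2 := (measurePreserving_sub_right (volume : Measure (EuclideanSpace ℝ (Fin d)))
    (WithLp.toLp 2 fun i => (z i : ℝ))).quasiMeasurePreserving
  exact (hh.comp_quasiMeasurePreserving (h2.comp h1)).const_mul _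

theorem aemeasurable_of_dilate {h : EuclideanSpace ℝ (Fin d) → ℝ} {j : ℕ} {z : Fin d → ℤ}
    (hh : AEMeasurable (dilate h j z) volume) : AEMeasurable h volume := by
  set w : EuclideanSpace ℝ (Fin d) := WithLp.toLp 2 fun i => (z i : ℝ)
  have h1 := Measure.quasiMeasurePreserving_smul
    (volume : Measure (EuclideanSpace ℝ (Fin d))) (r := ((2 : ℝ) ^ j)⁻¹) (by positivity)
  have h2 := (measurePreserving_add_right (volume : Measure (EuclideanSpace ℝ (Fin d)))
    w).quasiMeasurePreserving
  have h3 := (hh.comp_quasiMeasurePreserving (h1.comp h2)).const_mul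
    ((2 : ℝ) ^ ((d : ℝ) * (j : ℝ) / 2))⁻¹
  refine h3.congr (ae_of_all _ fun x => ?_)
  have hc : (2 : ℝ) ^ ((d : ℝ) * (j : ℝ) / 2) ≠ 0 := by positivity
  simp only [Function.comp_apply, dilate]
  rw [inv_mul_cancel_left₀ hc, smul_inv_smul₀ (by positivity)]
  change h (x + w - w) = h x
  rw [add_sub_cancel_right]

theorem IsWaveletBasis.aemeasurable_waveletSystem {φ : EuclideanSpace ℝ (Fin d) → ℝ}
    {ψ : Fin (2 ^ d - 1) → EuclideanSpace ℝ (Fin d) → ℝ} {j₀ : ℕ} (h : IsWaveletBasis φ ψ j₀)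
    (i : WaveletIndex d j₀) : AEMeasurable (waveletSystem φ ψ j₀ i) volume := by
  obtain ⟨b, hb⟩ := h.basis
  exact (Lp.aestronglyMeasurable (b i)).aemeasurable.congr (hb i)

/-- A basis function agrees almost everywhere with an element of `L₂`, and undoing its dilation and
translation recovers `φ`. -/
theorem IsWaveletBasis.aemeasurable_father {φ : EuclideanSpace ℝ (Fin d) → ℝ}
    {ψ : Fin (2 ^ d - 1) → EuclideanSpace ℝ (Fin d) → ℝ} {j₀ : ℕ} (h : IsWaveletBasis φ ψ j₀) :
    AEMeasurable φ volume :=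
  aemeasurable_of_dilate (h.aemeasurable_waveletSystem (Sum.inl 0))

theorem IsWaveletBasis.aemeasurable_mother {φ : EuclideanSpace ℝ (Fin d) → ℝ}
    {ψ : Fin (2 ^ d - 1) → EuclideanSpace ℝ (Fin d) → ℝ} {j₀ : ℕ} (h : IsWaveletBasis φ ψ j₀)
    (q : Fin (2 ^ d - 1)) : AEMeasurable (ψ q) volume :=
  aemeasurable_of_dilate (h.aemeasurable_waveletSystem (Sum.inr (⟨j₀, le_rfl⟩, 0, q)))

/-- Clipping a measurable modification makes the bound hold everywhere. The level is `max M 0`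
because `M` may be negative when `α` is empty. -/
theorem exists_measurable_abs_le_ae_eq {α : Type*} [MeasurableSpace α] {μ : Measure α} {H : α → ℝ}
    (hH : AEMeasurable H μ) {M : ℝ} (hM : ∀ x, |H x| ≤ M) :
    ∃ H' : α → ℝ, Measurable H' ∧ (∀ x, |H' x| ≤ max M 0) ∧ H =ᵐ[μ] H' := by
  refine ⟨fun x => max (-(max M 0)) (min (max M 0) (hH.mk H x)),
    measurable_const.max (measurable_const.min hH.measurable_mk), fun x => ?_, ?_⟩
  · have : 0 ≤ max M 0 := le_max_right _ _
    exact abs_le.2 ⟨le_max_left _ _, max_le (by linarith) (min_le_left _ _)⟩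
  · filter_upwards [hH.ae_eq_mk] with x hx
    have h1 := abs_le.1 ((hM x).trans (le_max_left M 0))
    rw [← hx, min_eq_right h1.2, max_eq_right h1.1]

end Measurability

/-! ### Transfer from the random sequence to the product space. -/

section Estimator

variable {d : ℕ}

theorem nnRadius_eq_kthRadius (x : ℕ → EuclideanSpace ℝ (Fin d)) {n : ℕ} (k : ℕ) (i : Fin n) :
    nnRadius x n k i = kthRadius (fun l : Fin n => x l) (Finset.univ.erase i) k (x i) := by
  have : ∀ r, ((Finset.range n).filter fun l : ℕ => l ≠ i ∧ ‖x l - x i‖ ≤ r).card =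
      ballCount (fun l : Fin n => x l) (Finset.univ.erase i) (x i) r := fun r => by
    rw [ballCount, Finset.card_filter, Finset.sum_range, ← Finset.card_filter]
    congr 1
    ext l
    simp [Fin.ext_iff]
  simp only [nnRadius, this, kthRadius]

theorem coefEst_eq_knnEst (h : EuclideanSpace ℝ (Fin d) → ℝ) (j : ℕ) (z : Fin d → ℤ) (n k : ℕ)
    (x : ℕ → EuclideanSpace ℝ (Fin d)) :
    coefEst h j z n k x = knnEst (dilate h j z) k fun l : Fin n => x l := by
  rw [coefEst, knnEst, Finset.sum_range]
  simp only [nnVolume, nnRadius_eq_kthRadius]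

variable {Ω : Type*} [MeasurableSpace Ω] {P : Measure Ω}
  {X : ℕ → Ω → EuclideanSpace ℝ (Fin d)} {f : EuclideanSpace ℝ (Fin d) → ℝ}

/-- The law of each sample point is absolutely continuous, so almost surely no sample point hits the
null set where the two weights differ. -/
theorem IsIIDSample.coefEst_ae_eq (hX : IsIIDSample P X f) {h : EuclideanSpace ℝ (Fin d) → ℝ}
    {j : ℕ} {z : Fin d → ℤ} {H : EuclideanSpace ℝ (Fin d) → ℝ} (hH : dilate h j z =ᵐ[volume] H)
    (n k : ℕ) : (fun ω => coefEst h j z n k fun i => X i ω) =ᵐ[P]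
      fun ω => knnEst H k fun i : Fin n => X i ω := by
  have h1 : ∀ i, ∀ᵐ ω ∂P, dilate h j z (X i ω) = H (X i ω) := fun i => by
    refine ae_of_ae_map (p := fun y => dilate h j z y = H y) (hX.measurable i).aemeasurable ?_
    rw [hX.law i]
    exact withDensity_absolutelyContinuous _ _ hH
  filter_upwards [ae_all_iff.2 h1] with ω hω
  rw [coefEst_eq_knnEst, knnEst, knnEst]
  simp only [hω]

variable [IsProbabilityMeasure P]

theorem IsIIDSample.isProbabilityMeasure (hX : IsIIDSample P X f) :
    IsProbabilityMeasure (densityMeasure f) := by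
  rw [densityMeasure, ← hX.law 0]
  exact Measure.isProbabilityMeasure_map (hX.measurable 0).aemeasurable

theorem IsIIDSample.measurePreserving (hX : IsIIDSample P X f) (n : ℕ) :
    MeasurePreserving (fun ω (i : Fin n) => X i ω) P (Measure.pi fun _ => densityMeasure f) := by
  refine ⟨measurable_pi_lambda _ fun i => hX.measurable i, ?_⟩
  have h := (iIndepFun_iff_map_fun_eq_pi_map fun i : Fin n =>
    (hX.measurable i).aemeasurable).1 (hX.indep.precomp Fin.val_injective)
  rw [h]
  simp only [hX.law]

end Estimator

/-! ### Mean square error and convergence in probability. -/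

section MeanSquare

variable {Ω : Type*} [MeasurableSpace Ω] {P : Measure Ω} [IsProbabilityMeasure P]

theorem integral_sub_const_sq {Y : Ω → ℝ} (hY : MemLp Y 2 P) (c : ℝ) :
    ∫ ω, (Y ω - c) ^ 2 ∂P = variance Y P + (∫ ω, Y ω ∂P - c) ^ 2 := by
  have hc : MemLp (fun ω => Y ω - c) 2 P := hY.sub (memLp_const c)
  have h1 := variance_eq_sub hc
  rw [variance_sub_const hY.aestronglyMeasurable, integral_sub (hY.integrable one_le_two)
    (integrable_const c)] at h1
  simp only [integral_const, probReal_univ, one_smul] at h1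
  rw [h1]
  simp

theorem tendstoInMeasure_of_tendsto_integral_sq {Y : ℕ → Ω → ℝ} (hY : ∀ n, MemLp (Y n) 2 P) {c : ℝ}
    (h : Tendsto (fun n => ∫ ω, (Y n ω - c) ^ 2 ∂P) atTop (𝓝 0)) :
    TendstoInMeasure P Y atTop fun _ => c := by
  refine tendstoInMeasure_of_tendsto_eLpNorm two_ne_zero (fun n => (hY n).aestronglyMeasurable)
    aestronglyMeasurable_const ?_
  have h1 : ∀ n, eLpNorm (Y n - fun _ => c) 2 P =
      ENNReal.ofReal ((∫ ω, (Y n ω - c) ^ 2 ∂P) ^ (2 : ℝ)⁻¹) := fun n => by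
    rw [((hY n).sub (memLp_const c)).eLpNorm_eq_integral_rpow_norm two_ne_zero ENNReal.ofNat_ne_top]
    simp
  simp only [h1]
  have h2 := (h.rpow_const (p := (2 : ℝ)⁻¹) (Or.inr (by norm_num)))
  rw [Real.zero_rpow (by norm_num)] at h2
  simpa using ENNReal.tendsto_ofReal h2

end MeanSquare

/-! ### Bias, variance and consistency of the coefficient estimators. -/

section Main

variable {d : ℕ} {Ω : Type*} [MeasurableSpace Ω] {P : Measure Ω} [IsProbabilityMeasure P]
  {X : ℕ → Ω → EuclideanSpace ℝ (Fin d)} {f : EuclideanSpace ℝ (Fin d) → ℝ}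
  {C : Set (EuclideanSpace ℝ (Fin d))} {h : EuclideanSpace ℝ (Fin d) → ℝ}

theorem IsIIDSample.memLp_coefEst (hX : IsIIDSample P X f) (hf : IsRegularDensity f C)
    (hh : AEMeasurable h volume) (hM : ∃ M : ℝ, ∀ x, |h x| ≤ M) (j : ℕ) (z : Fin d → ℤ) (n k : ℕ) :
    MemLp (fun ω => coefEst h j z n k fun i => X i ω) 2 P := by
  have := hX.isProbabilityMeasure
  obtain ⟨M, hM⟩ := hM
  obtain ⟨H, hHm, hHM, hH⟩ := exists_measurable_abs_le_ae_eq (aemeasurable_dilate hh j z)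
    (abs_dilate_le hM j z)
  exact ((hf.memLp_knnEst n k hHm hHM).comp_measurePreserving (hX.measurePreserving n)).ae_eq
    (hX.coefEst_ae_eq hH n k).symm

theorem IsIIDSample.exists_abs_bias_coefEst_le (hX : IsIIDSample P X f)
    (hf : IsRegularDensity f C) (hd : 1 ≤ d) (hh : AEMeasurable h volume)
    (hM : ∃ M : ℝ, ∀ x, |h x| ≤ M) (j : ℕ) (z : Fin d → ℤ) :
    ∃ K : ℝ, 0 ≤ K ∧ ∀ n k : ℕ, 1 ≤ k → k < n →
      |∫ ω, coefEst h j z n k (fun i => X i ω) ∂P - sqrtCoef f h j z| ≤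
        K * ((k : ℝ) / n) ^ (1 / (d : ℝ)) := by
  have := hX.isProbabilityMeasure
  obtain ⟨M, hM⟩ := hM
  obtain ⟨H, hHm, hHM, hH⟩ := exists_measurable_abs_le_ae_eq (aemeasurable_dilate hh j z)
    (abs_dilate_le hM j z)
  obtain ⟨K, hK, hb⟩ := hf.exists_abs_bias_le hd hHm hHM
  refine ⟨K, hK, fun n k hk1 hkn => ?_⟩
  have h1 : sqrtCoef f h j z = ∫ x, H x * √(f x) :=
    integral_congr_ae (hH.mul (ae_eq_refl _))
  rw [h1, integral_congr_ae (hX.coefEst_ae_eq hH n k)]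
  have h2 := integral_map (hX.measurePreserving n).measurable.aemeasurable
    (measurable_knnEst hHm k).aestronglyMeasurable (μ := P)
  rw [(hX.measurePreserving n).map_eq] at h2
  rw [← h2]
  exact hb n k hk1 hkn

theorem IsIIDSample.exists_variance_coefEst_le (hX : IsIIDSample P X f)
    (hf : IsRegularDensity f C) (hd : 1 ≤ d) (hh : AEMeasurable h volume)
    (hM : ∃ M : ℝ, ∀ x, |h x| ≤ M) (j : ℕ) (z : Fin d → ℤ) :
    ∃ K : ℝ, 0 ≤ K ∧ ∀ n k : ℕ, 1 ≤ k → k < n →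
      variance (fun ω => coefEst h j z n k fun i => X i ω) P ≤
        (k : ℝ) ^ 3 * gammaRatio k ^ 2 * (K * (n : ℝ)⁻¹) := by
  have := hX.isProbabilityMeasure
  obtain ⟨M, hM⟩ := hM
  obtain ⟨H, hHm, hHM, hH⟩ := exists_measurable_abs_le_ae_eq (aemeasurable_dilate hh j z)
    (abs_dilate_le hM j z)
  obtain ⟨K, hK, hb⟩ := hf.exists_variance_knnEst_le hd hHm hHM
  refine ⟨K, hK, fun n k hk1 hkn => ?_⟩
  rw [variance_congr (hX.coefEst_ae_eq hH n k)]
  have h2 := variance_map (measurable_knnEst hHm k).aemeasurable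
    (hX.measurePreserving n).measurable.aemeasurable (μ := P)
  rw [(hX.measurePreserving n).map_eq] at h2
  exact h2.symm.trans_le (hb n k hk1 hkn)

theorem IsIIDSample.isBigO_bias_coefEst (hX : IsIIDSample P X f)
    (hf : IsRegularDensity f C) (hd : 1 ≤ d) (hh : AEMeasurable h volume)
    (hM : ∃ M : ℝ, ∀ x, |h x| ≤ M) (j : ℕ) (z : Fin d → ℤ) {k : ℕ} (hk : 1 ≤ k) :
    (fun n : ℕ => (∫ ω, coefEst h j z n k (fun i => X i ω) ∂P) - sqrtCoef f h j z)
      =O[atTop] fun n : ℕ => (n : ℝ) ^ (-(1 / (d : ℝ))) := by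
  obtain ⟨K, hK, hb⟩ := hX.exists_abs_bias_coefEst_le hf hd hh hM j z
  refine IsBigO.of_bound (K * (k : ℝ) ^ (1 / (d : ℝ))) ?_
  filter_upwards [eventually_gt_atTop k] with n hn
  refine (hb n k hk hn).trans (le_of_eq ?_)
  rw [Real.norm_of_nonneg (by positivity), Real.div_rpow (by positivity) (by positivity),
    Real.rpow_neg (by positivity), div_eq_mul_inv, mul_assoc]

theorem IsIIDSample.tendsto_integral_sq_coefEst (hX : IsIIDSample P X f)
    (hf : IsRegularDensity f C) (hd : 1 ≤ d) (hh : AEMeasurable h volume)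
    (hM : ∃ M : ℝ, ∀ x, |h x| ≤ M) (j : ℕ) (z : Fin d → ℤ) {k : ℕ → ℕ} (hk : ∀ n, 1 ≤ k n)
    (hkn : (fun n : ℕ => (k n : ℝ) ^ (3 / 2 : ℝ) * gammaRatio (k n))
      =o[atTop] fun n : ℕ => (n : ℝ) ^ (1 / 2 : ℝ)) :
    Tendsto (fun n : ℕ =>
      ∫ ω, (coefEst h j z n (k n) (fun i => X i ω) - sqrtCoef f h j z) ^ 2 ∂P) atTop (𝓝 0) := by
  obtain ⟨K₁, hK₁, hb⟩ := hX.exists_abs_bias_coefEst_le hf hd hh hM j z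
  obtain ⟨K₂, hK₂, hv⟩ := hX.exists_variance_coefEst_le hf hd hh hM j z
  set a : ℕ → ℝ := fun n => ((k n : ℝ) ^ (3 / 2 : ℝ) * gammaRatio (k n)) / (n : ℝ) ^ (1 / 2 : ℝ)
  have ha : Tendsto a atTop (𝓝 0) := by
    refine (isLittleO_iff_tendsto' ?_).1 hkn
    filter_upwards [eventually_gt_atTop 0] with n hn h0
    have : (0 : ℝ) < n := by exact_mod_cast hn
    exact absurd h0 (by positivity)
  have ha2 : Tendsto (fun n => a n ^ 2) atTop (𝓝 0) := by
    simpa using ha.pow 2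
  have hsq : ∀ n : ℕ, a n ^ 2 = (k n : ℝ) ^ 3 * gammaRatio (k n) ^ 2 * (n : ℝ)⁻¹ := fun n => by
    simp only [a]
    rw [div_pow, mul_pow, ← Real.rpow_natCast _ 2, ← Real.rpow_mul (by positivity),
      ← Real.sqrt_eq_rpow, Real.sq_sqrt (by positivity), div_eq_mul_inv]
    norm_num
  -- Since `k ≥ 1` and `k * gammaRatio k ^ 2 ≥ 1` by Wendel, the growth condition controls `k/n`. It
  -- yields both `k n < n` eventually and a vanishing bias.
  have hratio : ∀ n : ℕ, (k n : ℝ) / n ≤ a n ^ 2 := fun n => by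
    rw [hsq, div_eq_mul_inv]
    have h1 : (1 : ℝ) ≤ k n := by exact_mod_cast hk n
    have h2 := one_le_sqrt_mul_gammaRatio (hk n)
    have h3 : 1 ≤ (k n : ℝ) * gammaRatio (k n) ^ 2 := by
      calc (1 : ℝ) = 1 ^ 2 := by norm_num
        _ ≤ (√(k n : ℝ) * gammaRatio (k n)) ^ 2 := by gcongr
        _ = _ := by rw [mul_pow, Real.sq_sqrt (by positivity)]
    gcongr
    calc (k n : ℝ) = k n * 1 * 1 := by ring
      _ ≤ k n * k n * (k n * gammaRatio (k n) ^ 2) := by gcongr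
      _ = _ := by ring
  have hlim : Tendsto (fun n => K₂ * a n ^ 2 + (K₁ * (a n ^ 2) ^ (1 / (d : ℝ))) ^ 2) atTop
      (𝓝 0) := by
    have hd0 : 0 < 1 / (d : ℝ) := by
      have : (0 : ℝ) < d := by exact_mod_cast hd
      positivity
    have h1 := ha2.rpow_const (p := 1 / (d : ℝ)) (Or.inr hd0.le)
    rw [Real.zero_rpow hd0.ne'] at h1
    simpa using (ha2.const_mul K₂).add ((h1.const_mul K₁).pow 2)
  refine squeeze_zero' (Eventually.of_forall fun n => integral_nonneg fun ω => sq_nonneg _) ?_ hlim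
  filter_upwards [ha2.eventually (gt_mem_nhds one_pos), eventually_gt_atTop 0] with n hn hn0
  have hn0' : (0 : ℝ) < n := by exact_mod_cast hn0
  have hlt : k n < n := by
    have := (hratio n).trans_lt hn
    rw [div_lt_one hn0'] at this
    exact_mod_cast this
  rw [integral_sub_const_sq (hX.memLp_coefEst hf hh hM j z n (k n))]
  refine add_le_add ((hv n (k n) (hk n) hlt).trans (le_of_eq ?_)) ?_
  · rw [hsq]
    ring
  · rw [← sq_abs]
    refine pow_le_pow_left₀ (abs_nonneg _) ((hb n (k n) (hk n) hlt).trans ?_) 2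
    have := hratio n
    gcongr

end Main

theorem mainTheorem4 {d : ℕ} (hd : 1 ≤ d)
    {Ω : Type*} [MeasurableSpace Ω] (P : Measure Ω) [IsProbabilityMeasure P]
    (X : ℕ → Ω → EuclideanSpace ℝ (Fin d))
    (f : EuclideanSpace ℝ (Fin d) → ℝ) (C : Set (EuclideanSpace ℝ (Fin d)))
    (φ : EuclideanSpace ℝ (Fin d) → ℝ) (ψ : Fin (2 ^ d - 1) → EuclideanSpace ℝ (Fin d) → ℝ)
    (j₀ : ℕ)
    (hX : IsIIDSample P X f) (hwav : IsWaveletBasis φ ψ j₀) (hf : IsRegularDensity f C)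
    (j : ℕ) (hj : j₀ ≤ j) (z : Fin d → ℤ) :
    -- the coefficients of the father wavelet
    ((∀ n k : ℕ, MemLp (fun ω => coefEst φ j z n k fun i => X i ω) 2 P) ∧
      (∀ k : ℕ, 1 ≤ k →
        (fun n : ℕ => (∫ ω, coefEst φ j z n k (fun i => X i ω) ∂P) - sqrtCoef f φ j z)
          =O[atTop] fun n : ℕ => (n : ℝ) ^ (-(1 / (d : ℝ)))) ∧
      (∃ K : ℝ, ∀ n k : ℕ, 1 ≤ k → k < n →
        variance (fun ω => coefEst φ j z n k fun i => X i ω) P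
          ≤ (k : ℝ) ^ 3 * gammaRatio k ^ 2 * (K * (n : ℝ)⁻¹)) ∧
      (∀ k : ℕ → ℕ, (∀ n, 1 ≤ k n) →
        ((fun n : ℕ => (k n : ℝ) ^ (3 / 2 : ℝ) * gammaRatio (k n))
          =o[atTop] fun n : ℕ => (n : ℝ) ^ (1 / 2 : ℝ)) →
        Tendsto (fun n : ℕ =>
          ∫ ω, (coefEst φ j z n (k n) (fun i => X i ω) - sqrtCoef f φ j z) ^ 2 ∂P)
          atTop (𝓝 0) ∧
        TendstoInMeasure P (fun (n : ℕ) ω => coefEst φ j z n (k n) fun i => X i ω) atTop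
          (fun _ => sqrtCoef f φ j z))) ∧
    -- the coefficients of the mother wavelets
    (∀ q : Fin (2 ^ d - 1),
      (∀ n k : ℕ, MemLp (fun ω => coefEst (ψ q) j z n k fun i => X i ω) 2 P) ∧
      (∀ k : ℕ, 1 ≤ k →
        (fun n : ℕ => (∫ ω, coefEst (ψ q) j z n k (fun i => X i ω) ∂P) - sqrtCoef f (ψ q) j z)
          =O[atTop] fun n : ℕ => (n : ℝ) ^ (-(1 / (d : ℝ)))) ∧
      (∃ K : ℝ, ∀ n k : ℕ, 1 ≤ k → k < n →
        variance (fun ω => coefEst (ψ q) j z n k fun i => X i ω) P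
          ≤ (k : ℝ) ^ 3 * gammaRatio k ^ 2 * (K * (n : ℝ)⁻¹)) ∧
      (∀ k : ℕ → ℕ, (∀ n, 1 ≤ k n) →
        ((fun n : ℕ => (k n : ℝ) ^ (3 / 2 : ℝ) * gammaRatio (k n))
          =o[atTop] fun n : ℕ => (n : ℝ) ^ (1 / 2 : ℝ)) →
        Tendsto (fun n : ℕ =>
          ∫ ω, (coefEst (ψ q) j z n (k n) (fun i => X i ω) - sqrtCoef f (ψ q) j z) ^ 2 ∂P)
          atTop (𝓝 0) ∧
        TendstoInMeasure P (fun (n : ℕ) ω => coefEst (ψ q) j z n (k n) fun i => X i ω) atTop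
          (fun _ => sqrtCoef f (ψ q) j z))) := by

  have key : ∀ h : EuclideanSpace ℝ (Fin d) → ℝ, AEMeasurable h volume →
      (∃ M : ℝ, ∀ x, |h x| ≤ M) →
      (∀ n k : ℕ, MemLp (fun ω => coefEst h j z n k fun i => X i ω) 2 P) ∧
      (∀ k : ℕ, 1 ≤ k →
        (fun n : ℕ => (∫ ω, coefEst h j z n k (fun i => X i ω) ∂P) - sqrtCoef f h j z)
          =O[atTop] fun n : ℕ => (n : ℝ) ^ (-(1 / (d : ℝ)))) ∧
      (∃ K : ℝ, ∀ n k : ℕ, 1 ≤ k → k < n →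
        variance (fun ω => coefEst h j z n k fun i => X i ω) P
          ≤ (k : ℝ) ^ 3 * gammaRatio k ^ 2 * (K * (n : ℝ)⁻¹)) ∧
      (∀ k : ℕ → ℕ, (∀ n, 1 ≤ k n) →
        ((fun n : ℕ => (k n : ℝ) ^ (3 / 2 : ℝ) * gammaRatio (k n))
          =o[atTop] fun n : ℕ => (n : ℝ) ^ (1 / 2 : ℝ)) →
        Tendsto (fun n : ℕ =>
          ∫ ω, (coefEst h j z n (k n) (fun i => X i ω) - sqrtCoef f h j z) ^ 2 ∂P)
          atTop (𝓝 0) ∧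
        TendstoInMeasure P (fun (n : ℕ) ω => coefEst h j z n (k n) fun i => X i ω) atTop
          (fun _ => sqrtCoef f h j z)) := fun h hh hM =>
    ⟨hX.memLp_coefEst hf hh hM j z, fun _ hk => hX.isBigO_bias_coefEst hf hd hh hM j z hk,
      (hX.exists_variance_coefEst_le hf hd hh hM j z).imp fun _ hK => hK.2,
      fun _ hk hkn =>
        have hlim := hX.tendsto_integral_sq_coefEst hf hd hh hM j z hk hkn
        ⟨hlim, tendstoInMeasure_of_tendsto_integral_sq
          (fun n => hX.memLp_coefEst hf hh hM j z n _) hlim⟩⟩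
  exact ⟨key φ hwav.aemeasurable_father hwav.father_bounded,
    fun q => key (ψ q) (hwav.aemeasurable_mother q) (hwav.mother_bounded q)⟩
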